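/- **Setting.** Let $J\ge 1$, let $n_1,\dots,n_J\ge 1$ with $n=n_1+\dots+n_J$, and let $a_1,\dots,a_J$, $\lambda_1,\dots,\lambda_J\in\mathbb C$ satisfy $a_1=\lambda_1=0$ and $0\le \operatorname{Re}\lambda_j<1$ for all $j$. Let $J_m$ be the nilpotent Jordan block of size $m$ (ones on the superdiagonal), $L=\bigoplus_j(\lambda_jI_{n_j}+J_{n_j})$ and $Q(1/x)=\bigoplus_j\frac{-a_j}{x}I_{n_j}$. Consider a linear system $x^2\,\frac{dY}{dx}=A(x)Y$ with $A\in M_n(\mathbb C\{x\})$ having a formal fundamental solution $\widetilde F(x)\,x^Le^{Q(1/x)}$ with $\widetilde F(x)=I_n+\sum_{m\ge1}F_mx^m\in M_n(\mathbb C[[x]])$; that is, $x^2\widetilde F'=A\widetilde F-\widetilde FA_0$ with $A_0=\bigoplus_j\big(a_jI_{n_j}+x(\lambda_jI_{n_j}+J_{n_j})\big)$. The $a_j$ need not be distinct. Let $\Omega=\{a_1,\dots,a_J\}$, let $\widetilde f$ be the first $n_1$ columns of $\widetilde F$, and let $\widehat f(\xi)=\sum_{m\ge1}f_m\frac{\xi^{m-1}}{(m-1)!}$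 be its Borel transform (apart from the term $\delta\, I_{n,n_1}$), where $\widetilde f=\sum_{m\ge 0} f_mx^m$. Matrices with $n$ rows are split into row-blocks $M^{j;\bullet}$ of $n_j$ rows. **Definitions.** For a finite set $\Omega'\ni 0$, a *resurgent function* with singular support $\Omega'$ is a holomorphic germ at $0$ that can be continued analytically along every path issuing from $0$ and lying in $\mathbb C\setminus\Omega'$ except for its starting point. It is *summable-resurgent*, written $h\in\widehat{\mathcal Res}{}^{\rm sum}_{\Omega'}$, if moreover, for every such path followed by a sector $\{|\xi|>\rho,\ \alpha<\arg\xi<\beta\}$ of finite opening (possibly larger than $2\pi$) at positive distance from $\Omega'$, its continuation to that sector is bounded by $Ce^{c|\xi|}$ for large $|\xi|$. A *path from $0$ towards* $\omega\in\Omega$ is a path from $0$, lying in $\mathbb C\setminus\Omega$ except for its starting point, which ends at a point of an open disc $D$ centred at $\omega$ with $D\cap\Omega=\{\omega\}$. If $\varphi$ is a holomorphic germ at $0$ on the Riemann surface of the logarithm, a *major* of its singularity at $0$ is a germ of the same kind that differs from $\varphi$ by a holomorphic germ at $0$ in $\mathbb C$. The singularity is *simple-moderate with exponents in* a finite set $\Lambda\subset\{\mu:0\le\operatorname{Re}\mu<1,\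 \mu\ne0\}$ if it has a major of the form $$\sum_{p=0}^{N_0}c_p\frac{\ln^p\xi}{\xi}+\sum_{p=1}^{N_0+1}h_p(\xi)\ln^p\xi+\sum_{\mu\in\Lambda}\sum_{p=0}^{N_\mu}\big(c_{\mu,p}\,\xi^{\mu-1}\ln^p\xi+H_{\mu,p}(\xi)\,\xi^{\mu}\ln^p\xi\big)$$ with constants $c_p,c_{\mu,p}$ and holomorphic germs $h_p,H_{\mu,p}$ at $0$. For $\ell=1,\dots,J$ let $N[\ell]$ be the row of integers whose $q$-th entry ($q=1,\dots,n_1$) is $(n_\ell-1)+(q-1)$ if $\lambda_\ell\neq0$ and $n_\ell+(q-1)$ if $\lambda_\ell=0$. **Theorem.** Let $\omega\in\Omega$ and let $\gamma$ be a path from $0$ towards $\omega$, ending in a disc $D$ centred at $\omega$ with $D\cap\Omega=\{\omega\}$. Then the series $\widehat f$ converges near $0$ and can be continued analytically along $\gamma$, and its continuation extends to the whole Riemann surface of the logarithm over $D\setminus\{\omega\}$. For any determination of $\ln\xi$ at the end point of $\gamma$ (where $\xi$ is the end point minus $\omega$), the singularity at $\xi=0$ of $(\mathrm{cont}_\gamma\widehat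 f)(\omega+\xi)$ has a major $\check f(\omega+\xi)$ with row-blocks $$\check f^{\,j;\bullet}(\omega+\xi)=\xi^{\lambda_j-1}\,\xi^{J_{n_j}}\,k^{j;\bullet}_{(\omega)}\,\xi^{-J_{n_1}}+\sum_{\ell\,:\,a_\ell=\omega}\xi^{\lambda_\ell}\,R^{j;\bullet}_{\lambda_\ell;(\omega)}(\ln\xi),\qquad j=1,\dots,J,$$ where * $k^{j;\bullet}_{(\omega)}$ is a constant $n_j\times n_1$ matrix, equal to $0$ when $a_j\ne\omega$; * $R^{j;\bullet}_{\lambda_\ell;(\omega)}(X)$ is an $n_j\times n_1$ matrix of polynomials in $X$ with coefficients in $\widehat{\mathcal Res}{}^{\rm sum}_{\Omega-\omega}$, whose successive columns have degrees in $X$ at most the entries of $N[\ell]$. In particular, every entry of $(\mathrm{cont}_\gamma\widehat f)(\omega+\xi)$ has at $\xi=0$ a simple-moderate singularity, with exponents in $\{\lambda_\ell : a_\ell=\omega,\ \lambda_\ell\neq0\}$. -/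

import Mathlib

open Filter Topology
open scoped PowerSeries

namespace LevelOne

/-! ### Prepared level-one systems -/

/-- The nilpotent Jordan block `J_m` (ones on the superdiagonal). -/
def jordan (m : ℕ) : Matrix (Fin m) (Fin m) ℂ :=
  Matrix.of fun i k => if (i : ℕ) + 1 = (k : ℕ) then 1 else 0

/-- Row indices of an `n × n` matrix split in blocks of sizes `n j`: the pair `⟨j, i⟩` is the
`i`-th row of the `j`-th block. -/
abbrev Idx {J : ℕ} (n : Fin J → ℕ) : Type := Σ j : Fin J, Fin (n j)

/-- The matrix `A₀(x) = ⨁ⱼ (aⱼ I + x (λⱼ I + J_{nⱼ}))` of the normal form, whose fundamental solution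
is `x^L e^{Q(1/x)}` with `L = ⨁ⱼ (λⱼ I + J_{nⱼ})` and `Q(1/x) = ⨁ⱼ (-aⱼ/x) I`. -/
noncomputable def normalForm {J : ℕ} (n : Fin J → ℕ) (a lam : Fin J → ℂ) :
    Matrix (Idx n) (Idx n) ℂ⟦X⟧ :=
  Matrix.blockDiagonal' fun j =>
    (PowerSeries.C (a j) + PowerSeries.C (lam j) * PowerSeries.X) •
        (1 : Matrix (Fin (n j)) (Fin (n j)) ℂ⟦X⟧) +
      (PowerSeries.X : ℂ⟦X⟧) • (jordan (n j)).map PowerSeries.C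

/-- A power series with positive radius of convergence. -/
def IsConvergent (p : ℂ⟦X⟧) : Prop :=
  ∃ C ρ : ℝ, ∀ m : ℕ, ‖PowerSeries.coeff m p‖ ≤ C * ρ ^ m

/-- `F(x) x^L e^{Q(1/x)}` is a formal solution of `x² dY/dx = A(x) Y`. Since `x^L e^{Q(1/x)}` is
an invertible solution of the normal form, this says `x² dF/dx = A F - F A₀`. -/
def IsFormalSolution {J : ℕ} (n : Fin J → ℕ) (a lam : Fin J → ℂ)
    (A F : Matrix (Idx n) (Idx n) ℂ⟦X⟧) : Prop :=
  (PowerSeries.X : ℂ⟦X⟧) ^ 2 • F.map (fun p => PowerSeries.derivative ℂ p) =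
    A * F - F * normalForm n a lam

/-- Formal Borel transform, without the multiple of `δ` coming from the constant term:
`x^{m+1} ↦ ξ^m / m!`. -/
noncomputable def borel (p : ℂ⟦X⟧) : ℂ⟦X⟧ :=
  PowerSeries.mk fun m => PowerSeries.coeff (m + 1) p / (m.factorial : ℂ)

/-- The function `f` is, near `0`, the sum of the (convergent) power series `p`. -/
def IsSumOf (f : ℂ → ℂ) (p : ℂ⟦X⟧) : Prop :=
  HasFPowerSeriesAt f
    (FormalMultilinearSeries.ofScalars ℂ fun m => PowerSeries.coeff m p) 0

/-! ### Analytic continuation and summable-resurgence -/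

/-- `g t` represents a germ at `γ t`, and these germs are the analytic continuation along `γ`
of the germ `g 0`. -/
def IsContinuationAlong {z₀ z : ℂ} (γ : Path z₀ z) (g : unitInterval → ℂ → ℂ) : Prop :=
  ∀ t, AnalyticAt ℂ (g t) (γ t) ∧ ∀ᶠ t' in 𝓝 t, g t' =ᶠ[𝓝 (γ t')] g t

/-- A path issuing from `0` and lying in `ℂ ∖ Ω`, except for its starting point. The homotopy
classes of these paths are the points other than `0` of the Riemann surface `𝓡_Ω`. -/
def Avoids (Ω : Set ℂ) {z : ℂ} (γ : Path (0 : ℂ) z) : Prop :=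
  ∀ t, t ≠ 0 → γ t ∉ Ω

/-- A resurgent function with singular support `Ω`: a germ at `0` that extends analytically
to all of `𝓡_Ω`, i.e. along every path issuing from `0` and lying in `ℂ ∖ Ω`. -/
def IsResurgent (Ω : Set ℂ) (f : ℂ → ℂ) : Prop :=
  AnalyticAt ℂ f 0 ∧
    ∀ (z : ℂ) (γ : Path (0 : ℂ) z), Avoids Ω γ →
      ∃ g, IsContinuationAlong γ g ∧ g 0 =ᶠ[𝓝 0] f

/-- The sector `{ξ : |ξ| > e^ρ, α < arg ξ < β}` on the Riemann surface of the logarithm, in the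
coordinate `s = ln ξ`. Its opening `β - α` is finite, and may exceed `2π`. -/
def sector (ρ α β : ℝ) : Set ℂ := {s | ρ < s.re ∧ α < s.im ∧ s.im < β}

/-- Summable-resurgence: at most exponential growth at infinity on every sectorial region of
`𝓡_Ω`. Such a region reaches, along a path `γ` from `0` in `ℂ ∖ Ω`, a sector of bounded opening
lying at a positive distance `ν` from `Ω`; `Φ` is the continuation of `f` to this sector, in the
coordinate `s = ln ξ`, so that `|ξ| = e^{Re s}`. -/
def IsSummableResurgent (Ω : Set ℂ) (f : ℂ → ℂ) : Prop :=
  IsResurgent Ω f ∧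
    ∀ (z : ℂ) (γ : Path (0 : ℂ) z) (g : unitInterval → ℂ → ℂ), Avoids Ω γ →
      IsContinuationAlong γ g → g 0 =ᶠ[𝓝 0] f →
      ∀ (ν ρ α β : ℝ) (s₀ : ℂ), 0 < ν →
        (∀ s ∈ sector ρ α β, ∀ b ∈ Ω, ν < dist (Complex.exp s) b) →
        s₀ ∈ sector ρ α β → Complex.exp s₀ = z →
        ∃ Φ : ℂ → ℂ, AnalyticOnNhd ℂ Φ (sector ρ α β) ∧
          Φ =ᶠ[𝓝 s₀] (fun s => g 1 (Complex.exp s)) ∧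
          ∃ C c M : ℝ, ∀ s ∈ sector ρ α β, M ≤ s.re →
            ‖Φ s‖ ≤ C * Real.exp (c * Real.exp s.re)

/-! ### Singularities

Functions on the Riemann surface of the logarithm are written in the coordinate `s = ln ξ`. -/

/-- The neighbourhoods `{0 < |ξ| < ε}` of `0` on the Riemann surface of the logarithm. -/
def logZero : Filter ℂ := comap Complex.re atBot

/-- `φ` is a holomorphic germ at `0` on the Riemann surface of the logarithm. -/
def IsLogGerm (φ : ℂ → ℂ) : Prop := ∀ᶠ s in logZero, AnalyticAt ℂ φ s

/-- `m` is a major of the singularity of `φ`: both are holomorphic germs at `0` on the Riemann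
surface of the logarithm, and they differ by a holomorphic germ `h(ξ)` at `0` in `ℂ`. -/
def IsMajor (m φ : ℂ → ℂ) : Prop :=
  IsLogGerm m ∧ IsLogGerm φ ∧
    ∃ h : ℂ → ℂ, AnalyticAt ℂ h 0 ∧ ∀ᶠ s in logZero, φ s = m s + h (Complex.exp s)

/-- The singularity of `φ` is simple-moderate with exponents in the finite set `Λ`: it has a major
`∑_{p ≤ N₀} c_p ξ⁻¹ ln^p ξ + ∑_{1 ≤ p ≤ N₀ + 1} h_p(ξ) ln^p ξ
  + ∑_{μ ∈ Λ} ∑_{p ≤ N_μ} (c_{μ,p} ξ^{μ-1} ln^p ξ + H_{μ,p}(ξ) ξ^μ ln^p ξ)`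
with constants `c` and holomorphic germs `h`, `H` at `0`. -/
def IsSimpleModerate (Λ : Finset ℂ) (φ : ℂ → ℂ) : Prop :=
  (∀ μ ∈ Λ, 0 ≤ μ.re ∧ μ.re < 1 ∧ μ ≠ 0) ∧
    ∃ (N₀ : ℕ) (c : ℕ → ℂ) (h : ℕ → ℂ → ℂ) (N : ℂ → ℕ) (d : ℂ → ℕ → ℂ) (H : ℂ → ℕ → ℂ → ℂ),
      (∀ p, AnalyticAt ℂ (h p) 0) ∧ (∀ μ p, AnalyticAt ℂ (H μ p) 0) ∧
      IsMajor (fun s =>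
        ∑ p ∈ Finset.range (N₀ + 1), c p * Complex.exp (-s) * s ^ p +
        ∑ p ∈ Finset.Icc 1 (N₀ + 1), h p (Complex.exp s) * s ^ p +
        ∑ μ ∈ Λ, ∑ p ∈ Finset.range (N μ + 1),
          (d μ p * Complex.exp ((μ - 1) * s) * s ^ p +
            H μ p (Complex.exp s) * Complex.exp (μ * s) * s ^ p)) φ

/-- `φ` is `s ↦ (cont_γ f)(ω + e^s)`, where `f` is the sum of `p`: the germ of `f` at `0` is
continued along `γ` up to the point `z = ω + e^{s₁}`, and from there to the whole Riemann surface
of the logarithm over the punctured disc `0 < |ξ| < r`; `s₁` fixes the determination of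
`ln ξ`. -/
def IsContinuationNear (p : ℂ⟦X⟧) {z : ℂ} (γ : Path (0 : ℂ) z) (ω : ℂ) (r : ℝ) (s₁ : ℂ)
    (φ : ℂ → ℂ) : Prop :=
  ∃ g : unitInterval → ℂ → ℂ, IsSumOf (g 0) p ∧ IsContinuationAlong γ g ∧
    AnalyticOnNhd ℂ φ {s | s.re < Real.log r} ∧
    φ =ᶠ[𝓝 s₁] fun s => g 1 (ω + Complex.exp s)

/-- The log-degree `N[ℓ]` of the column `q = 0, 1, …`, for a Jordan block of size `m` and exponent
`μ`. -/
noncomputable def logDegree (m : ℕ) (μ : ℂ) (q : ℕ) : ℕ :=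
  if μ = 0 then m + q else m - 1 + q

/-- The power `ξ^M = exp (M ln ξ)` of a matrix, with `s = ln ξ`. -/
noncomputable def matPow {m : ℕ} (s : ℂ) (M : Matrix (Fin m) (Fin m) ℂ) :
    Matrix (Fin m) (Fin m) ℂ :=
  NormedSpace.exp (s • M)

end LevelOne

/-! The Borel transform turns x² d/dx into multiplication by ξ, so the first columns satisfy a
convolution equation (ξ − D) f = g + K * f, where D is diagonal with the a_j as eigenvalues, K(ξ) =
∑ K_k ξ^k / k! is entire of exponential type because A converges, and g = K F_0 with F_0 the
constant term. The main idea is to get rid of the convolution. Put y_k = g^{(k)} + K^{(k)} * f. Then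
y_k' = y_{k+1} + K_k f and f = (ξ − D)⁻¹ y_0, so the sequence (y_k / ρ^k) solves an ordinary linear
system y' = A(ξ) y on a Banach space of bounded sequences. Its coefficient has only simple poles, at
the a_j, and is bounded at any positive distance from them. Continuation along paths is then Picard
iteration, and exponential growth on sectors is a Gronwall estimate
(`exists_continuation_of_solution`, `isSummableResurgent_of_solution`).

At ω the residue P of this infinite-dimensional system factors through the finite-dimensional space
V, and its powers reduce to those of the exponent matrix, which acts on each row-block with a_ℓ = ω
as λ_ℓ plus the nilpotent map X ↦ J X − X J₁, and as 0 on the other blocks. All eigenvalues have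
real part in [0, 1), so no two differ by a positive integer (`bijective_residueAt`), and a
holomorphic gauge H with H(0) = 1 reduces the system to ξ Z' = P Z (`exists_gauge`). Solutions near
ω are therefore H(ξ) ξ^P y₀, where ξ^P y₀ is an explicit combination of ξ^{λ_ℓ} ln^p ξ
(`exists_log_state`). Since H itself solves a linear system with the same kind of singularities, the
coefficients are summable-resurgent. Splitting H into its value 1 at 0 and ξ times its difference
quotient isolates the polar term with the constant matrix k. Right multiplication by the Jordan
block commutes with the whole construction, which bounds the logarithmic degree column by column
(`localReadout_eq_zero`).

At 0 the same gauge produces a holomorphic solution with initial state `input` F_0, and nonresonance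
forces its Taylor coefficients to be F_{m+1} / m! (`hasSeries_regularSolution`). This proves that
the Borel transform converges and identifies it with a solution of the linear system. -/

namespace LevelOne

/-! ### Linear differential equations in the complex domain -/

section ODE

variable {E : Type*} [NormedAddCommGroup E] [NormedSpace ℂ E]

/-- `y` solves the linear differential equation `y' = A y` on `U`. -/
def SolvesOn (A : ℂ → E →L[ℂ] E) (U : Set ℂ) (y : ℂ → E) : Prop :=
  ∀ s ∈ U, HasDerivAt y (A s (y s)) s

theorem SolvesOn.mono {A : ℂ → E →L[ℂ] E} {U W : Set ℂ} {y : ℂ → E} (h : SolvesOn A U y)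
    (hWU : W ⊆ U) : SolvesOn A W y := fun s hs => h s (hWU hs)

theorem SolvesOn.sub {A : ℂ → E →L[ℂ] E} {U : Set ℂ} {y z : ℂ → E} (hy : SolvesOn A U y)
    (hz : SolvesOn A U z) : SolvesOn A U (y - z) := fun s hs => by
  simpa using (hy s hs).sub (hz s hs)

theorem SolvesOn.analyticOnNhd [CompleteSpace E] {A : ℂ → E →L[ℂ] E} {U : Set ℂ} {y : ℂ → E}
    (h : SolvesOn A U y) (hU : IsOpen U) : AnalyticOnNhd ℂ y U :=
  DifferentiableOn.analyticOnNhd (fun s hs => (h s hs).differentiableAt.differentiableWithinAt) hU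

theorem hasDerivAt_comp_segment {y : ℂ → E} {y' : E} {c s : ℂ} {t : ℝ}
    (h : HasDerivAt y y' (c + (t : ℂ) * (s - c))) :
    HasDerivAt (fun t : ℝ => y (c + (t : ℂ) * (s - c))) ((s - c) • y') t := by
  have h1 : HasDerivAt (fun t : ℝ => c + (t : ℂ) * (s - c)) (s - c) t := by
    have := ((Complex.ofRealCLM.hasDerivAt (x := t)).mul_const (s - c)).const_add c
    simpa using this
  exact h.scomp t h1

theorem segment_mem_of_convex {U : Set ℂ} (hU : Convex ℝ U) {c s : ℂ} (hc : c ∈ U) (hs : s ∈ U)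
    {t : ℝ} (ht : t ∈ Set.Icc (0 : ℝ) 1) : c + (t : ℂ) * (s - c) ∈ U := by
  have := hU.add_smul_sub_mem hc hs ht
  simpa using this

/-- A bound of Gronwall type along a segment. -/
theorem SolvesOn.norm_le_of_convex {A : ℂ → E →L[ℂ] E} {U : Set ℂ} {y : ℂ → E}
    (h : SolvesOn A U y) (hU : Convex ℝ U) {C : ℝ} {c s : ℂ} (hc : c ∈ U) (hs : s ∈ U)
    (hA : ∀ t ∈ Set.Icc (0 : ℝ) 1, ‖A (c + (t : ℂ) * (s - c))‖ ≤ C) :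
    ‖y s‖ ≤ ‖y c‖ * Real.exp (C * ‖s - c‖) := by
  have hd : ∀ t ∈ Set.Icc (0 : ℝ) 1, HasDerivAt (fun t : ℝ => y (c + (t : ℂ) * (s - c)))
      ((s - c) • A (c + (t : ℂ) * (s - c)) (y (c + (t : ℂ) * (s - c)))) t := fun t ht =>
    hasDerivAt_comp_segment (h _ (segment_mem_of_convex hU hc hs ht))
  have := norm_le_gronwallBound_of_norm_deriv_right_le (δ := ‖y c‖) (K := C * ‖s - c‖) (ε := 0)
    (f := fun t : ℝ => y (c + (t : ℂ) * (s - c))) (a := 0) (b := 1)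
    (fun t ht => (hd t ht).continuousAt.continuousWithinAt)
    (fun t ht => (hd t ⟨ht.1, ht.2.le⟩).hasDerivWithinAt) (by simp)
    (fun t ht => by
      rw [norm_smul, add_zero, mul_comm C, mul_assoc]
      gcongr
      exact (ContinuousLinearMap.le_opNorm _ _).trans
        (by gcongr; exact hA t ⟨ht.1, ht.2.le⟩)) 1 (by simp)
  simpa [gronwallBound_ε0] using this

theorem SolvesOn.eq_zero_of_convex {A : ℂ → E →L[ℂ] E} {U : Set ℂ} {y : ℂ → E}
    (h : SolvesOn A U y) (hU : Convex ℝ U) (hA : ContinuousOn A U) {c s : ℂ}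
    (hc : c ∈ U) (hs : s ∈ U) (h0 : y c = 0) : y s = 0 := by
  have hK : IsCompact ((fun t : ℝ => c + (t : ℂ) * (s - c)) '' Set.Icc 0 1) :=
    isCompact_Icc.image (by fun_prop)
  have hKU : (fun t : ℝ => c + (t : ℂ) * (s - c)) '' Set.Icc 0 1 ⊆ U := by
    rintro _ ⟨t, ht, rfl⟩
    exact segment_mem_of_convex hU hc hs ht
  obtain ⟨C, hC⟩ := hK.exists_bound_of_continuousOn (hA.mono hKU)
  have := h.norm_le_of_convex hU hc hs (C := C) fun t ht => hC _ ⟨t, ht, rfl⟩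
  simpa [h0] using this

/-- Two solutions on a convex set which agree at one point are equal. -/
theorem SolvesOn.eqOn_of_convex {A : ℂ → E →L[ℂ] E} {U : Set ℂ} {y z : ℂ → E}
    (hy : SolvesOn A U y) (hz : SolvesOn A U z) (hU : Convex ℝ U) (hA : ContinuousOn A U) {c : ℂ}
    (hc : c ∈ U) (h0 : y c = z c) : Set.EqOn y z U := fun s hs => by
  have := (hy.sub hz).eq_zero_of_convex hU hA hc hs (by simp [h0])
  simpa [sub_eq_zero] using this

variable [CompleteSpace E]

/-- The Picard iterates of a linear differential equation on a convex open set. -/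
theorem exists_picard_iterates {A : ℂ → E →L[ℂ] E} {U : Set ℂ} (hU : Convex ℝ U) (hUo : IsOpen U)
    (hA : DifferentiableOn ℂ A U) (c : ℂ) (y₀ : E) :
    ∃ u : ℕ → ℂ → E, (∀ s, u 0 s = y₀) ∧ (∀ n, u (n + 1) c = 0) ∧
      ∀ n, ∀ s ∈ U, HasDerivAt (u (n + 1)) (A s (u n s)) s := by
  -- The differentiability hypothesis sits inside the existential, so that `choose` yields an
  -- integration operator `T` on all functions, which can be iterated before the iterates are known
  -- to be holomorphic.
  have key : ∀ v : ℂ → E, ∃ w : ℂ → E, DifferentiableOn ℂ v U →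
      w c = 0 ∧ ∀ s ∈ U, HasDerivAt w (A s (v s)) s := by
    intro v
    by_cases hv : DifferentiableOn ℂ v U
    · obtain ⟨w, hw⟩ := hU.exists_forall_hasDerivWithinAt (hA.clm_apply hv)
      refine ⟨fun s => w s - w c, fun _ => ⟨by simp, fun s hs => ?_⟩⟩
      exact ((hw s hs).hasDerivAt (hUo.mem_nhds hs)).sub_const _
    · exact ⟨0, fun h => absurd h hv⟩
  choose T hT using key
  let u : ℕ → ℂ → E := fun n => Nat.rec (fun _ => y₀) (fun _ v => T v) n
  have hd : ∀ n, DifferentiableOn ℂ (u n) U := by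
    intro n
    induction n with
    | zero => exact differentiableOn_const _
    | succ n ih =>
      exact fun s hs => ((hT _ ih).2 s hs).differentiableAt.differentiableWithinAt
  exact ⟨u, fun _ => rfl, fun n => (hT _ (hd n)).1, fun n => (hT _ (hd n)).2⟩

/-- Linear differential equations with holomorphic coefficients have solutions on convex open
sets, with any prescribed value at one point. -/
theorem exists_solvesOn {A : ℂ → E →L[ℂ] E} {U : Set ℂ} (hU : Convex ℝ U) (hUo : IsOpen U)
    (hA : DifferentiableOn ℂ A U) {c : ℂ} (hc : c ∈ U) (y₀ : E) :
    ∃ y : ℂ → E, SolvesOn A U y ∧ y c = y₀ := by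
  obtain ⟨u, hu0, huc, hud⟩ := exists_picard_iterates hU hUo hA c y₀
  -- The factor t ^ n carries the induction: integrating it along the segment produces the new 1 /
  -- (n + 1) of the factorial.
  have hbd : ∀ (C : ℝ) (s : ℂ), s ∈ U → (∀ t ∈ Set.Icc (0 : ℝ) 1, ‖A (c + (t : ℂ) * (s - c))‖ ≤ C) →
      ∀ n, ∀ t ∈ Set.Icc (0 : ℝ) 1, ‖u n (c + (t : ℂ) * (s - c))‖ ≤
        ‖y₀‖ * ((C * ‖s - c‖) ^ n / n.factorial) * t ^ n := by
    intro C s hs hC n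
    have hC0 : 0 ≤ C := (norm_nonneg _).trans (hC 0 (by simp))
    induction n with
    | zero => intro t _; simp [hu0]
    | succ n ih =>
      have hd : ∀ t ∈ Set.Icc (0 : ℝ) 1,
          HasDerivAt (fun t : ℝ => u (n + 1) (c + (t : ℂ) * (s - c)))
            ((s - c) • A (c + (t : ℂ) * (s - c)) (u n (c + (t : ℂ) * (s - c)))) t := fun t ht =>
        hasDerivAt_comp_segment (hud n _ (segment_mem_of_convex hU hc hs ht))
      refine fun t ht => image_norm_le_of_norm_deriv_right_le_deriv_boundary
        (f := fun t : ℝ => u (n + 1) (c + (t : ℂ) * (s - c)))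
        (B := fun t : ℝ => ‖y₀‖ * ((C * ‖s - c‖) ^ (n + 1) / (n + 1).factorial) * t ^ (n + 1))
        (B' := fun t : ℝ => ‖y₀‖ * ((C * ‖s - c‖) ^ (n + 1) / (n + 1).factorial) *
          (((n + 1 : ℕ) : ℝ) * t ^ n))
        (fun t ht => (hd t ht).continuousAt.continuousWithinAt)
        (fun t ht => (hd t ⟨ht.1, ht.2.le⟩).hasDerivWithinAt) (by simp [huc])
        (fun t => by simpa using (hasDerivAt_pow (n + 1) t).const_mul _) (fun t ht => ?_) ht
      have h1 := ih t ⟨ht.1, ht.2.le⟩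
      have h2 := hC t ⟨ht.1, ht.2.le⟩
      have h3 : ((n + 1).factorial : ℝ) = ((n + 1 : ℕ) : ℝ) * (n.factorial : ℝ) := by
        rw [Nat.factorial_succ]; push_cast; ring
      have h4 : ((n + 1 : ℕ) : ℝ) ≠ 0 := by positivity
      have h5 : (n.factorial : ℝ) ≠ 0 := by positivity
      calc ‖(s - c) • A (c + (t : ℂ) * (s - c)) (u n (c + (t : ℂ) * (s - c)))‖
          ≤ ‖s - c‖ * (C * (‖y₀‖ * ((C * ‖s - c‖) ^ n / n.factorial) * t ^ n)) := by
            rw [norm_smul]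
            gcongr
            exact (ContinuousLinearMap.le_opNorm _ _).trans (by gcongr)
        _ = _ := by
            rw [h3]
            field_simp
            ring
  -- The segments from `c` to a closed ball around `z` sweep out a compact set, on which `A` has a
  -- single bound. The Weierstrass test then applies locally uniformly and permits termwise
  -- differentiation.
  have hloc : ∀ z ∈ U, ∃ W ⊆ U, IsOpen W ∧ z ∈ W ∧ ∃ v : ℕ → ℝ, Summable v ∧
      ∀ n, ∀ s ∈ W, ‖u n s‖ ≤ v n := by
    intro z hz
    obtain ⟨ε, hε, hεU⟩ := Metric.nhds_basis_closedBall.mem_iff.1 (hUo.mem_nhds hz)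
    have hK : IsCompact ((fun p : ℝ × ℂ => c + (p.1 : ℂ) * (p.2 - c)) ''
        (Set.Icc 0 1 ×ˢ Metric.closedBall z ε)) :=
      (isCompact_Icc.prod (isCompact_closedBall z ε)).image (by fun_prop)
    have hKU : (fun p : ℝ × ℂ => c + (p.1 : ℂ) * (p.2 - c)) ''
        (Set.Icc 0 1 ×ˢ Metric.closedBall z ε) ⊆ U := by
      rintro _ ⟨⟨t, s⟩, ⟨ht, hs⟩, rfl⟩
      exact segment_mem_of_convex hU hc (hεU hs) ht
    obtain ⟨C, hC⟩ := hK.exists_bound_of_continuousOn (hA.continuousOn.mono hKU)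
    have hC0 : 0 ≤ C := (norm_nonneg _).trans
      (hC (c + ((0 : ℝ) : ℂ) * (z - c)) ⟨(0, z), ⟨by simp, by simp [hε.le]⟩, rfl⟩)
    refine ⟨Metric.ball z ε, Metric.ball_subset_closedBall.trans hεU, Metric.isOpen_ball,
      Metric.mem_ball_self hε,
      fun n => ‖y₀‖ * ((C * (ε + ‖z - c‖)) ^ n / n.factorial),
      (Real.summable_pow_div_factorial _).mul_left _, fun n s hs => ?_⟩
    have hs' := Metric.ball_subset_closedBall hs
    have := hbd C s (hεU hs') (fun t ht => hC _ ⟨(t, s), ⟨ht, hs'⟩, rfl⟩) n 1 (by simp)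
    have h1 : ‖s - c‖ ≤ ε + ‖z - c‖ := by
      calc ‖s - c‖ = ‖(s - z) + (z - c)‖ := by ring_nf
        _ ≤ ‖s - z‖ + ‖z - c‖ := norm_add_le _ _
        _ ≤ _ := by
          gcongr
          simpa [dist_eq_norm] using hs'
    have h2 : ‖u n s‖ ≤ ‖y₀‖ * ((C * ‖s - c‖) ^ n / n.factorial) := by simpa using this
    refine h2.trans ?_
    change _ ≤ ‖y₀‖ * ((C * (ε + ‖z - c‖)) ^ n / n.factorial)
    gcongr
  have hdiff : ∀ n, DifferentiableOn ℂ (u n) U := by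
    intro n
    cases n with
    | zero => exact (differentiableOn_const y₀).congr fun s _ => hu0 s
    | succ n => exact fun s hs => (hud n s hs).differentiableAt.differentiableWithinAt
  refine ⟨fun s => ∑' n, u n s, fun z hz => ?_, ?_⟩
  · obtain ⟨W, hWU, hWo, hzW, v, hv, hvW⟩ := hloc z hz
    have h1 := Complex.differentiableOn_tsum_of_summable_norm hv (fun n => (hdiff n).mono hWU) hWo
        hvW
    have h2 := Complex.hasSum_deriv_of_summable_norm hv (fun n => (hdiff n).mono hWU) hWo hvW hzW
    have h3 : HasSum (fun n => u n z) (∑' n, u n z) :=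
      (Summable.of_norm_bounded hv fun n => hvW n z hzW).hasSum
    have h4 := (A z).hasSum h3
    have h5 : deriv (u 0) z = 0 := by
      rw [show u 0 = fun _ => y₀ from funext hu0]; simp
    have h6 : HasSum (fun n => deriv (u n) z) (A z (∑' n, u n z)) := by
      rw [← hasSum_nat_add_iff' 1]
      simpa [h5, (hud _ z hz).deriv] using h4
    have h7 := (h1.differentiableAt (hWo.mem_nhds hzW)).hasDerivAt
    rwa [h2.unique h6] at h7
  · change ∑' n, u n c = y₀
    rw [tsum_eq_single 0 fun n hn => ?_, hu0]
    obtain ⟨m, rfl⟩ := Nat.exists_eq_succ_of_ne_zero hn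
    exact huc m

end ODE

end LevelOne

namespace LevelOne

/-! ### Continuation along paths -/

section Continuation

variable {E : Type*}

/-- The germs `g t` at `γ t`, for `t ∈ T`, have the property `Q`, and they are continuations of each
other along `γ`. -/
def ContinuesOn (γ : unitInterval → ℂ) (Q : (ℂ → E) → ℂ → Prop) (T : Set unitInterval)
    (g : unitInterval → ℂ → E) : Prop :=
  ∀ t ∈ T, Q (g t) (γ t) ∧ ∀ᶠ t' in 𝓝[T] t, g t' =ᶠ[𝓝 (γ t')] g t

theorem continuesOn_const {γ : unitInterval → ℂ} {Q : (ℂ → E) → ℂ → Prop} {T : Set unitInterval}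
    {y : ℂ → E} (h : ∀ t ∈ T, Q y (γ t)) : ContinuesOn γ Q T fun _ => y :=
  fun t ht => ⟨h t ht, Eventually.of_forall fun _ => EventuallyEq.rfl⟩

open Classical in
theorem ContinuesOn.glue {γ : unitInterval → ℂ} (hγ : Continuous γ) {Q : (ℂ → E) → ℂ → Prop}
    {a b c : unitInterval} {g g' : unitInterval → ℂ → E}
    (hg : ContinuesOn γ Q (Set.Icc a b) g) (hg' : ContinuesOn γ Q (Set.Icc b c) g')
    (hab : a ≤ b) (hbc : b ≤ c) (h : g b =ᶠ[𝓝 (γ b)] g' b) :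
    ContinuesOn γ Q (Set.Icc a c) fun t => if t ≤ b then g t else g' t := by
  intro t ht
  rcases lt_trichotomy t b with htb | rfl | htb
  · simp only [htb.le, if_true]
    obtain ⟨h1, h2⟩ := hg t ⟨ht.1, htb.le⟩
    refine ⟨h1, ?_⟩
    rw [eventually_nhdsWithin_iff] at h2 ⊢
    filter_upwards [h2, Iio_mem_nhds htb] with t' h3 h4 h5
    have h4' : t' ≤ b := le_of_lt h4
    simpa only [h4', if_true] using h3 ⟨h5.1, h4'⟩
  · simp only [le_refl, if_true]
    obtain ⟨h1, h2⟩ := hg t ⟨hab, le_rfl⟩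
    obtain ⟨-, h3⟩ := hg' t ⟨le_rfl, hbc⟩
    refine ⟨h1, ?_⟩
    rw [eventually_nhdsWithin_iff] at h2 h3 ⊢
    filter_upwards [h2, h3, hγ.continuousAt.eventually (eventually_eventually_nhds.2 h)]
      with t' h4 h5 h6 h7
    by_cases h8 : t' ≤ t
    · simpa only [h8, if_true] using h4 ⟨h7.1, h8⟩
    · simp only [h8, if_false]
      refine (h5 ⟨(not_le.1 h8).le, h7.2⟩).trans ?_
      filter_upwards [h6] with x hx using hx.symm
  · simp only [not_le.2 htb, if_false]
    obtain ⟨h1, h2⟩ := hg' t ⟨htb.le, ht.2⟩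
    refine ⟨h1, ?_⟩
    rw [eventually_nhdsWithin_iff] at h2 ⊢
    filter_upwards [h2, Ioi_mem_nhds htb] with t' h3 h4 h5
    simpa only [not_le.2 (Set.mem_Ioi.1 h4), if_false] using h3 ⟨(Set.mem_Ioi.1 h4).le, h5.2⟩

variable [NormedAddCommGroup E] [NormedSpace ℂ E]

/-- `y` is a germ at `s` of a solution of `y' = A y`. -/
def SolvesAt (A : ℂ → E →L[ℂ] E) (y : ℂ → E) (s : ℂ) : Prop :=
  ∀ᶠ s' in 𝓝 s, HasDerivAt y (A s' (y s')) s'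

theorem SolvesOn.solvesAt {A : ℂ → E →L[ℂ] E} {U : Set ℂ} {y : ℂ → E} (h : SolvesOn A U y)
    (hU : IsOpen U) {s : ℂ} (hs : s ∈ U) : SolvesAt A y s :=
  eventually_of_mem (hU.mem_nhds hs) h

/-- Germs of solutions are determined by their value at the point, so continuations can be glued by
matching values only. -/
theorem SolvesAt.eventuallyEq {A : ℂ → E →L[ℂ] E} {y z : ℂ → E} {s : ℂ}
    (hy : SolvesAt A y s) (hz : SolvesAt A z s) (hA : ∀ᶠ s' in 𝓝 s, ContinuousAt A s')
    (h : y s = z s) : y =ᶠ[𝓝 s] z := by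
  obtain ⟨ε, hε, hball⟩ := Metric.eventually_nhds_iff_ball.1 (hy.and (hz.and hA))
  exact eventually_of_mem (Metric.ball_mem_nhds s hε)
    (SolvesOn.eqOn_of_convex (A := A) (fun s' hs' => (hball s' hs').1)
      (fun s' hs' => (hball s' hs').2.1)
      (convex_ball s ε) (fun s' hs' => (hball s' hs').2.2.continuousWithinAt)
      (Metric.mem_ball_self hε) h)

/-- Solutions of linear differential equations can be continued along paths which avoid the
singularities of the equation. -/
theorem exists_continuesOn_solvesAt [CompleteSpace E] {A : ℂ → E →L[ℂ] E} {Ω : Set ℂ}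
    (hΩ : IsClosed Ω) (hA : DifferentiableOn ℂ A Ωᶜ) {γ : unitInterval → ℂ} (hγ : Continuous γ)
    (a : unitInterval) (ha : ∀ t, a ≤ t → γ t ∉ Ω) (y₀ : E) :
    ∃ g : unitInterval → ℂ → E, ContinuesOn γ (SolvesAt A) (Set.Icc a 1) g ∧ g a (γ a) = y₀ := by
  have hK : IsCompact (γ '' Set.Icc a 1) := isCompact_Icc.image hγ
  have hKΩ : γ '' Set.Icc a 1 ⊆ Ωᶜ := by
    rintro _ ⟨t, ht, rfl⟩
    exact ha t ht.1
  obtain ⟨δ, hδ, hδΩ⟩ := hK.exists_thickening_subset_open hΩ.isOpen_compl hKΩ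
  have hball : ∀ t, a ≤ t → Metric.ball (γ t) δ ⊆ Ωᶜ := fun t ht =>
    (Metric.ball_subset_thickening (Set.mem_image_of_mem γ (Set.mem_Icc.2 ⟨ht, t.2.2⟩)) δ).trans hδΩ
  obtain ⟨ε, hε, hεγ⟩ := Metric.uniformContinuous_iff.1
    (CompactSpace.uniformContinuous_of_continuous hγ) δ hδ
  -- Continuation by steps of length ε / 2: during each step γ stays in a ball of radius δ free of
  -- singularities, where a solution exists. Halving ε gives the strict inequality required by
  -- uniform continuity.
  have key : ∀ (m : ℕ) (b : unitInterval), a ≤ b → (b : ℝ) - a ≤ m * (ε / 2) →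
      ∃ g : unitInterval → ℂ → E, ContinuesOn γ (SolvesAt A) (Set.Icc a b) g ∧ g a (γ a) = y₀ := by
    intro m
    induction m with
    | zero =>
      intro b hab hb
      have hba : b = a := le_antisymm (by
        rw [← Subtype.coe_le_coe]; simp at hb; exact_mod_cast hb) hab
      subst hba
      obtain ⟨y, hy, hy0⟩ := exists_solvesOn (convex_ball (γ b) δ) Metric.isOpen_ball
        (hA.mono (hball b le_rfl)) (Metric.mem_ball_self hδ) y₀
      refine ⟨fun _ => y, continuesOn_const fun t ht => ?_, hy0⟩
      have : t = b := le_antisymm ht.2 ht.1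
      subst this
      exact hy.solvesAt Metric.isOpen_ball (Metric.mem_ball_self hδ)
    | succ m ih =>
      intro b hab hb
      by_cases hb' : (b : ℝ) - a ≤ m * (ε / 2)
      · exact ih b hab hb'
      push Not at hb'
      have hmε : 0 ≤ m * (ε / 2) := by positivity
      let c : unitInterval := ⟨a + m * (ε / 2), add_nonneg a.2.1 hmε, by
        have := b.2.2; linarith⟩
      have hac : a ≤ c := Subtype.coe_le_coe.1 (by change (a : ℝ) ≤ a + m * (ε / 2); linarith)
      have hcb : c ≤ b := Subtype.coe_le_coe.1 (by change (a : ℝ) + m * (ε / 2) ≤ b; linarith)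
      obtain ⟨g, hg, hg0⟩ := ih c hac (by change (a : ℝ) + m * (ε / 2) - a ≤ _; linarith)
      obtain ⟨y, hy, hy0⟩ := exists_solvesOn (convex_ball (γ c) δ) Metric.isOpen_ball
        (hA.mono (hball c hac)) (Metric.mem_ball_self hδ) (g c (γ c))
      have hy' : ContinuesOn γ (SolvesAt A) (Set.Icc c b) fun _ => y := by
        refine continuesOn_const fun t ht => hy.solvesAt Metric.isOpen_ball ?_
        refine hεγ ?_
        have h1 : (c : ℝ) ≤ t := ht.1
        have h2 : (t : ℝ) ≤ b := ht.2
        have h3 : (c : ℝ) = a + m * (ε / 2) := rfl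
        rw [Subtype.dist_eq, Real.dist_eq, abs_of_nonneg (by linarith)]
        push_cast at hb
        linarith
      have hAc : ∀ᶠ s' in 𝓝 (γ c), ContinuousAt A s' := by
        filter_upwards [hΩ.isOpen_compl.mem_nhds (ha c hac)] with s' hs'
        exact (hA.differentiableAt (hΩ.isOpen_compl.mem_nhds hs')).continuousAt
      have hgc : g c =ᶠ[𝓝 (γ c)] y := (hg c ⟨hac, le_rfl⟩).1.eventuallyEq
        (hy.solvesAt Metric.isOpen_ball (Metric.mem_ball_self hδ)) hAc hy0.symm
      refine ⟨_, hg.glue hγ hy' hac hcb hgc, ?_⟩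
      simp only [hac, if_true]
      exact hg0
  obtain ⟨m, hm⟩ := exists_nat_ge (1 / (ε / 2))
  refine key m 1 a.2.2 ?_
  have h1 : (1 : ℝ) ≤ m * (ε / 2) := (div_le_iff₀ (by positivity)).1 hm
  have h2 := a.2.1
  push_cast
  linarith

/-- The analytic continuation of a germ along a path is unique. -/
theorem IsContinuationAlong.eventuallyEq {z₀ z : ℂ} {γ : Path z₀ z} {g g' : unitInterval → ℂ → ℂ}
    (hg : IsContinuationAlong γ g) (hg' : IsContinuationAlong γ g')
    (h : g 0 =ᶠ[𝓝 z₀] g' 0) : g 1 =ᶠ[𝓝 z] g' 1 := by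
  have hγ : Continuous γ := γ.continuous
  let S : Set unitInterval := {t | g t =ᶠ[𝓝 (γ t)] g' t}
  -- Near `t`, membership in `S` compares two fixed functions `g t` and `g' t` at nearby points.
  -- Openness is then immediate, and closedness is the identity theorem on a ball.
  have hnear : ∀ t, ∀ᶠ t' in 𝓝 t, (t' ∈ S ↔ g t =ᶠ[𝓝 (γ t')] g' t) := by
    intro t
    filter_upwards [(hg t).2, (hg' t).2] with t' h1 h2
    exact ⟨fun h3 => h1.symm.trans (h3.trans h2), fun h3 => h1.trans (h3.trans h2.symm)⟩
  have hopen : IsOpen S := by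
    rw [isOpen_iff_mem_nhds]
    intro t ht
    filter_upwards [hnear t, hγ.continuousAt.eventually (eventually_eventually_nhds.2 ht)]
      with t' h1 h2 using h1.2 h2
  have hclosed : IsClosed S := by
    rw [← closure_subset_iff_isClosed]
    intro t ht
    have han : ∀ᶠ x in 𝓝 (γ t), AnalyticAt ℂ (g t) x ∧ AnalyticAt ℂ (g' t) x :=
      (hg t).1.eventually_analyticAt.and (hg' t).1.eventually_analyticAt
    obtain ⟨ε, hε, hball⟩ := Metric.eventually_nhds_iff_ball.1 han
    have h1 := (hnear t).and (hγ.continuousAt.eventually (Metric.ball_mem_nhds (γ t) hε))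
    obtain ⟨t', h4, h2, h3⟩ := ((mem_closure_iff_frequently.1 ht).and_eventually h1).exists
    have h5 := AnalyticOnNhd.eqOn_of_preconnected_of_eventuallyEq
      (fun x hx => (hball x hx).1) (fun x hx => (hball x hx).2)
      (convex_ball (γ t) ε).isPreconnected h3 (h2.1 h4)
    exact h5.eventuallyEq_of_mem (Metric.ball_mem_nhds _ hε)
  have huniv : S = Set.univ := IsClopen.eq_univ ⟨hclosed, hopen⟩ ⟨0, by simpa [S] using h⟩
  have : (1 : unitInterval) ∈ S := huniv ▸ Set.mem_univ _
  simpa [S] using this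

end Continuation

end LevelOne

namespace LevelOne

/-! ### Solutions of linear differential equations and summable-resurgence -/

section Resurgence

/-- `ψ` is holomorphic on `ℂ ∖ Ω`, and bounded at any positive distance from `Ω`. -/
def IsTame {F : Type*} [NormedAddCommGroup F] [NormedSpace ℂ F] (Ω : Set ℂ) (ψ : ℂ → F) : Prop :=
  DifferentiableOn ℂ ψ Ωᶜ ∧
    ∀ ν : ℝ, 0 < ν → ∃ C : ℝ, ∀ ξ : ℂ, (∀ b ∈ Ω, ν < dist ξ b) → ‖ψ ξ‖ ≤ C

section Tame

variable {F F' : Type*} [NormedAddCommGroup F] [NormedSpace ℂ F] [NormedAddCommGroup F']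
  [NormedSpace ℂ F'] {Ω : Set ℂ}

theorem isTame_const (c : F) : IsTame Ω fun _ => c :=
  ⟨differentiableOn_const _, fun _ _ => ⟨‖c‖, fun _ _ => le_rfl⟩⟩

theorem IsTame.add {ψ χ : ℂ → F} (hψ : IsTame Ω ψ) (hχ : IsTame Ω χ) :
    IsTame Ω fun ξ => ψ ξ + χ ξ := by
  refine ⟨hψ.1.add hχ.1, fun ν hν => ?_⟩
  obtain ⟨C, hC⟩ := hψ.2 ν hν
  obtain ⟨C', hC'⟩ := hχ.2 ν hν
  exact ⟨C + C', fun ξ hξ => (norm_add_le _ _).trans (add_le_add (hC ξ hξ) (hC' ξ hξ))⟩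

theorem IsTame.sum {ι : Type*} (s : Finset ι) {ψ : ι → ℂ → F} (h : ∀ i ∈ s, IsTame Ω (ψ i)) :
    IsTame Ω fun ξ => ∑ i ∈ s, ψ i ξ := by
  classical
  induction s using Finset.induction_on with
  | empty => simpa using isTame_const (Ω := Ω) (0 : F)
  | insert i s hi ih =>
    simp only [Finset.sum_insert hi]
    exact (h i (by simp)).add (ih fun j hj => h j (by simp [hj]))

theorem isTame_inv_sub {b : ℂ} (hb : b ∈ Ω) : IsTame Ω fun ξ => (ξ - b)⁻¹ := by
  refine ⟨fun ξ hξ => ?_, fun ν hν => ⟨ν⁻¹, fun ξ hξ => ?_⟩⟩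
  · have : ξ - b ≠ 0 := sub_ne_zero.2 fun h => hξ (h ▸ hb)
    exact ((differentiableAt_id.sub_const b).inv this).differentiableWithinAt
  · rw [norm_inv, ← dist_eq_norm]
    exact inv_anti₀ hν (hξ b hb).le

theorem IsTame.smul_const {ψ : ℂ → ℂ} (hψ : IsTame Ω ψ) (c : F) : IsTame Ω fun ξ => ψ ξ • c := by
  refine ⟨hψ.1.smul_const c, fun ν hν => ?_⟩
  obtain ⟨C, hC⟩ := hψ.2 ν hν
  exact ⟨C * ‖c‖, fun ξ hξ => by rw [norm_smul]; gcongr; exact hC ξ hξ⟩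

theorem IsTame.clm_comp {ψ : ℂ → F} (hψ : IsTame Ω ψ) (L : F →L[ℂ] F') :
    IsTame Ω fun ξ => L (ψ ξ) := by
  refine ⟨L.differentiable.comp_differentiableOn hψ.1, fun ν hν => ?_⟩
  obtain ⟨C, hC⟩ := hψ.2 ν hν
  exact ⟨‖L‖ * C, fun ξ hξ => (L.le_opNorm _).trans (by gcongr; exact hC ξ hξ)⟩

end Tame

variable {E : Type*} [NormedAddCommGroup E] [NormedSpace ℂ E]

theorem SolvesAt.analyticAt [CompleteSpace E] {A : ℂ → E →L[ℂ] E} {y : ℂ → E} {s : ℂ}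
    (h : SolvesAt A y s) : AnalyticAt ℂ y s := by
  obtain ⟨ε, hε, hball⟩ := Metric.eventually_nhds_iff_ball.1 h
  exact SolvesOn.analyticOnNhd (A := A) hball Metric.isOpen_ball s (Metric.mem_ball_self hε)

/-- A solution of a linear differential equation read in the coordinate `s = ln ξ`, where the
coordinate `ξ` is centred at `ω`. -/
theorem SolvesAt.comp_exp {A : ℂ → E →L[ℂ] E} {y : ℂ → E} {ω s : ℂ}
    (h : SolvesAt A y (ω + Complex.exp s)) :
    SolvesAt (fun s => Complex.exp s • A (ω + Complex.exp s))
      (fun s => y (ω + Complex.exp s)) s := by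
  have hc : ContinuousAt (fun s => ω + Complex.exp s) s := by fun_prop
  filter_upwards [hc.eventually h] with s' hs'
  exact hs'.scomp s' ((Complex.hasDerivAt_exp s').const_add ω)

theorem continuousAt_of_isTame {F : Type*} [NormedAddCommGroup F] [NormedSpace ℂ F] {Ω : Set ℂ}
    {ψ : ℂ → F} (hΩ : IsClosed Ω) (hψ : IsTame Ω ψ) {z : ℂ} (hz : z ∉ Ω) :
    ∀ᶠ s in 𝓝 z, ContinuousAt ψ s := by
  filter_upwards [hΩ.isOpen_compl.mem_nhds hz] with s hs
  exact (hψ.1.differentiableAt (hΩ.isOpen_compl.mem_nhds hs)).continuousAt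

theorem sector_eq (ρ α β : ℝ) :
    sector ρ α β = Complex.re ⁻¹' Set.Ioi ρ ∩ Complex.im ⁻¹' Set.Ioo α β := by
  ext s; simp [sector]

theorem convex_sector (ρ α β : ℝ) : Convex ℝ (sector ρ α β) := by
  rw [sector_eq]
  exact ((convex_Ioi ρ).linear_preimage Complex.reLm).inter
    ((convex_Ioo α β).linear_preimage Complex.imLm)

theorem isOpen_sector (ρ α β : ℝ) : IsOpen (sector ρ α β) := by
  rw [sector_eq]
  exact (isOpen_Ioi.preimage Complex.continuous_re).inter (isOpen_Ioo.preimage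
      Complex.continuous_im)

/-- Solutions of a linear differential equation with bounded coefficients have at most exponential
growth on sectors. -/
theorem SolvesOn.norm_le_of_sector {A : ℂ → E →L[ℂ] E} {ρ α β C : ℝ} {y : ℂ → E}
    (hy : SolvesOn (fun s => Complex.exp s • A (Complex.exp s)) (sector ρ α β) y)
    (hC : ∀ s ∈ sector ρ α β, ‖A (Complex.exp s)‖ ≤ C) {s₀ : ℂ} (hs₀ : s₀ ∈ sector ρ α β) :
    ∃ D : ℝ, 0 ≤ D ∧ ∀ s ∈ sector ρ α β, s₀.re ≤ s.re →
      ‖y s‖ ≤ D * Real.exp (C * Real.exp s.re) := by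
  have hC0 : 0 ≤ C := (norm_nonneg _).trans (hC s₀ hs₀)
  -- The solution is followed in two legs: first along the arc |ξ| = e^{Re s₀}, of length at most β
  -- − α in s, where the coefficient is at most e^{Re s₀} C. This leg produces the constant. The
  -- second leg is radial.
  refine ⟨‖y s₀‖ * Real.exp (Real.exp s₀.re * C * (β - α)), by positivity, fun s hs hss => ?_⟩
  have hre : ∀ r θ : ℝ, ((r : ℂ) + (θ : ℂ) * Complex.I).re = r := by intro r θ; simp
  have him : ∀ r θ : ℝ, ((r : ℂ) + (θ : ℂ) * Complex.I).im = θ := by intro r θ; simp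
  have hmem : ∀ r : ℝ, s₀.re ≤ r → ((r : ℂ) + (s.im : ℂ) * Complex.I) ∈ sector ρ α β := by
    intro r hr
    refine ⟨?_, ?_, ?_⟩
    · rw [hre]; exact hs₀.1.trans_le hr
    · rw [him]; exact hs.2.1
    · rw [him]; exact hs.2.2
  have hv : ‖y ((s₀.re : ℂ) + (s.im : ℂ) * Complex.I)‖ ≤
      ‖y s₀‖ * Real.exp (Real.exp s₀.re * C * (β - α)) := by
    have hsub : (s₀.re : ℂ) + (s.im : ℂ) * Complex.I - s₀ =
        ((s.im - s₀.im : ℝ) : ℂ) * Complex.I := by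
      apply Complex.ext <;> simp
    refine (hy.norm_le_of_convex (convex_sector ρ α β) hs₀ (hmem _ le_rfl)
      (C := Real.exp s₀.re * C) fun t ht => ?_).trans ?_
    · have h1 := segment_mem_of_convex (convex_sector ρ α β) hs₀ (hmem _ le_rfl) ht
      rw [norm_smul, Complex.norm_exp]
      refine mul_le_mul (le_of_eq ?_) (hC _ h1) (norm_nonneg _) (Real.exp_pos _).le
      rw [hsub]
      simp
    · rw [hsub]
      gcongr
      rw [norm_mul, Complex.norm_I, mul_one, Complex.norm_real, Real.norm_eq_abs, abs_le]
      have := hs.2; have := hs₀.2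
      constructor <;> linarith
  -- Radial leg, parametrized by r = |ξ| instead of ln r: the factor 1 / r cancels |e^s|, leaving a
  -- coefficient bounded by C and hence growth e^{C r}.
  have hd : ∀ r ∈ Set.Icc (Real.exp s₀.re) (Real.exp s.re),
      HasDerivAt (fun r : ℝ => y ((Real.log r : ℂ) + (s.im : ℂ) * Complex.I))
        (((r⁻¹ : ℝ) : ℂ) • (Complex.exp ((Real.log r : ℂ) + (s.im : ℂ) * Complex.I) •
          A (Complex.exp ((Real.log r : ℂ) + (s.im : ℂ) * Complex.I)))
            (y ((Real.log r : ℂ) + (s.im : ℂ) * Complex.I))) r := by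
    intro r hr
    have hr0 : 0 < r := (Real.exp_pos _).trans_le hr.1
    have h1 := ((Real.hasDerivAt_log hr0.ne').ofReal_comp).add_const ((s.im : ℂ) * Complex.I)
    exact (hy _ (hmem _ ((Real.le_log_iff_exp_le hr0).2 hr.1))).scomp r h1
  have hg := norm_le_gronwallBound_of_norm_deriv_right_le
    (δ := ‖y s₀‖ * Real.exp (Real.exp s₀.re * C * (β - α))) (K := C) (ε := 0)
    (a := Real.exp s₀.re) (b := Real.exp s.re)
    (f := fun r : ℝ => y ((Real.log r : ℂ) + (s.im : ℂ) * Complex.I))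
    (fun r hr => (hd r hr).continuousAt.continuousWithinAt)
    (fun r hr => (hd r ⟨hr.1, hr.2.le⟩).hasDerivWithinAt)
    (by simpa using hv)
    (fun r hr => by
      have hr0 : 0 < r := (Real.exp_pos _).trans_le hr.1
      have h1 := hC _ (hmem _ ((Real.le_log_iff_exp_le hr0).2 hr.1))
      rw [smul_apply, norm_smul, norm_smul, Complex.norm_exp, hre, Real.exp_log hr0,
        Complex.norm_real, Real.norm_eq_abs, abs_of_pos (inv_pos.2 hr0), ← mul_assoc,
        inv_mul_cancel₀ hr0.ne', one_mul, add_zero]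
      exact (ContinuousLinearMap.le_opNorm _ _).trans (by gcongr))
    (Real.exp s.re) ⟨Real.exp_le_exp.2 hss, le_rfl⟩
  simp only [Real.log_exp, gronwallBound_ε0, Complex.re_add_im] at hg
  refine hg.trans ?_
  gcongr
  have := Real.exp_pos s₀.re
  linarith

variable [CompleteSpace E]

theorem analyticAt_clm_apply {F : Type*} [NormedAddCommGroup F] [NormedSpace ℂ F] [CompleteSpace F]
    {ψ : ℂ → E →L[ℂ] F} {y : ℂ → E} {z : ℂ} (hψ : AnalyticAt ℂ ψ z) (hy : AnalyticAt ℂ y z) :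
    AnalyticAt ℂ (fun ξ => ψ ξ (y ξ)) z := by
  rw [Complex.analyticAt_iff_eventually_differentiableAt] at *
  filter_upwards [hψ, hy] with ξ h1 h2 using h1.clm_apply h2

theorem analyticAt_clm_apply_add {Ω : Set ℂ} (hΩ : IsClosed Ω) {ψ : ℂ → E →L[ℂ] ℂ} {κ : ℂ → ℂ}
    (hψ : IsTame Ω ψ) (hκ : IsTame Ω κ) {y : ℂ → E} {z : ℂ} (hz : z ∉ Ω)
    (hy : AnalyticAt ℂ y z) : AnalyticAt ℂ (fun ξ => ψ ξ (y ξ) + κ ξ) z := by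
  have hz' := hΩ.isOpen_compl.mem_nhds hz
  have h1 : AnalyticAt ℂ ψ z := hψ.1.analyticAt hz'
  exact (analyticAt_clm_apply h1 hy).add (hκ.1.analyticAt hz')

/-- A solution near `0` of a linear differential equation, with a singularity at `0`, is continued
along any path issuing from `0` and avoiding the singularities. -/
theorem exists_continuation_of_solution {Ω : Set ℂ} (hΩ : IsClosed Ω) (h0 : (0 : ℂ) ∈ Ω)
    {A : ℂ → E →L[ℂ] E} (hA : IsTame Ω A) {Y : ℂ → E}
    (hY : ∀ᶠ ξ in 𝓝[≠] (0 : ℂ), HasDerivAt Y (A ξ (Y ξ)) ξ) {z : ℂ} (γ : Path (0 : ℂ) z)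
    (hγ : Avoids Ω γ) (ι : Type*) [Finite ι] (f : ι → ℂ → ℂ) (ψ : ι → ℂ → E →L[ℂ] ℂ)
    (κ : ι → ℂ → ℂ) (hf : ∀ i, AnalyticAt ℂ (f i) 0) (hψ : ∀ i, IsTame Ω (ψ i))
    (hκ : ∀ i, IsTame Ω (κ i)) (hfψ : ∀ i, ∀ᶠ ξ in 𝓝[≠] (0 : ℂ), f i ξ = ψ i ξ (Y ξ) + κ i ξ) :
    ∃ y : ℂ → E, SolvesAt A y z ∧ ∀ i, ∃ g, IsContinuationAlong γ g ∧ g 0 = f i ∧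
      g 1 =ᶠ[𝓝 z] fun ξ => ψ i ξ (y ξ) + κ i ξ := by
  classical
  have hall : ∀ᶠ ξ in 𝓝 (0 : ℂ), (∀ i, AnalyticAt ℂ (f i) ξ) ∧
      (ξ ≠ 0 → HasDerivAt Y (A ξ (Y ξ)) ξ ∧ ∀ i, f i ξ = ψ i ξ (Y ξ) + κ i ξ) := by
    refine (eventually_all.2 fun i => (hf i).eventually_analyticAt).and ?_
    exact eventually_nhdsWithin_iff.1 (hY.and (eventually_all.2 hfψ))
  obtain ⟨ε, hε, hball⟩ := Metric.eventually_nhds_iff_ball.1 hall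
  have hγc : Continuous γ := γ.continuous
  -- Up to time `a` the continuation is `f i` itself, since the system is singular at the starting
  -- point. From `a` on, `Y` is continued and the function is recovered through ψ and κ.
  obtain ⟨a, ha0, ha⟩ : ∃ a : unitInterval, 0 < a ∧ ∀ t ≤ a, γ t ∈ Metric.ball (0 : ℂ) ε := by
    have h1 : ∀ᶠ t in 𝓝 (0 : unitInterval), γ t ∈ Metric.ball (0 : ℂ) ε :=
      hγc.continuousAt.eventually_mem (by rw [γ.source]; exact Metric.ball_mem_nhds (0 : ℂ) hε)
    obtain ⟨δ, hδ, hδ'⟩ := Metric.eventually_nhds_iff.1 h1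
    refine ⟨⟨min 1 (δ / 2), by positivity, min_le_left _ _⟩, ?_, fun t ht => hδ' ?_⟩
    · rw [← Subtype.coe_lt_coe]
      change (0 : ℝ) < min 1 (δ / 2)
      positivity
    · have : (t : ℝ) ≤ min 1 (δ / 2) := ht
      have h2 : (t : ℝ) ≤ δ / 2 := this.trans (min_le_right _ _)
      have h3 := t.2.1
      rw [Subtype.dist_eq, Real.dist_eq]
      simp only [Set.Icc.coe_zero, sub_zero, abs_of_nonneg h3]
      linarith
  have hγΩ : ∀ t, a ≤ t → γ t ∉ Ω := fun t ht => hγ t (ha0.trans_le ht).ne'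
  obtain ⟨G, hG, hGa⟩ := exists_continuesOn_solvesAt hΩ hA.1 hγc a hγΩ (Y (γ a))
  have hane : γ a ≠ 0 := fun h => hγΩ a le_rfl (by rwa [h])
  have hnear : ∀ᶠ ξ in 𝓝 (γ a), ξ ∈ Metric.ball (0 : ℂ) ε ∧ ξ ≠ 0 :=
    inter_mem (Metric.isOpen_ball.mem_nhds (ha a le_rfl)) (isOpen_ne.mem_nhds hane)
  have hGY : G a =ᶠ[𝓝 (γ a)] Y := (hG a ⟨le_rfl, a.2.2⟩).1.eventuallyEq
    (by filter_upwards [hnear] with ξ hξ using ((hball ξ hξ.1).2 hξ.2).1)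
    (continuousAt_of_isTame hΩ hA (hγΩ a le_rfl)) hGa
  refine ⟨G 1, ?_, fun i => ?_⟩
  · simpa using (hG 1 ⟨a.2.2, le_rfl⟩).1
  have h1 : ContinuesOn γ (fun y s => AnalyticAt ℂ y s) (Set.Icc 0 a) fun _ => f i :=
    continuesOn_const fun t ht => (hball _ (ha t ht.2)).1 i
  have h2 : ContinuesOn γ (fun y s => AnalyticAt ℂ y s) (Set.Icc a 1)
      fun t ξ => ψ i ξ (G t ξ) + κ i ξ := by
    intro t ht
    obtain ⟨h3, h4⟩ := hG t ht
    refine ⟨analyticAt_clm_apply_add hΩ (hψ i) (hκ i) (hγΩ t ht.1) h3.analyticAt, ?_⟩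
    filter_upwards [h4] with t' ht'
    filter_upwards [ht'] with ξ hξ
    rw [hξ]
  have h3 : f i =ᶠ[𝓝 (γ a)] fun ξ => ψ i ξ (G a ξ) + κ i ξ := by
    filter_upwards [hnear, hGY] with ξ hξ hξ'
    rw [hξ', ((hball ξ hξ.1).2 hξ.2).2 i]
  have h4 := h1.glue hγc h2 ha0.le a.2.2 h3
  refine ⟨fun t => if t ≤ a then f i else fun ξ => ψ i ξ (G t ξ) + κ i ξ, fun t => ?_,
    if_pos ha0.le, ?_⟩
  · have := h4 t ⟨t.2.1, t.2.2⟩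
    have h5 : Set.Icc (0 : unitInterval) 1 = Set.univ := by
      ext t; exact ⟨fun _ => Set.mem_univ _, fun _ => ⟨t.2.1, t.2.2⟩⟩
    rwa [h5, nhdsWithin_univ] at this
  · by_cases h5 : (1 : unitInterval) ≤ a
    · have h6 : a = 1 := le_antisymm a.2.2 h5
      subst h6
      simpa using h3
    · simp only [h5, if_false]
      rfl

/-- A function obtained from a solution of a linear differential equation, with bounded
coefficients away from the singular set `Ω`, is summable-resurgent. -/
theorem isSummableResurgent_of_solution {Ω : Set ℂ} (hΩ : IsClosed Ω) (h0 : (0 : ℂ) ∈ Ω)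
    {A : ℂ → E →L[ℂ] E} (hA : IsTame Ω A) {Y : ℂ → E}
    (hY : ∀ᶠ ξ in 𝓝[≠] (0 : ℂ), HasDerivAt Y (A ξ (Y ξ)) ξ)
    {f : ℂ → ℂ} {ψ : ℂ → E →L[ℂ] ℂ} {κ : ℂ → ℂ} (hf : AnalyticAt ℂ f 0) (hψ : IsTame Ω ψ)
    (hκ : IsTame Ω κ) (hfψ : ∀ᶠ ξ in 𝓝[≠] (0 : ℂ), f ξ = ψ ξ (Y ξ) + κ ξ) :
    IsSummableResurgent Ω f := by
  refine ⟨⟨hf, fun z γ hγ => ?_⟩, ?_⟩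
  · obtain ⟨y, -, hg⟩ := exists_continuation_of_solution hΩ h0 hA hY γ hγ Unit (fun _ => f)
      (fun _ => ψ) (fun _ => κ) (fun _ => hf) (fun _ => hψ) (fun _ => hκ) (fun _ => hfψ)
    obtain ⟨g, hg1, hg2, -⟩ := hg ()
    exact ⟨g, hg1, hg2 ▸ EventuallyEq.rfl⟩
  · intro z γ g' hγ hg' hg'0 ν ρ α β s₀ hν hsec hs₀ hs₀z
    obtain ⟨y, hy, hg⟩ := exists_continuation_of_solution hΩ h0 hA hY γ hγ Unit (fun _ => f)
      (fun _ => ψ) (fun _ => κ) (fun _ => hf) (fun _ => hψ) (fun _ => hκ) (fun _ => hfψ)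
    obtain ⟨g, hg1, hg2, hg3⟩ := hg ()
    have hg'1 : g' 1 =ᶠ[𝓝 z] fun ξ => ψ ξ (y ξ) + κ ξ :=
      (hg'.eventuallyEq hg1 (by rw [hg2]; exact hg'0)).trans hg3
    have hout : ∀ s ∈ sector ρ α β, Complex.exp s ∉ Ω := fun s hs h => by
      have := hsec s hs _ h
      rw [dist_self] at this
      linarith
    have hdA : DifferentiableOn ℂ (fun s => Complex.exp s • A (Complex.exp s)) (sector ρ α β) :=
      Complex.differentiable_exp.differentiableOn.smul
        (hA.1.comp Complex.differentiable_exp.differentiableOn hout)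
    -- In the coordinate s = ln ξ a sector of any opening, even beyond 2π, is convex, so one
    -- solution covers it entirely.
    obtain ⟨w, hw, hw0⟩ := exists_solvesOn (convex_sector ρ α β) (isOpen_sector ρ α β) hdA hs₀ (y z)
    obtain ⟨C, hC⟩ := hA.2 ν hν
    obtain ⟨Cψ, hCψ⟩ := hψ.2 ν hν
    obtain ⟨Cκ, hCκ⟩ := hκ.2 ν hν
    obtain ⟨D, hD0, hD⟩ := hw.norm_le_of_sector (fun s hs => hC _ (hsec s hs)) hs₀
    have hC0 : 0 ≤ C := (norm_nonneg _).trans (hC _ (hsec s₀ hs₀))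
    have hCψ0 : 0 ≤ Cψ := (norm_nonneg _).trans (hCψ _ (hsec s₀ hs₀))
    have hCκ0 : 0 ≤ Cκ := (norm_nonneg _).trans (hCκ _ (hsec s₀ hs₀))
    -- The bound on κ is absorbed in the exponential, which is at least 1. The threshold is Re s₀
    -- because the growth estimate starts from the base point.
    refine ⟨fun s => ψ (Complex.exp s) (w s) + κ (Complex.exp s), ?_, ?_, Cψ * D + Cκ, C, s₀.re, ?_⟩
    · have hd : DifferentiableOn ℂ (fun s => ψ (Complex.exp s) (w s) + κ (Complex.exp s))
          (sector ρ α β) :=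
        ((hψ.1.comp Complex.differentiable_exp.differentiableOn hout).clm_apply
          (hw.analyticOnNhd (isOpen_sector ρ α β)).differentiableOn).add
          (hκ.1.comp Complex.differentiable_exp.differentiableOn hout)
      exact hd.analyticOnNhd (isOpen_sector ρ α β)
    · have h1 : SolvesAt (fun s => Complex.exp s • A (Complex.exp s))
          (fun s => y (Complex.exp s)) s₀ := by
        have := SolvesAt.comp_exp (A := A) (y := y) (ω := 0) (s := s₀) (by simpa [hs₀z] using hy)
        simpa using this
      have h2 : w =ᶠ[𝓝 s₀] fun s => y (Complex.exp s) :=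
        (hw.solvesAt (isOpen_sector ρ α β) hs₀).eventuallyEq h1
          (by
            filter_upwards [(isOpen_sector ρ α β).mem_nhds hs₀] with s hs
            exact (hdA.differentiableAt ((isOpen_sector ρ α β).mem_nhds hs)).continuousAt)
          (by rw [hw0, hs₀z])
      have h3 := (Complex.continuous_exp.continuousAt (x := s₀)).eventually (hs₀z.symm ▸ hg'1)
      filter_upwards [h2, h3] with s hs hs'
      rw [hs', hs]
    · intro s hs hss
      have h1 : (1 : ℝ) ≤ Real.exp (C * Real.exp s.re) := Real.one_le_exp (by positivity)
      calc ‖ψ (Complex.exp s) (w s) + κ (Complex.exp s)‖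
          ≤ ‖ψ (Complex.exp s)‖ * ‖w s‖ + ‖κ (Complex.exp s)‖ :=
            (norm_add_le _ _).trans (by gcongr; exact ContinuousLinearMap.le_opNorm _ _)
        _ ≤ Cψ * (D * Real.exp (C * Real.exp s.re)) + Cκ * Real.exp (C * Real.exp s.re) := by
            gcongr
            · exact hCψ _ (hsec s hs)
            · exact hD s hs hss
            · exact (hCκ _ (hsec s hs)).trans (le_mul_of_one_le_right hCκ0 h1)
        _ = _ := by ring

end Resurgence

end LevelOne

namespace LevelOne

/-! ### Power series with coefficients in a Banach space -/

section Series

variable {E F : Type*} [NormedAddCommGroup E] [NormedSpace ℂ E] [NormedAddCommGroup F]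
  [NormedSpace ℂ F]

/-- Near `0`, the function `f` is the sum of the series `∑ ξ^m c_m`. -/
def HasSeries (f : ℂ → E) (c : ℕ → E) : Prop :=
  ∀ᶠ ξ in 𝓝 (0 : ℂ), HasSum (fun m => ξ ^ m • c m) (f ξ)

/-- The formal multilinear series `∑ ξ^m c_m`. -/
noncomputable def toMultilinear (c : ℕ → E) : FormalMultilinearSeries ℂ ℂ E :=
  fun m => ContinuousMultilinearMap.mkPiRing ℂ (Fin m) (c m)

@[simp]
theorem coeff_toMultilinear (c : ℕ → E) (m : ℕ) : (toMultilinear c).coeff m = c m := by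
  simp [toMultilinear, FormalMultilinearSeries.coeff]

theorem hasSeries_iff {f : ℂ → E} {c : ℕ → E} :
    HasSeries f c ↔ HasFPowerSeriesAt f (toMultilinear c) 0 := by
  rw [hasFPowerSeriesAt_iff]
  simp [HasSeries]

theorem HasFPowerSeriesAt.hasSeries {f : ℂ → E} {p : FormalMultilinearSeries ℂ ℂ E}
    (h : HasFPowerSeriesAt f p 0) : HasSeries f p.coeff := by
  rw [hasFPowerSeriesAt_iff] at h
  simpa [HasSeries] using h

theorem HasSeries.analyticAt {f : ℂ → E} {c : ℕ → E} (h : HasSeries f c) : AnalyticAt ℂ f 0 :=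
  (hasSeries_iff.1 h).analyticAt

theorem HasSeries.congr {f g : ℂ → E} {c : ℕ → E} (h : HasSeries f c) (hfg : f =ᶠ[𝓝 0] g) :
    HasSeries g c := by
  filter_upwards [h, hfg] with ξ h1 h2
  rwa [← h2]

theorem HasSeries.unique {f : ℂ → E} {c d : ℕ → E} (hc : HasSeries f c) (hd : HasSeries f d) :
    c = d := by
  have := (hasSeries_iff.1 hc).eq_formalMultilinearSeries (hasSeries_iff.1 hd)
  funext m
  rw [← coeff_toMultilinear c, this, coeff_toMultilinear]

theorem HasSeries.apply_zero {f : ℂ → E} {c : ℕ → E} (h : HasSeries f c) : f 0 = c 0 := by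
  have h1 := h.self_of_nhds
  refine h1.unique ?_
  convert! hasSum_single (f := fun m => (0 : ℂ) ^ m • c m) 0 fun m hm => by simp [hm]
  simp

theorem HasSeries.add {f g : ℂ → E} {c d : ℕ → E} (hf : HasSeries f c) (hg : HasSeries g d) :
    HasSeries (fun ξ => f ξ + g ξ) fun m => c m + d m := by
  filter_upwards [hf, hg] with ξ h1 h2
  simpa [smul_add] using h1.add h2

theorem HasSeries.sub {f g : ℂ → E} {c d : ℕ → E} (hf : HasSeries f c) (hg : HasSeries g d) :
    HasSeries (fun ξ => f ξ - g ξ) fun m => c m - d m := by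
  filter_upwards [hf, hg] with ξ h1 h2
  simpa [smul_sub] using h1.sub h2

theorem HasSeries.clm {f : ℂ → E} {c : ℕ → E} (hf : HasSeries f c) (L : E →L[ℂ] F) :
    HasSeries (fun ξ => L (f ξ)) fun m => L (c m) := by
  filter_upwards [hf] with ξ h1
  simpa using L.hasSum h1

/-- The coefficients of `ξ f(ξ)`. -/
def shiftCoeff {E : Type*} [Zero E] (c : ℕ → E) : ℕ → E
  | 0 => 0
  | m + 1 => c m

theorem HasSeries.id_smul {f : ℂ → E} {c : ℕ → E} (hf : HasSeries f c) :
    HasSeries (fun ξ => ξ • f ξ) (shiftCoeff c) := by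
  filter_upwards [hf] with ξ h1
  rw [← hasSum_nat_add_iff' 1]
  simpa [shiftCoeff, pow_succ', mul_smul] using h1.const_smul ξ

theorem HasSeries.exists_bound {f : ℂ → E} {c : ℕ → E} (hf : HasSeries f c) :
    ∃ C R : ℝ, 0 < C ∧ 0 < R ∧ ∀ m, ‖c m‖ ≤ C * R ^ m := by
  obtain ⟨ε, hε, h⟩ := Metric.eventually_nhds_iff_ball.1 hf
  have hε' : (((ε / 2 : ℝ) : ℂ)) ∈ Metric.ball (0 : ℂ) ε := by
    simp [abs_of_pos hε, hε]
  obtain ⟨C, hC⟩ := (h _ hε').summable.tendsto_atTop_zero.norm.bddAbove_range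
  refine ⟨max C 1, (ε / 2)⁻¹, by positivity, by positivity, fun m => ?_⟩
  have h1 : ‖((ε / 2 : ℝ) : ℂ) ^ m • c m‖ ≤ C := hC ⟨m, rfl⟩
  rw [norm_smul, norm_pow, Complex.norm_real, Real.norm_eq_abs, abs_of_pos (by positivity)] at h1
  rw [inv_pow, ← div_eq_mul_inv, le_div_iff₀ (by positivity), mul_comm]
  exact h1.trans (le_max_left _ _)

theorem summable_of_bound [CompleteSpace E] {c : ℕ → E} {C R : ℝ} (hR : 0 < R)
    (hc : ∀ m, ‖c m‖ ≤ C * R ^ m) {ξ : ℂ} (hξ : ‖ξ‖ < R⁻¹) : Summable fun m => ‖ξ ^ m • c m‖ := by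
  have h1 : ‖ξ‖ * R < 1 := by
    rwa [← lt_inv_mul_iff₀' hR, mul_one]
  refine Summable.of_nonneg_of_le (fun _ => norm_nonneg _) (fun m => ?_)
    ((summable_geometric_of_lt_one (by positivity) h1).mul_left C)
  rw [norm_smul, norm_pow, mul_pow]
  calc ‖ξ‖ ^ m * ‖c m‖ ≤ ‖ξ‖ ^ m * (C * R ^ m) := by gcongr; exact hc m
    _ = _ := by ring

theorem hasSeries_of_bound [CompleteSpace E] {c : ℕ → E} {C R : ℝ} (hR : 0 < R)
    (hc : ∀ m, ‖c m‖ ≤ C * R ^ m) : HasSeries (fun ξ => ∑' m, ξ ^ m • c m) c := by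
  filter_upwards [Metric.ball_mem_nhds (0 : ℂ) (inv_pos.2 hR)] with ξ hξ
  exact (summable_of_bound hR hc (by simpa using hξ)).of_norm.hasSum

theorem HasSeries.summable_norm [CompleteSpace E] {f : ℂ → E} {c : ℕ → E} (hf : HasSeries f c) :
    ∀ᶠ ξ in 𝓝 (0 : ℂ), Summable fun m => ‖ξ ^ m • c m‖ := by
  obtain ⟨C, R, -, hR, hc⟩ := hf.exists_bound
  filter_upwards [Metric.ball_mem_nhds (0 : ℂ) (inv_pos.2 hR)] with ξ hξ
  exact summable_of_bound hR hc (by simpa using hξ)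

theorem HasSeries.deriv [CompleteSpace E] {f : ℂ → E} {c : ℕ → E} (hf : HasSeries f c) :
    HasSeries (deriv f) fun m => ((m : ℂ) + 1) • c (m + 1) := by
  obtain ⟨C, R, hC, hR, hc⟩ := hf.exists_bound
  have hf' : ∀ᶠ ξ in 𝓝 (0 : ℂ), f =ᶠ[𝓝 ξ] fun ξ => ∑' m, ξ ^ m • c m := by
    refine eventually_eventually_nhds.2 ?_
    filter_upwards [hf] with ξ hξ using hξ.tsum_eq.symm
  have hR2 : 0 < (2 * R)⁻¹ := by positivity
  filter_upwards [hf', Metric.ball_mem_nhds (0 : ℂ) hR2] with ξ h1 h2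
  have h3 := Complex.hasSum_deriv_of_summable_norm (F := fun m ξ => ξ ^ m • c m)
    (u := fun m => C * (1 / 2) ^ m)
    ((summable_geometric_of_lt_one (by norm_num) (by norm_num : (1 / 2 : ℝ) < 1)).mul_left C)
    (fun m => ((differentiable_id.pow m).smul_const (c m)).differentiableOn)
    Metric.isOpen_ball (fun m w hw => by
      have hw' : ‖w‖ < (2 * R)⁻¹ := by simpa using hw
      rw [norm_smul, norm_pow]
      calc ‖w‖ ^ m * ‖c m‖ ≤ ((2 * R)⁻¹) ^ m * (C * R ^ m) := by
            gcongr
            exact hc m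
        _ = C * (1 / 2) ^ m := by
            rw [mul_left_comm, ← mul_pow]
            congr 2
            field_simp) h2
  rw [← h1.deriv_eq, ← hasSum_nat_add_iff' 1] at h3
  convert! h3 using 1
  · funext m
    rw [deriv_smul_const (by fun_prop)]
    simp [smul_smul, mul_comm]
  · simp

theorem HasSeries.mul {𝒜 : Type*} [NormedRing 𝒜] [NormedAlgebra ℂ 𝒜] [CompleteSpace 𝒜]
    {f g : ℂ → 𝒜} {c d : ℕ → 𝒜} (hf : HasSeries f c) (hg : HasSeries g d) :
    HasSeries (fun ξ => f ξ * g ξ) fun m => ∑ i ∈ Finset.range (m + 1), c (m - i) * d i := by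
  filter_upwards [hf, hg, hf.summable_norm, hg.summable_norm] with ξ h1 h2 h3 h4
  have h5 := summable_norm_sum_mul_antidiagonal_of_summable_norm h3 h4
  have h6 := tsum_mul_tsum_eq_tsum_sum_antidiagonal_of_summable_norm h3 h4
  rw [h1.tsum_eq, h2.tsum_eq] at h6
  have h7 : ∀ m : ℕ, ∑ kl ∈ Finset.HasAntidiagonal.antidiagonal m,
      ξ ^ kl.1 • c kl.1 * ξ ^ kl.2 • d kl.2 =
      ξ ^ m • ∑ i ∈ Finset.range (m + 1), c (m - i) * d i := by
    intro m
    rw [← Finset.Nat.sum_antidiagonal_swap, Finset.Nat.sum_antidiagonal_eq_sum_range_succ_mk,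
      Finset.smul_sum]
    refine Finset.sum_congr rfl fun i hi => ?_
    have hi' : i ≤ m := Nat.lt_succ_iff.1 (Finset.mem_range.1 hi)
    rw [smul_mul_smul_comm, ← pow_add]
    simp [Nat.sub_add_cancel hi']
  rw [h6]
  simp_rw [h7] at h5 ⊢
  exact h5.of_norm.hasSum

end Series

end LevelOne

namespace LevelOne

/-! ### Nonresonant Fuchsian singularities -/

section Gauge

/-- If `a` commutes with `b`, then `a - b` divides `p(a) - p(b)`. -/
theorem exists_aeval_sub_aeval_eq_mul {𝒜 : Type*} [Ring 𝒜] [Algebra ℂ 𝒜] {x y : 𝒜}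
    (h : Commute x y) (p : Polynomial ℂ) :
    ∃ q, Polynomial.aeval x p - Polynomial.aeval y p = (x - y) * q ∧
      Polynomial.aeval x p - Polynomial.aeval y p = q * (x - y) := by
  induction p using Polynomial.induction_on' with
  | add p q hp hq =>
    obtain ⟨u, hu, hu'⟩ := hp
    obtain ⟨v, hv, hv'⟩ := hq
    refine ⟨u + v, ?_, ?_⟩
    · rw [mul_add, ← hu, ← hv, map_add, map_add]; abel
    · rw [add_mul, ← hu', ← hv', map_add, map_add]; abel
  | monomial m c =>
    refine ⟨c • ∑ i ∈ Finset.range m, x ^ i * y ^ (m - 1 - i), ?_, ?_⟩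
    · rw [mul_smul_comm, h.mul_geom_sum₂, Polynomial.aeval_monomial, Polynomial.aeval_monomial,
        ← mul_sub, Algebra.smul_def]
    · rw [smul_mul_assoc, h.geom_sum₂_mul, Polynomial.aeval_monomial, Polynomial.aeval_monomial,
        ← mul_sub, Algebra.smul_def]

/-- If `P` is killed by a polynomial whose roots have real parts in `[0, 1)`, then no positive
integer is a difference of spectral values of `P`. -/
theorem bijective_natCast_sub_commutator {𝒜 : Type*} [Ring 𝒜] [Algebra ℂ 𝒜] {P : 𝒜}
    {p : Polynomial ℂ} (hp : Polynomial.aeval P p = 0)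
    (hroot : ∀ μ, p.eval μ = 0 → 0 ≤ μ.re ∧ μ.re < 1) {m : ℕ} (hm : 1 ≤ m) :
    Function.Bijective fun X : 𝒜 => (m : ℂ) • X - (P * X - X * P) := by
  let L : Module.End ℂ 𝒜 := LinearMap.mulLeft ℂ P
  let R : Module.End ℂ 𝒜 := LinearMap.mulRight ℂ P
  have hLR : Commute R L := LinearMap.ext fun X => by simp [L, R, mul_assoc]
  have hL : Polynomial.aeval L p = 0 := by
    have := Polynomial.aeval_algHom_apply (Algebra.lmul ℂ 𝒜) P p
    rw [hp, map_zero] at this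
    exact this
  have hR : Polynomial.aeval R p = 0 := by
    have h1 : ∀ q : Polynomial ℂ,
        Polynomial.aeval R q = LinearMap.mulRight ℂ (Polynomial.aeval P q) := by
      intro q
      induction q using Polynomial.induction_on' with
      | add q r hq hr =>
        rw [map_add, map_add, hq, hr]
        ext X
        simp [mul_add]
      | monomial k c =>
        ext X
        rw [Polynomial.aeval_monomial, Polynomial.aeval_monomial, LinearMap.pow_mulRight]
        simp [Algebra.algebraMap_eq_smul_one]
    rw [h1, hp]
    ext X
    simp
  let R' : Module.End ℂ 𝒜 := R + algebraMap ℂ _ (m : ℂ)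
  have hR'L : Commute R' L := hLR.add_left (Algebra.commutes _ _)
  -- A common root μ would make both μ and μ + m roots of p, impossible in a strip of width less
  -- than 1. As p(R) = 0, the Bézout relation makes p(R + m) invertible. The map studied is R' − L
  -- with R' = R + m, it divides p(R') − p(L) = p(R'), and hence it is invertible too.
  have hcop : IsCoprime p (p.comp (Polynomial.X + Polynomial.C (m : ℂ))) := by
    rw [Polynomial.isCoprime_iff_aeval_ne_zero_of_isAlgClosed ℂ ℂ]
    intro μ
    by_contra! h
    obtain ⟨h1, h2⟩ := h
    have h1' := hroot μ (by simpa using h1)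
    have h2' := hroot (μ + m) (by simpa [Polynomial.aeval_def,
        Polynomial.eval₂_eq_eval_map] using h2)
    have : (1 : ℝ) ≤ m := by exact_mod_cast hm
    simp at h2'
    linarith
  obtain ⟨u, v, huv⟩ := hcop
  have hunit : Polynomial.aeval R v * Polynomial.aeval R' p = 1 := by
    have := congrArg (Polynomial.aeval R) huv
    rw [map_add, map_mul, map_mul, hR, mul_zero, zero_add, Polynomial.aeval_comp, map_one] at this
    simpa [R'] using this
  have hunit' : Polynomial.aeval R' p * Polynomial.aeval R v = 1 := by
    have h2 := congrArg (Polynomial.aeval R) huv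
    rw [map_add, map_mul, mul_comm v, map_mul, hR, mul_zero, zero_add, Polynomial.aeval_comp,
      map_one] at h2
    simpa [R'] using h2
  obtain ⟨q, hq, hq'⟩ := exists_aeval_sub_aeval_eq_mul hR'L p
  rw [hL, sub_zero] at hq hq'
  have hT : (fun X : 𝒜 => (m : ℂ) • X - (P * X - X * P)) = ⇑(R' - L) := by
    funext X
    simp only [R', L, R, LinearMap.sub_apply, LinearMap.add_apply, LinearMap.mulRight_apply,
      LinearMap.mulLeft_apply, Module.algebraMap_end_apply]
    abel
  rw [hT]
  constructor
  · have h1 : (Polynomial.aeval R v * q) * (R' - L) = 1 := by rw [mul_assoc, ← hq', hunit]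
    exact Function.LeftInverse.injective (g := ⇑(Polynomial.aeval R v * q)) fun X => by
      rw [← Module.End.mul_apply, h1, Module.End.one_apply]
  · have h1 : (R' - L) * (q * Polynomial.aeval R v) = 1 := by rw [← mul_assoc, ← hq, hunit']
    exact Function.RightInverse.surjective (g := ⇑(q * Polynomial.aeval R v)) fun X => by
      rw [← Module.End.mul_apply, h1, Module.End.one_apply]

variable {𝒜 : Type*} [NormedRing 𝒜]

/-- The coefficients of the solution `H = 1 + ∑_{m ≥ 1} ξ^m H_m` of
`ξ H' = (P + ξ B) H - H P`, where `inv m` inverts `X ↦ m X - [P, X]`. -/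
noncomputable def gaugeCoeff (inv : ℕ → 𝒜 → 𝒜) (b : ℕ → 𝒜) : ℕ → 𝒜
  | 0 => 1
  | m + 1 => inv (m + 1) (∑ i : Fin (m + 1), b (m - i) * gaugeCoeff inv b i)

theorem gaugeCoeff_succ (inv : ℕ → 𝒜 → 𝒜) (b : ℕ → 𝒜) (m : ℕ) :
    gaugeCoeff inv b (m + 1) =
      inv (m + 1) (∑ i ∈ Finset.range (m + 1), b (m - i) * gaugeCoeff inv b i) := by
  rw [gaugeCoeff, Finset.sum_range]

variable [NormedAlgebra ℂ 𝒜]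

/-- The map X ↦ m X − [P, X] has an inverse of norm at most 2 / m once m ≥ 4‖P‖. This 1 / m
compensates the m terms of the convolution sum, so the coefficients grow at most geometrically. -/
theorem exists_gaugeCoeff_bound {P : 𝒜} {inv : ℕ → 𝒜 → 𝒜} {b : ℕ → 𝒜}
    (hinv : ∀ m : ℕ, 1 ≤ m → ∀ X, (m : ℂ) • inv m X - (P * inv m X - inv m X * P) = X)
    {C R : ℝ} (hC : 0 < C) (hR : 0 < R) (hb : ∀ m, ‖b m‖ ≤ C * R ^ m) :
    ∃ C' R' : ℝ, 0 < R' ∧ ∀ m, ‖gaugeCoeff inv b m‖ ≤ C' * R' ^ m := by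
  obtain ⟨m₀, hm₀⟩ := exists_nat_ge (4 * ‖P‖)
  set h := gaugeCoeff inv b with hh
  set K : ℝ := ∑ m ∈ Finset.range (m₀ + 1), ‖h m‖ with hK
  have hK0 : 0 ≤ K := Finset.sum_nonneg fun _ _ => norm_nonneg _
  -- K absorbs the finitely many coefficients with m ≤ m₀, using R' ≥ 1. The bound R' ≥ R controls
  -- b, and R' ≥ 2C closes the induction.
  refine ⟨K, max 1 (max R (2 * C)), by positivity, fun m => ?_⟩
  set R' : ℝ := max 1 (max R (2 * C)) with hR'
  have hR'1 : 1 ≤ R' := le_max_left _ _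
  have hR'R : R ≤ R' := (le_max_left _ _).trans (le_max_right _ _)
  have hR'C : 2 * C ≤ R' := (le_max_right _ _).trans (le_max_right _ _)
  induction m using Nat.strong_induction_on with
  | _ m ih =>
    by_cases hm : m ≤ m₀
    · calc ‖h m‖ ≤ K := Finset.single_le_sum (f := fun m => ‖h m‖) (fun _ _ => norm_nonneg _)
            (Finset.mem_range.2 (Nat.lt_succ_iff.2 hm))
        _ ≤ K * R' ^ m := le_mul_of_one_le_right hK0 (one_le_pow₀ hR'1)
    · push Not at hm
      obtain ⟨k, rfl⟩ := Nat.exists_eq_succ_of_ne_zero (Nat.ne_of_gt (Nat.zero_lt_of_lt hm))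
      set X := ∑ i ∈ Finset.range (k + 1), b (k - i) * h i with hX
      have h1 : h (k + 1) = inv (k + 1) X := gaugeCoeff_succ inv b k
      have h2 := hinv (k + 1) (by omega) X
      rw [← h1] at h2
      have h3 : ‖X‖ ≤ ((k + 1 : ℕ) : ℝ) * (C * K * R' ^ k) := by
        calc ‖X‖ ≤ ∑ i ∈ Finset.range (k + 1), ‖b (k - i) * h i‖ := norm_sum_le _ _
          _ ≤ ∑ i ∈ Finset.range (k + 1), C * K * R' ^ k := by
            refine Finset.sum_le_sum fun i hi => ?_
            have hi' : i ≤ k := Nat.lt_succ_iff.1 (Finset.mem_range.1 hi)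
            calc ‖b (k - i) * h i‖ ≤ ‖b (k - i)‖ * ‖h i‖ := norm_mul_le _ _
              _ ≤ (C * R' ^ (k - i)) * (K * R' ^ i) := by
                gcongr
                · exact (hb _).trans (by gcongr)
                · exact ih i (by omega)
              _ = C * K * (R' ^ (k - i) * R' ^ i) := by ring
              _ = C * K * R' ^ k := by rw [← pow_add, Nat.sub_add_cancel hi']
          _ = _ := by simp
      have h4 : ((k + 1 : ℕ) : ℝ) * ‖h (k + 1)‖ ≤ ‖X‖ + 2 * ‖P‖ * ‖h (k + 1)‖ := by
        have h5 : ((k + 1 : ℕ) : ℂ) • h (k + 1) = X + (P * h (k + 1) - h (k + 1) * P) := by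
          rw [← h2]; abel
        have h6 := congrArg norm h5
        rw [norm_smul, Complex.norm_natCast] at h6
        rw [h6]
        refine (norm_add_le _ _).trans ?_
        gcongr
        refine (norm_sub_le _ _).trans ?_
        have := norm_mul_le P (h (k + 1))
        have := norm_mul_le (h (k + 1)) P
        linarith
      have h5 : 4 * ‖P‖ ≤ ((k + 1 : ℕ) : ℝ) := hm₀.trans (by exact_mod_cast hm.le)
      have h6 : 0 < ((k + 1 : ℕ) : ℝ) := by positivity
      have h7 : ((k + 1 : ℕ) : ℝ) * ‖h (k + 1)‖ ≤ ((k + 1 : ℕ) : ℝ) * (2 * (C * K * R' ^ k)) := by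
        have := mul_le_mul_of_nonneg_right h5 (norm_nonneg (h (k + 1)))
        linarith
      have h8 := le_of_mul_le_mul_left h7 h6
      refine h8.trans ?_
      calc 2 * (C * K * R' ^ k) = (2 * C) * (K * R' ^ k) := by ring
        _ ≤ R' * (K * R' ^ k) := by gcongr
        _ = K * R' ^ (k + 1) := by ring

/-- A nonresonant Fuchsian system `ξ Y' = (P + ξ B(ξ)) Y` is reduced to `ξ Z' = P Z` by a
holomorphic gauge transformation `Y = H(ξ) Z`. -/
theorem exists_gauge [CompleteSpace 𝒜] {P : 𝒜} {B : ℂ → 𝒜} (hB : AnalyticAt ℂ B 0)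
    (hP : ∀ m : ℕ, 1 ≤ m → Function.Bijective fun X : 𝒜 => (m : ℂ) • X - (P * X - X * P)) :
    ∃ H : ℂ → 𝒜, AnalyticAt ℂ H 0 ∧ H 0 = 1 ∧
      (∀ᶠ ξ in 𝓝 (0 : ℂ), ξ • deriv H ξ = P * H ξ + ξ • (B ξ * H ξ) - H ξ * P) ∧
      ∀ T : 𝒜, Commute T P → (∀ᶠ ξ in 𝓝 (0 : ℂ), Commute T (B ξ)) →
        ∀ᶠ ξ in 𝓝 (0 : ℂ), Commute T (H ξ) := by
  obtain ⟨p, hp⟩ := hB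
  obtain ⟨b, hb⟩ : ∃ b, HasSeries B b := ⟨_, HasFPowerSeriesAt.hasSeries hp⟩
  obtain ⟨C, R, hC, hR, hbC⟩ := hb.exists_bound
  -- The inverse at m = 0 is a dummy value: the recursion only inverts for m ≥ 1.
  have hinv : ∀ m : ℕ, ∃ f : 𝒜 → 𝒜, 1 ≤ m → ∀ X, (m : ℂ) • f X - (P * f X - f X * P) = X := by
    intro m
    by_cases hm : 1 ≤ m
    · obtain ⟨f, hf⟩ := (hP m hm).2.hasRightInverse
      exact ⟨f, fun _ => hf⟩
    · exact ⟨id, fun h => absurd h hm⟩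
  choose inv hinv using hinv
  obtain ⟨C', R', hR', hh⟩ := exists_gaugeCoeff_bound hinv hC hR hbC
  set h := gaugeCoeff inv b with hdef
  have hrec : ∀ m, ((m + 1 : ℕ) : ℂ) • h (m + 1) - (P * h (m + 1) - h (m + 1) * P) =
      ∑ i ∈ Finset.range (m + 1), b (m - i) * h i := by
    intro m
    rw [hdef, gaugeCoeff_succ]
    exact hinv (m + 1) (by omega) _
  have h0 : h 0 = 1 := by rw [hdef, gaugeCoeff]
  have hH := hasSeries_of_bound hR' hh
  set H : ℂ → 𝒜 := fun ξ => ∑' m, ξ ^ m • h m with hHdef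
  refine ⟨H, hH.analyticAt, by rw [hH.apply_zero, h0], ?_, fun T hTP hTB => ?_⟩
  · have h1 : HasSeries (fun ξ => ξ • deriv H ξ) _ := hH.deriv.id_smul
    have h2 := ((hH.clm (ContinuousLinearMap.mul ℂ 𝒜 P)).add (hb.mul hH).id_smul).sub
      (hH.clm ((ContinuousLinearMap.mul ℂ 𝒜).flip P))
    have h3 : (shiftCoeff fun m => ((m : ℂ) + 1) • h (m + 1)) =
        fun m => ContinuousLinearMap.mul ℂ 𝒜 P (h m) +
          shiftCoeff (fun m => ∑ i ∈ Finset.range (m + 1), b (m - i) * h i) m -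
            (ContinuousLinearMap.mul ℂ 𝒜).flip P (h m) := by
      funext m
      cases m with
      | zero => simp [shiftCoeff, h0]
      | succ m =>
        simp only [shiftCoeff, ContinuousLinearMap.mul_apply', ContinuousLinearMap.flip_apply]
        rw [← hrec m]
        push_cast
        abel
    rw [h3] at h1
    filter_upwards [h1, h2] with ξ h4 h5
    simpa using h4.unique h5
  · have hTb : ∀ m, Commute T (b m) := by
      have h1 := hb.clm (ContinuousLinearMap.mul ℂ 𝒜 T)
      have h2 := hb.clm ((ContinuousLinearMap.mul ℂ 𝒜).flip T)
      have h3 := h1.unique (h2.congr (by filter_upwards [hTB] with ξ hξ using by simpa using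
          hξ.symm.eq))
      exact fun m => show T * b m = b m * T by simpa using congrFun h3 m
    have hTh : ∀ m, Commute T (h m) := by
      intro m
      induction m using Nat.strong_induction_on with
      | _ m ih =>
        cases m with
        | zero => rw [h0]; exact Commute.one_right T
        | succ m =>
          have h1 : Commute T (∑ i ∈ Finset.range (m + 1), b (m - i) * h i) :=
            Commute.sum_right _ _ _ fun i hi =>
              (hTb _).mul_right (ih i (Finset.mem_range.1 hi))
          rw [← hrec m] at h1
          -- T h and h T have the same image under X ↦ (m + 1) X − [P, X] because T commutes with P
          -- and with the right-hand side. Injectivity then makes them equal.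
          have h2 : (fun X : 𝒜 => ((m + 1 : ℕ) : ℂ) • X - (P * X - X * P)) (T * h (m + 1)) =
              (fun X : 𝒜 => ((m + 1 : ℕ) : ℂ) • X - (P * X - X * P)) (h (m + 1) * T) := by
            have h3 := h1.eq
            simp only [mul_sub, sub_mul, mul_smul_comm, smul_mul_assoc] at h3 ⊢
            have h4 : P * (T * h (m + 1)) = T * (P * h (m + 1)) := by
              rw [← mul_assoc, ← hTP.eq, mul_assoc]
            have h5 : h (m + 1) * T * P = h (m + 1) * P * T := by
              rw [mul_assoc, hTP.eq, mul_assoc]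
            rw [h4, h5, mul_assoc T, h3, mul_assoc P]
          exact (hP (m + 1) (by omega)).1 h2
    filter_upwards [hH] with ξ hξ
    have h1 := hξ.mul_left T
    have h2 := hξ.mul_right T
    have h3 : (fun m => T * ξ ^ m • h m) = fun m => ξ ^ m • h m * T := by
      funext m
      rw [mul_smul_comm, (hTh m).eq, smul_mul_assoc]
    rw [h3] at h1
    exact h1.unique h2

end Gauge

end LevelOne

namespace LevelOne

/-! ### Convolution systems as linear differential equations -/

section BorelSystem

/-- The convolution system `(ξ - D) f = g + K * f`, where `D = ∑ⱼ aⱼ Eⱼ` is diagonal and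
`K(ξ) = ∑ Kₖ ξ^k / k!` is entire of exponential type. -/
structure BorelSystem (J : ℕ) (V : Type*) [NormedAddCommGroup V] [NormedSpace ℂ V] where
  /-- the eigenvalues of `D` -/
  a : Fin J → ℂ
  /-- the spectral projections of `D` -/
  E : Fin J → V →L[ℂ] V
  /-- the Taylor coefficients of the kernel -/
  K : ℕ → V →L[ℂ] V
  /-- a bound of the kernel -/
  C : ℝ
  /-- an exponential type of the kernel -/
  ρ : ℝ
  E_mul : ∀ i j, E i * E j = if i = j then E i else 0
  E_sum : ∑ j, E j = 1
  ρ_pos : 0 < ρ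
  K_le : ∀ k, ‖K k‖ ≤ C * ρ ^ k

variable {J : ℕ} {V : Type*} [NormedAddCommGroup V] [NormedSpace ℂ V]

/-- The state `(y_k / ρ^k)` of a convolution system, where `y_k = g^{(k)} + K^{(k)} * f`. -/
abbrev State (V : Type*) [NormedAddCommGroup V] : Type _ := BoundedContinuousFunction ℕ V

namespace BorelSystem

variable (B : BorelSystem J V)

theorem C_nonneg : 0 ≤ B.C := by
  simpa using (norm_nonneg _).trans (B.K_le 0)

/-- The shift of the state space. -/
noncomputable def shift : State V →L[ℂ] State V :=
  LinearMap.mkContinuous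
    { toFun := fun y => (B.ρ : ℂ) • y.compContinuous ⟨Nat.succ, continuous_of_discreteTopology⟩
      map_add' := fun y z => by ext k; simp
      map_smul' := fun c y => by ext k; simp [smul_comm c] } B.ρ fun y => by
    refine (BoundedContinuousFunction.norm_le (mul_nonneg B.ρ_pos.le (norm_nonneg _))).2 fun k => ?_
    simp only [LinearMap.coe_mk, AddHom.coe_mk, BoundedContinuousFunction.coe_smul, norm_smul,
      Complex.norm_real, Real.norm_eq_abs, abs_of_pos B.ρ_pos]
    exact mul_le_mul_of_nonneg_left (y.norm_coe_le_norm _) B.ρ_pos.le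

@[simp]
theorem shift_apply (y : State V) (k : ℕ) : B.shift y k = (B.ρ : ℂ) • y (k + 1) := rfl

/-- This is the purpose of the weights ρ^{-k}: they turn the exponential type of the kernel into
boundedness of the input map. -/
theorem norm_smul_K_apply_le (v : V) (k : ℕ) : ‖((B.ρ : ℂ) ^ k)⁻¹ • B.K k v‖ ≤ B.C * ‖v‖ := by
  have hρ := pow_pos B.ρ_pos k
  rw [norm_smul, norm_inv, norm_pow, Complex.norm_real, Real.norm_eq_abs, abs_of_pos B.ρ_pos,
    inv_mul_le_iff₀ hρ]
  calc ‖B.K k v‖ ≤ ‖B.K k‖ * ‖v‖ := ContinuousLinearMap.le_opNorm _ _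
    _ ≤ (B.C * B.ρ ^ k) * ‖v‖ := by gcongr; exact B.K_le k
    _ = _ := by ring

/-- The input map of the state space: `v ↦ (Kₖ v)`. -/
noncomputable def input : V →L[ℂ] State V :=
  LinearMap.mkContinuous
    { toFun := fun v => BoundedContinuousFunction.ofNormedAddCommGroupDiscrete
        (fun k => ((B.ρ : ℂ) ^ k)⁻¹ • B.K k v) (B.C * ‖v‖) (B.norm_smul_K_apply_le v)
      map_add' := fun y z => by ext k; simp
      map_smul' := fun c y => by ext k; simp [smul_comm c] } B.C fun v =>
    (BoundedContinuousFunction.norm_le (mul_nonneg B.C_nonneg (norm_nonneg _))).2 fun k =>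
      B.norm_smul_K_apply_le v k

@[simp]
theorem input_apply (v : V) (k : ℕ) : B.input v k = ((B.ρ : ℂ) ^ k)⁻¹ • B.K k v := rfl

/-- The output map of the state space: `y ↦ y_0`. -/
noncomputable def output : State V →L[ℂ] V := BoundedContinuousFunction.evalCLM ℂ 0

@[simp]
theorem output_apply (y : State V) : output y = y 0 := rfl

theorem output_input (v : V) : output (B.input v) = B.K 0 v := by simp

/-- The residue at `aⱼ` of the differential system on the state space. -/
noncomputable def residue (j : Fin J) : State V →L[ℂ] State V := B.input ∘L B.E j ∘L output

/-- The differential system `y' = A(ξ) y` on the state space. -/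
noncomputable def system (ξ : ℂ) : State V →L[ℂ] State V :=
  B.shift + ∑ j, (ξ - B.a j)⁻¹ • B.residue j

/-- The solution of the convolution system in terms of the state: `(ξ - D)⁻¹ y_0`. -/
noncomputable def readout (ξ : ℂ) : State V →L[ℂ] V :=
  ∑ j, (ξ - B.a j)⁻¹ • (B.E j ∘L output)

/-- This is the differentiated convolution equation y_k' = y_{k+1} + K_k f with f = (ξ − D)⁻¹ y_0,
up to the weights. -/
theorem system_apply (ξ : ℂ) (y : State V) :
    B.system ξ y = B.shift y + B.input (B.readout ξ y) := by
  simp [system, readout, residue, map_sum]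

/-! ### The system at a singular point: residue, exponents and nonresonance. -/

section Local

variable (ω : ℂ)

/-- The projection on the eigenspace `ω` of `D`. -/
noncomputable def proj : V →L[ℂ] V := ∑ j with B.a j = ω, B.E j

theorem E_comp_E (i j : Fin J) (v : V) : B.E i (B.E j v) = if i = j then B.E i v else 0 := by
  have := congrArg (fun T : V →L[ℂ] V => T v) (B.E_mul i j)
  simp only [mul_apply_eq_comp] at this
  rw [this]
  split_ifs <;> rfl

theorem sum_E_apply (v : V) : ∑ j, B.E j v = v := by
  have := congrArg (fun T : V →L[ℂ] V => T v) B.E_sum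
  simpa [sum_apply] using this

theorem proj_apply (v : V) : B.proj ω v = ∑ j with B.a j = ω, B.E j v := by
  simp [proj]

theorem E_proj (j : Fin J) (v : V) : B.E j (B.proj ω v) = if B.a j = ω then B.E j v else 0 := by
  simp only [proj_apply, map_sum, E_comp_E, Finset.sum_ite_eq, Finset.mem_filter,
    Finset.mem_univ, true_and]

theorem proj_E (j : Fin J) (v : V) : B.proj ω (B.E j v) = if B.a j = ω then B.E j v else 0 := by
  simp only [proj_apply, E_comp_E, Finset.sum_ite_eq', Finset.mem_filter,
    Finset.mem_univ, true_and]

theorem proj_proj (v : V) : B.proj ω (B.proj ω v) = B.proj ω v := by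
  rw [proj_apply B ω (B.proj ω v)]
  conv_rhs => rw [proj_apply]
  refine Finset.sum_congr rfl fun j hj => ?_
  rw [E_proj, if_pos (Finset.mem_filter.1 hj).2]

/-- The exponent matrix at `ω`. -/
noncomputable def exponent : V →L[ℂ] V := B.proj ω ∘L B.K 0 ∘L B.proj ω

theorem exponent_apply (v : V) : B.exponent ω v = B.proj ω (B.K 0 (B.proj ω v)) := rfl

/-- The residue at `ω` of the differential system on the state space. -/
noncomputable def residueAt : State V →L[ℂ] State V := B.input ∘L B.proj ω ∘L output

theorem residueAt_apply (y : State V) : B.residueAt ω y = B.input (B.proj ω (output y)) := rfl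

/-- The regular part at `ω` of the differential system on the state space. -/
noncomputable def regularPart (ξ : ℂ) : State V →L[ℂ] State V :=
  B.shift + ∑ j with B.a j ≠ ω, (ξ - (B.a j - ω))⁻¹ • B.residue j

theorem residueAt_eq_sum : B.residueAt ω = ∑ j with B.a j = ω, B.residue j := by
  ext y : 1
  simp [residueAt_apply, residue, proj_apply, map_sum]

theorem system_add (ξ : ℂ) :
    B.system (ω + ξ) = ξ⁻¹ • B.residueAt ω + B.regularPart ω ξ := by
  rw [system, regularPart, residueAt_eq_sum, Finset.smul_sum, ← Finset.sum_filter_add_sum_filter_not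
    Finset.univ (fun j => B.a j = ω) (fun j => (ω + ξ - B.a j)⁻¹ • B.residue j)]
  have h1 : ∑ j with B.a j = ω, (ω + ξ - B.a j)⁻¹ • B.residue j =
      ∑ j with B.a j = ω, ξ⁻¹ • B.residue j :=
    Finset.sum_congr rfl fun j hj => by rw [(Finset.mem_filter.1 hj).2, add_sub_cancel_left]
  have h2 : ∑ j with ¬ B.a j = ω, (ω + ξ - B.a j)⁻¹ • B.residue j =
      ∑ j with B.a j ≠ ω, (ξ - (B.a j - ω))⁻¹ • B.residue j :=
    Finset.sum_congr rfl fun j _ => by congr 2; ring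
  rw [h1, h2]
  abel

theorem analyticAt_regularPart : AnalyticAt ℂ (B.regularPart ω) 0 := by
  unfold regularPart
  refine analyticAt_const.add (Finset.analyticAt_fun_sum _ fun j hj => ?_)
  have h1 : AnalyticAt ℂ (fun ξ : ℂ => ξ - (B.a j - ω)) 0 := by fun_prop
  refine AnalyticAt.smul (h1.inv ?_) analyticAt_const
  rw [zero_sub, neg_ne_zero]
  exact sub_ne_zero.2 (Finset.mem_filter.1 hj).2

/-- The singular support, seen from `ω`. -/
theorem isTame_system_add :
    IsTame ((fun b => b - ω) '' Set.range B.a) fun ξ => B.system (ω + ξ) := by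
  have : (fun ξ => B.system (ω + ξ)) =
      fun ξ => B.shift + ∑ j, (ξ - (B.a j - ω))⁻¹ • B.residue j := by
    funext ξ
    rw [system]
    congr 1
    exact Finset.sum_congr rfl fun j _ => by congr 2; ring
  rw [this]
  exact (isTame_const _).add (IsTame.sum _ fun j _ =>
    (isTame_inv_sub (Set.mem_image_of_mem _ (Set.mem_range_self j))).smul_const _)

theorem isTame_system : IsTame (Set.range B.a) B.system := by
  have := B.isTame_system_add 0
  simpa using this

theorem isTame_readout : IsTame (Set.range B.a) B.readout :=
  IsTame.sum _ fun j _ => (isTame_inv_sub (Set.mem_range_self j)).smul_const _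

/-- The spectrum of the exponent matrix lies in the strip `0 ≤ Re μ < 1`. -/
def HasGoodExponents : Prop :=
  ∀ (μ : ℂ) (v : V), B.exponent ω v = μ • v → v ≠ 0 → 0 ≤ μ.re ∧ μ.re < 1

/-- Between two consecutive residues, `output ∘ input` collapses to `K 0`, so powers of the residue
reduce to powers of the finite-dimensional exponent matrix. -/
theorem residueAt_mul_pow (k : ℕ) : B.residueAt ω * B.residueAt ω ^ k =
    B.input ∘L B.proj ω ∘L (B.exponent ω ^ k) ∘L B.proj ω ∘L output := by
  induction k with
  | zero =>
    ext1 y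
    simp [residueAt_apply, proj_proj]
  | succ k ih =>
    rw [pow_succ' (B.residueAt ω), ih, pow_succ' (B.exponent ω)]
    ext1 y
    simp only [mul_apply_eq_comp, ContinuousLinearMap.comp_apply, residueAt_apply,
      exponent_apply, output_input, proj_proj]

theorem aeval_X_mul_residueAt (q : Polynomial ℂ) :
    Polynomial.aeval (B.residueAt ω) (Polynomial.X * q) =
      B.input ∘L B.proj ω ∘L (Polynomial.aeval (B.exponent ω) q) ∘L B.proj ω ∘L output := by
  rw [map_mul, Polynomial.aeval_X]
  induction q using Polynomial.induction_on' with
  | add p q hp hq =>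
    rw [map_add, map_add, mul_add, hp, hq]
    ext1 y
    simp
  | monomial k c =>
    rw [Polynomial.aeval_monomial, Polynomial.aeval_monomial, ← Algebra.smul_def,
      ← Algebra.smul_def, mul_smul_comm, residueAt_mul_pow]
    ext1 y
    simp

/-- Cayley–Hamilton is applied to the exponent matrix rather than to the residue, which acts on an
infinite-dimensional space. The extra factor X of the annihilating polynomial only adds the root 0,
which lies in the strip. -/
theorem bijective_residueAt [FiniteDimensional ℂ V] (h : B.HasGoodExponents ω) {m : ℕ}
    (hm : 1 ≤ m) : Function.Bijective fun X : State V →L[ℂ] State V =>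
      (m : ℂ) • X - (B.residueAt ω * X - X * B.residueAt ω) := by
  let M : Module.End ℂ V := (B.exponent ω : V →ₗ[ℂ] V)
  refine bijective_natCast_sub_commutator (p := Polynomial.X * M.charpoly) ?_ ?_ hm
  · have h1 : Polynomial.aeval (B.exponent ω) M.charpoly = 0 := by
      let Φ : (V →L[ℂ] V) →ₐ[ℂ] Module.End ℂ V :=
        { ContinuousLinearMap.toLinearMapRingHom with commutes' := fun c => rfl }
      have h2 := Polynomial.aeval_algHom_apply Φ (B.exponent ω) M.charpoly
      have h3 : Polynomial.aeval (Φ (B.exponent ω)) M.charpoly = 0 :=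
          LinearMap.aeval_self_charpoly M
      rw [h3] at h2
      exact ContinuousLinearMap.coe_injective h2.symm
    rw [aeval_X_mul_residueAt, h1]
    ext1 y
    simp
  · intro μ hμ
    rw [Polynomial.eval_mul, Polynomial.eval_X, mul_eq_zero] at hμ
    rcases hμ with rfl | hμ
    · simp
    · have h1 : Module.End.HasEigenvalue M μ :=
        (Module.End.hasEigenvalue_iff_isRoot_charpoly _ _).2 hμ
      obtain ⟨v, hv⟩ := h1.exists_hasEigenvector
      exact h μ v hv.apply_eq_smul hv.2

variable [CompleteSpace V] [FiniteDimensional ℂ V]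

/-- `H` is a gauge transformation which reduces the system at `ω` to its residue. -/
structure IsGauge (H : ℂ → State V →L[ℂ] State V) : Prop where
  analyticAt : AnalyticAt ℂ H 0
  apply_zero : H 0 = 1
  deriv_eq : ∀ᶠ ξ in 𝓝 (0 : ℂ), ξ • deriv H ξ =
    B.residueAt ω * H ξ + ξ • (B.regularPart ω ξ * H ξ) - H ξ * B.residueAt ω
  commute : ∀ T : State V →L[ℂ] State V, Commute T (B.residueAt ω) →
    (∀ᶠ ξ in 𝓝 (0 : ℂ), Commute T (B.regularPart ω ξ)) → ∀ᶠ ξ in 𝓝 (0 : ℂ), Commute T (H ξ)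

theorem exists_isGauge (h : B.HasGoodExponents ω) : ∃ H, B.IsGauge ω H := by
  obtain ⟨H, h1, h2, h3, h4⟩ := exists_gauge (B.analyticAt_regularPart ω)
    fun m hm => B.bijective_residueAt ω h hm
  exact ⟨H, h1, h2, h3, h4⟩

end Local

end BorelSystem

end BorelSystem

end LevelOne

/-! ### The gauge transformation at a singular point and the solutions near it. -/

namespace LevelOne

theorem eventually_logZero_iff {p : ℂ → Prop} :
    (∀ᶠ s in logZero, p s) ↔ ∃ σ : ℝ, ∀ s : ℂ, s.re < σ → p s := by
  rw [logZero, (atBot_basis_Iio.comap Complex.re).eventually_iff]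
  simp

theorem tendsto_exp_logZero : Tendsto Complex.exp logZero (𝓝[≠] 0) := by
  refine tendsto_nhdsWithin_iff.2 ⟨?_, Eventually.of_forall fun s => Complex.exp_ne_zero s⟩
  rw [tendsto_zero_iff_norm_tendsto_zero]
  simp_rw [Complex.norm_exp]
  exact Real.tendsto_exp_atBot.comp tendsto_comap

theorem convex_re_lt (σ : ℝ) : Convex ℝ {s : ℂ | s.re < σ} :=
  (convex_Iio σ).linear_preimage Complex.reLm

theorem isOpen_re_lt (σ : ℝ) : IsOpen {s : ℂ | s.re < σ} :=
  isOpen_Iio.preimage Complex.continuous_re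

namespace BorelSystem

variable {J : ℕ} {V : Type*} [NormedAddCommGroup V] [NormedSpace ℂ V] {B : BorelSystem J V}
  {ω : ℂ} {H : ℂ → State V →L[ℂ] State V}

/-! #### Resurgence of the gauge transformation -/

variable (B ω) in
/-- The linear differential system satisfied by the gauge transformation at `ω`. -/
noncomputable def gaugeSystem (ξ : ℂ) :
    (State V →L[ℂ] State V) →L[ℂ] (State V →L[ℂ] State V) :=
  ContinuousLinearMap.mul ℂ (State V →L[ℂ] State V) (B.system (ω + ξ)) +
    (ξ - 0)⁻¹ • -(ContinuousLinearMap.mul ℂ (State V →L[ℂ] State V)).flip (B.residueAt ω)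

theorem zero_mem_sub_image (hω : ω ∈ Set.range B.a) :
    (0 : ℂ) ∈ (fun b => b - ω) '' Set.range B.a := ⟨ω, hω, sub_self ω⟩

theorem isClosed_sub_image : IsClosed ((fun b => b - ω) '' Set.range B.a) :=
  ((Set.finite_range _).image _).isClosed

theorem isTame_gaugeSystem (hω : ω ∈ Set.range B.a) :
    IsTame ((fun b => b - ω) '' Set.range B.a) (B.gaugeSystem ω) :=
  ((B.isTame_system_add ω).clm_comp _).add
    ((isTame_inv_sub (zero_mem_sub_image hω)).smul_const _)

variable [CompleteSpace V]

/-- Division of the gauge equation by ξ shows that H solves a linear system on the operator space,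
with tame coefficients when ω ∈ Ω. This makes the resurgence theorem for solutions applicable to H
itself. -/
theorem IsGauge.hasDerivAt (hH : B.IsGauge ω H) :
    ∀ᶠ ξ in 𝓝[≠] (0 : ℂ), HasDerivAt H (B.gaugeSystem ω ξ (H ξ)) ξ := by
  filter_upwards [hH.deriv_eq.filter_mono nhdsWithin_le_nhds,
    hH.analyticAt.eventually_analyticAt.filter_mono nhdsWithin_le_nhds,
    self_mem_nhdsWithin] with ξ h1 h2 h3
  have h3 : ξ ≠ 0 := h3
  have h4 := h2.differentiableAt.hasDerivAt
  have h5 : deriv H ξ = B.gaugeSystem ω ξ (H ξ) := by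
    rw [← inv_smul_smul₀ h3 (deriv H ξ), h1]
    simp only [gaugeSystem, system_add, sub_zero, add_apply, smul_apply, neg_apply,
      ContinuousLinearMap.mul_apply', ContinuousLinearMap.flip_apply, add_mul, smul_sub, smul_add,
      smul_mul_assoc, smul_neg, inv_smul_smul₀ h3]
    abel
  rwa [h5] at h4

theorem IsGauge.isSummableResurgent_inv_mul (hH : B.IsGauge ω H) (hω : ω ∈ Set.range B.a)
    (l : (State V →L[ℂ] State V) →L[ℂ] ℂ) {j : Fin J} (hj : B.a j ≠ ω) :
    IsSummableResurgent ((fun b => b - ω) '' Set.range B.a)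
      fun ξ => (ω + ξ - B.a j)⁻¹ * l (H ξ) := by
  have hfun : ∀ ξ, ω + ξ - B.a j = ξ - (B.a j - ω) := fun ξ => by ring
  simp_rw [hfun]
  refine isSummableResurgent_of_solution isClosed_sub_image (zero_mem_sub_image hω)
    (isTame_gaugeSystem hω) hH.hasDerivAt (ψ := fun ξ => (ξ - (B.a j - ω))⁻¹ • l)
    (κ := fun _ => 0) ?_
    ((isTame_inv_sub (Set.mem_image_of_mem _ (Set.mem_range_self j))).smul_const l)
    (isTame_const 0) (Eventually.of_forall fun ξ => by simp)
  have h1 : AnalyticAt ℂ (fun ξ : ℂ => ξ - (B.a j - ω)) 0 := by fun_prop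
  refine (h1.inv ?_).mul ((l.analyticAt _).comp hH.analyticAt)
  rw [zero_sub, neg_ne_zero]
  exact sub_ne_zero.2 hj

theorem analyticAt_dslope {E : Type*} [NormedAddCommGroup E] [NormedSpace ℂ E] {f : ℂ → E} {c : ℂ}
    (hf : AnalyticAt ℂ f c) : AnalyticAt ℂ (dslope f c) c := by
  obtain ⟨p, hp⟩ := hf
  exact hp.has_fpower_series_dslope_fslope.analyticAt

theorem dslope_zero_eq {E : Type*} [NormedAddCommGroup E] [NormedSpace ℂ E] {f : ℂ → E} {ξ : ℂ}
    (hξ : ξ ≠ 0) : dslope f 0 ξ = ξ⁻¹ • (f ξ - f 0) := by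
  rw [dslope_of_ne f hξ, slope_def_module, sub_zero]

/-- The difference quotient is ξ⁻¹ l(H) − ξ⁻¹ l(1), an affine function of the solution H. The
inhomogeneous term κ of `isSummableResurgent_of_solution` serves this case. -/
theorem IsGauge.isSummableResurgent_dslope (hH : B.IsGauge ω H) (hω : ω ∈ Set.range B.a)
    (l : (State V →L[ℂ] State V) →L[ℂ] ℂ) :
    IsSummableResurgent ((fun b => b - ω) '' Set.range B.a) fun ξ => l (dslope H 0 ξ) := by
  have h0 := zero_mem_sub_image hω
  refine isSummableResurgent_of_solution isClosed_sub_image h0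
    (isTame_gaugeSystem hω) hH.hasDerivAt (ψ := fun ξ => (ξ - 0)⁻¹ • l)
    (κ := fun ξ => (ξ - 0)⁻¹ • (-l 1)) ?_
    ((isTame_inv_sub h0).smul_const l) ((isTame_inv_sub h0).smul_const _) ?_
  · exact (l.analyticAt _).comp (analyticAt_dslope hH.analyticAt)
  · filter_upwards [self_mem_nhdsWithin] with ξ hξ
    rw [dslope_zero_eq hξ, map_smul, map_sub, hH.apply_zero]
    simp
    ring

/-! #### Solutions near a singular point -/

/-- A solution of the system on the Riemann surface of the logarithm over a punctured disc
centred at `ω`. -/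
theorem IsGauge.exists_eq (hH : B.IsGauge ω H) {σ : ℝ} {y : ℂ → State V}
    (hy : SolvesOn (fun s => Complex.exp s • B.system (ω + Complex.exp s)) {s | s.re < σ} y) :
    ∃ y₀ : State V, ∀ Ψ : ℂ → V, Ψ 0 = 0 →
      (∀ s, HasDerivAt Ψ (B.proj ω (output y₀) + B.exponent ω (Ψ s)) s) →
      ∀ᶠ s in logZero, y s = H (Complex.exp s) (y₀ + B.input (B.proj ω (Ψ s))) := by
  have hunit : ∀ᶠ ξ in 𝓝 (0 : ℂ), IsUnit (H ξ) :=
    hH.analyticAt.continuousAt.eventually (by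
      rw [hH.apply_zero]
      exact Units.isOpen.mem_nhds isUnit_one)
  have hev := ((hunit.and (hH.analyticAt.eventually_analyticAt.and
    (hH.deriv_eq.and (B.analyticAt_regularPart ω).eventually_analyticAt))).filter_mono
      nhdsWithin_le_nhds : ∀ᶠ ξ in 𝓝[≠] (0 : ℂ), _)
  obtain ⟨σ₁, hσ₁⟩ := eventually_logZero_iff.1 (tendsto_exp_logZero.eventually hev)
  set τ := min σ σ₁ with hτ
  let P := B.residueAt ω
  have hsys : ∀ s, Complex.exp s • B.system (ω + Complex.exp s) =
      P + Complex.exp s • B.regularPart ω (Complex.exp s) := fun s => by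
    rw [system_add, smul_add, smul_inv_smul₀ (Complex.exp_ne_zero s)]
  have hcont : ContinuousOn (fun s => Complex.exp s • B.system (ω + Complex.exp s))
      {s | s.re < τ} := by
    simp_rw [hsys]
    intro s hs
    have h1 := (hσ₁ s (lt_of_lt_of_le hs (min_le_right _ _))).2.2.2.continuousAt
    have h2 : ContinuousAt (fun s => B.regularPart ω (Complex.exp s)) s :=
      ContinuousAt.comp (f := Complex.exp) h1 (by fun_prop)
    exact (continuousAt_const.add ((by fun_prop : ContinuousAt Complex.exp s).smul
        h2)).continuousWithinAt
  obtain ⟨s₀, hs₀⟩ : ∃ s₀ : ℂ, s₀.re < τ := ⟨((τ - 1 : ℝ) : ℂ), by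
    rw [Complex.ofReal_re]; linarith⟩
  obtain ⟨u, hu⟩ := (hσ₁ s₀ (lt_of_lt_of_le hs₀ (min_le_right _ _))).1
  -- In the logarithmic coordinate the reduced system ξ Z' = P Z has constant coefficients. The
  -- initial value is chosen so that H w and y agree at s₀.
  obtain ⟨w, hw, hw0⟩ := exists_solvesOn (A := fun _ => P) convex_univ isOpen_univ
    (differentiableOn_const _) (Set.mem_univ s₀) ((↑u⁻¹ : State V →L[ℂ] State V) (y s₀))
  have hsol : SolvesOn (fun s => Complex.exp s • B.system (ω + Complex.exp s)) {s | s.re < τ}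
      fun s => H (Complex.exp s) (w s) := by
    intro s hs
    obtain ⟨-, h1, h2, -⟩ := hσ₁ s (lt_of_lt_of_le hs (min_le_right _ _))
    have h3 : HasDerivAt (fun s => H (Complex.exp s)) (Complex.exp s • deriv H (Complex.exp s)) s :=
      h1.differentiableAt.hasDerivAt.scomp s (Complex.hasDerivAt_exp s)
    refine (h3.clm_apply (hw s (Set.mem_univ s))).congr_deriv ?_
    rw [h2]
    simp only [hsys, add_apply, sub_apply, smul_apply, mul_apply_eq_comp, P]
    abel
  have hval : y s₀ = H (Complex.exp s₀) (w s₀) := by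
    rw [hw0, ← hu, ← mul_apply_eq_comp, Units.mul_inv]
    rfl
  have heq : Set.EqOn y (fun s => H (Complex.exp s) (w s)) {s | s.re < τ} :=
    (hy.mono fun s (hs : s.re < τ) => hs.trans_le (min_le_left _ _)).eqOn_of_convex hsol
      (convex_re_lt τ) hcont hs₀ hval
  refine ⟨w 0, fun Ψ hΨ0 hΨ => eventually_logZero_iff.2 ⟨τ, fun s hs => ?_⟩⟩
  -- As P factors through V, the solution moves only within `input` of V, and w' = P w reduces to
  -- the finite-dimensional equation satisfied by Ψ.
  have h2 : SolvesOn (fun _ => P) Set.univ fun s : ℂ => w 0 + B.input (B.proj ω (Ψ s)) := by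
    intro s _
    refine (((B.input ∘L B.proj ω).hasFDerivAt.comp_hasDerivAt s (hΨ s)).const_add
      (w 0)).congr_deriv ?_
    simp only [P, residueAt_apply, ContinuousLinearMap.comp_apply, map_add, output_input,
      exponent_apply, proj_proj]
  have h3 := hw.eqOn_of_convex h2 convex_univ continuousOn_const (Set.mem_univ 0) (by simp [hΨ0])
  exact (heq hs).trans (congrArg (H (Complex.exp s)) (h3 (Set.mem_univ s)))

end BorelSystem

end LevelOne

namespace LevelOne

namespace BorelSystem

variable {J : ℕ} {V : Type*} [NormedAddCommGroup V] [NormedSpace ℂ V] {B : BorelSystem J V}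
  {H : ℂ → State V →L[ℂ] State V}

/-! #### The formal solution -/

variable (B) in
/-- The diagonal part `D = ∑ⱼ aⱼ Eⱼ` of the system. -/
noncomputable def diag : V →L[ℂ] V := ∑ j, B.a j • B.E j

theorem diag_apply (v : V) : B.diag v = ∑ j, B.a j • B.E j v := by
  simp [diag]

theorem E_diag (j : Fin J) (v : V) : B.E j (B.diag v) = B.a j • B.E j v := by
  simp [diag_apply, map_sum, E_comp_E]

theorem proj_zero_diag (v : V) : B.proj 0 (B.diag v) = 0 := by
  rw [proj_apply]
  refine Finset.sum_eq_zero fun j hj => ?_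
  rw [E_diag, (Finset.mem_filter.1 hj).2, zero_smul]

theorem proj_zero_eq_self {v : V} (h : B.diag v = 0) : B.proj 0 v = v := by
  conv_rhs => rw [← B.sum_E_apply v]
  rw [proj_apply, Finset.sum_filter]
  refine Finset.sum_congr rfl fun j _ => ?_
  split_ifs with hj
  · rfl
  · have := E_diag (B := B) j v
    rw [h, map_zero, eq_comm, smul_eq_zero] at this
    exact (this.resolve_left hj).symm

variable (B H) in
/-- The regular solution of the system at `0`, as a function on the state space. -/
noncomputable def regularState (v : V) (ξ : ℂ) : State V := H ξ (B.input v)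

variable (B H) in
/-- The regular solution of the convolution system at `0`. -/
noncomputable def regularSolution (v : V) (ξ : ℂ) : V :=
  ∑ j with B.a j ≠ 0, (ξ - B.a j)⁻¹ • B.E j (output (B.regularState H v ξ)) +
    B.proj 0 (output (dslope (B.regularState H v) 0 ξ))

theorem regularState_zero (hH : B.IsGauge 0 H) (v : V) : B.regularState H v 0 = B.input v := by
  rw [regularState, hH.apply_zero]; rfl

/-- The condition on v says that the part of y_0(0) in the kernel of D vanishes. The pole of (ξ −
D)⁻¹ at 0 is thus removable, and the difference quotient fills it in. -/
theorem regularSolution_eq (hH : B.IsGauge 0 H) {v : V} (hv : B.proj 0 (B.K 0 v) = 0) {ξ : ℂ}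
    (hξ : ξ ≠ 0) : B.regularSolution H v ξ = B.readout ξ (B.regularState H v ξ) := by
  rw [regularSolution, dslope_zero_eq hξ, regularState_zero hH, map_smul, map_sub, map_smul,
    map_sub, output_input, hv, sub_zero, readout, sum_apply,
    ← Finset.sum_filter_add_sum_filter_not Finset.univ (fun j => B.a j = 0), add_comm]
  congr 1
  rw [proj_apply, Finset.smul_sum]
  refine Finset.sum_congr rfl fun j hj => ?_
  simp [(Finset.mem_filter.1 hj).2]

theorem sub_diag_regularSolution (hH : B.IsGauge 0 H) {v : V} (hv : B.proj 0 (B.K 0 v) = 0) :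
    ∀ᶠ ξ in 𝓝[≠] (0 : ℂ), ξ • B.regularSolution H v ξ - B.diag (B.regularSolution H v ξ) =
      output (B.regularState H v ξ) := by
  have h1 : ∀ᶠ ξ in 𝓝[≠] (0 : ℂ), ∀ j, ξ ≠ B.a j := by
    refine eventually_all.2 fun j => ?_
    by_cases hj : B.a j = 0
    · rw [hj]; exact self_mem_nhdsWithin
    · exact mem_nhdsWithin_of_mem_nhds (isOpen_ne.mem_nhds (Ne.symm hj))
  filter_upwards [h1, self_mem_nhdsWithin] with ξ h2 h3
  rw [regularSolution_eq hH hv h3]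
  generalize B.regularState H v ξ = y
  conv_rhs => rw [← B.sum_E_apply (output y)]
  simp only [readout, sum_apply, smul_apply, ContinuousLinearMap.comp_apply, map_sum, map_smul,
    diag_apply, E_comp_E, Finset.smul_sum, ← Finset.sum_sub_distrib]
  refine Finset.sum_congr rfl fun j _ => ?_
  have h4 : ξ - B.a j ≠ 0 := sub_ne_zero.2 (h2 j)
  rw [Finset.sum_eq_single j]
  · simp only [if_true, smul_smul, ← sub_smul]
    rw [show ξ * (ξ - B.a j)⁻¹ - (ξ - B.a j)⁻¹ * B.a j = 1 by field_simp, one_smul]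
  · intro i _ hij
    simp [hij]
  · simp

variable [CompleteSpace V]

theorem analyticAt_regularState (hH : B.IsGauge 0 H) (v : V) :
    AnalyticAt ℂ (B.regularState H v) 0 :=
  analyticAt_clm_apply hH.analyticAt analyticAt_const

theorem analyticAt_regularSolution (hH : B.IsGauge 0 H) (v : V) :
    AnalyticAt ℂ (B.regularSolution H v) 0 := by
  unfold regularSolution
  refine AnalyticAt.add (Finset.analyticAt_fun_sum _ fun j hj => ?_) ?_
  · have h1 : AnalyticAt ℂ (fun ξ : ℂ => ξ - B.a j) 0 := by fun_prop
    refine (h1.inv (by simpa using (Finset.mem_filter.1 hj).2)).smul ?_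
    exact ((B.E j ∘L output).analyticAt _).comp (analyticAt_regularState hH v)
  · exact ((B.proj 0 ∘L output).analyticAt _).comp
      (analyticAt_dslope (analyticAt_regularState hH v))

/-- The condition on v says that the residue at 0 kills the initial state, so the term H P / ξ of
the gauge equation disappears. -/
theorem hasDerivAt_regularState (hH : B.IsGauge 0 H) {v : V} (hv : B.proj 0 (B.K 0 v) = 0) :
    ∀ᶠ ξ in 𝓝[≠] (0 : ℂ),
      HasDerivAt (B.regularState H v) (B.system ξ (B.regularState H v ξ)) ξ := by
  filter_upwards [hH.hasDerivAt] with ξ h1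
  refine (h1.clm_apply (hasDerivAt_const ξ (B.input v))).congr_deriv ?_
  simp [gaugeSystem, regularState, residueAt_apply, hv]

theorem eventuallyEq_of_analyticAt {E : Type*} [NormedAddCommGroup E] [NormedSpace ℂ E]
    {f g : ℂ → E} {c : ℂ} (hf : AnalyticAt ℂ f c) (hg : AnalyticAt ℂ g c)
    (h : ∀ᶠ ξ in 𝓝[≠] c, f ξ = g ξ) : f =ᶠ[𝓝 c] g :=
  (hf.frequently_eq_iff_eventually_eq hg).1 h.frequently

/-- The formal solution of the convolution system is the Taylor expansion of its regular
solution. -/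
theorem hasSeries_regularSolution (hH : B.IsGauge 0 H) (hB : B.HasGoodExponents 0) {F : ℕ → V}
    (hF : ∀ m : ℕ, (m : ℂ) • F m - B.diag (F (m + 1)) =
      ∑ i ∈ Finset.range (m + 1), B.K (m - i) (F i)) :
    B.proj 0 (B.K 0 (F 0)) = 0 ∧
      HasSeries (B.regularSolution H (F 0)) fun m => ((m.factorial : ℂ))⁻¹ • F (m + 1) := by
  have hv : B.proj 0 (B.K 0 (F 0)) = 0 := by
    have := congrArg (B.proj 0) (hF 0)
    simpa [proj_zero_diag] using this.symm
  refine ⟨hv, ?_⟩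
  obtain ⟨p, hp⟩ := analyticAt_regularState hH (F 0)
  obtain ⟨q, hq⟩ := analyticAt_regularSolution hH (F 0)
  obtain ⟨c, hc⟩ : ∃ c, HasSeries (B.regularState H (F 0)) c := ⟨_, HasFPowerSeriesAt.hasSeries hp⟩
  obtain ⟨φ, hφ⟩ : ∃ φ, HasSeries (B.regularSolution H (F 0)) φ :=
    ⟨_, HasFPowerSeriesAt.hasSeries hq⟩
  have hc0 : c 0 = B.input (F 0) := by rw [← hc.apply_zero, regularState_zero hH]
  have hrel : ∀ m, shiftCoeff φ m - B.diag (φ m) = output (c m) := by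
    have h1 := hφ.id_smul.sub (hφ.clm B.diag)
    have h2 := hc.clm (output (V := V))
    have h3 := h1.unique (h2.congr (eventuallyEq_of_analyticAt h2.analyticAt h1.analyticAt
      (by filter_upwards [sub_diag_regularSolution hH hv] with ξ h using h.symm)))
    exact fun m => congrFun h3 m
  have hode : ∀ m : ℕ, ((m : ℂ) + 1) • c (m + 1) = B.shift (c m) + B.input (φ m) := by
    have h1 := hc.deriv
    have h2 := (hc.clm B.shift).add (hφ.clm B.input)
    have h3 := h1.unique (h2.congr (eventuallyEq_of_analyticAt h2.analyticAt h1.analyticAt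
      (by
        filter_upwards [hasDerivAt_regularState hH hv, self_mem_nhdsWithin] with ξ h h'
        rw [h.deriv, system_apply, regularSolution_eq hH hv h'])))
    exact fun m => congrFun h3 m
  -- The Taylor coefficients of the whole state are carried along: the formula for c m is that of
  -- the sequences g^{(k)} + K^{(k)} * f for the formal solution. The middle clause covers m = 0,
  -- where no coefficient of index m − 1 exists.
  have key : ∀ m : ℕ, (∀ k, c m k = ((B.ρ : ℂ) ^ k)⁻¹ • ((m.factorial : ℂ))⁻¹ •
      ∑ i ∈ Finset.range (m + 1), B.K (k + m - i) (F i)) ∧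
      shiftCoeff φ m = (m : ℂ) • ((m.factorial : ℂ))⁻¹ • F m ∧
      φ m = ((m.factorial : ℂ))⁻¹ • F (m + 1) := by
    intro m
    have hstep : ∀ m : ℕ, (∀ k, c m k = ((B.ρ : ℂ) ^ k)⁻¹ • ((m.factorial : ℂ))⁻¹ •
        ∑ i ∈ Finset.range (m + 1), B.K (k + m - i) (F i)) →
        shiftCoeff φ m = (m : ℂ) • ((m.factorial : ℂ))⁻¹ • F m →
        φ m = ((m.factorial : ℂ))⁻¹ • F (m + 1) := by
      intro m h1 h2
      set μ : ℂ := ((m.factorial : ℂ))⁻¹ with hμ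
      -- The relation at order m determines the new coefficient only up to the kernel of D.
      have h3 : B.diag (φ m - μ • F (m + 1)) = 0 := by
        have h4 := hrel m
        rw [h2, output_apply, h1 0, pow_zero, inv_one, one_smul, zero_add, ← hF m] at h4
        rw [map_sub, map_smul]
        rw [smul_sub, smul_comm] at h4
        exact sub_eq_zero.2 (sub_right_injective h4)
      have h4 := proj_zero_eq_self h3
      have h5 : ((m : ℂ) + 1) • B.proj 0 (φ m) =
          B.proj 0 (output (B.shift (c m))) + B.proj 0 (B.K 0 (φ m)) := by
        have h6 := congrArg (fun y => B.proj 0 (output y)) (hode m)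
        simp only [map_smul, map_add, output_input] at h6
        rw [← h6, ← hrel (m + 1), map_sub, proj_zero_diag, sub_zero]
        rfl
      have h6 : ((m : ℂ) + 1) • B.proj 0 (μ • F (m + 1)) =
          B.proj 0 (output (B.shift (c m))) + B.proj 0 (B.K 0 (μ • F (m + 1))) := by
        have h7 := congrArg (fun v => μ • B.proj 0 v) (hF (m + 1))
        simp only [map_sub, proj_zero_diag, sub_zero] at h7
        rw [Finset.sum_range_succ, Nat.sub_self, map_add, smul_add, map_smul, smul_comm] at h7
        push_cast at h7
        rw [map_smul, h7, map_smul, map_smul]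
        congr 1
        rw [output_apply, shift_apply, h1 (0 + 1), zero_add, pow_one,
          smul_inv_smul₀ (by exact_mod_cast B.ρ_pos.ne'), map_smul]
        congr 2
        exact Finset.sum_congr rfl fun i _ => by rw [add_comm 1 m]
      -- The relation at order m + 1, projected on the kernel of D, shows that a nonzero discrepancy
      -- would be an eigenvector of the exponent matrix for m + 1, outside the strip.
      have h7 : B.exponent 0 (φ m - μ • F (m + 1)) = ((m : ℂ) + 1) • (φ m - μ • F (m + 1)) := by
        rw [exponent_apply, h4]
        conv_rhs => rw [← h4]
        rw [map_sub, map_sub, map_sub, smul_sub, h5, h6]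
        abel
      by_contra hne
      have h8 := (hB _ _ h7 (sub_ne_zero.2 hne)).2
      simp at h8
      have : (0 : ℝ) ≤ m := Nat.cast_nonneg m
      linarith
    induction m with
    | zero =>
      have h1 : ∀ k, c 0 k = ((B.ρ : ℂ) ^ k)⁻¹ • ((Nat.factorial 0 : ℂ))⁻¹ •
          ∑ i ∈ Finset.range (0 + 1), B.K (k + 0 - i) (F i) := by
        intro k
        simp [hc0]
      have h2 : shiftCoeff φ 0 = ((0 : ℕ) : ℂ) • ((Nat.factorial 0 : ℂ))⁻¹ • F 0 := by
        simp [shiftCoeff]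
      exact ⟨h1, h2, hstep 0 h1 h2⟩
    | succ m ih =>
      obtain ⟨ih1, -, ih3⟩ := ih
      have hm : ((m : ℂ) + 1) ≠ 0 := by exact_mod_cast Nat.succ_ne_zero m
      have hfac : (((m + 1).factorial : ℂ))⁻¹ = ((m : ℂ) + 1)⁻¹ * ((m.factorial : ℂ))⁻¹ := by
        rw [Nat.factorial_succ]; push_cast; rw [mul_inv]
      have h1 : ∀ k, c (m + 1) k = ((B.ρ : ℂ) ^ k)⁻¹ • (((m + 1).factorial : ℂ))⁻¹ •
          ∑ i ∈ Finset.range (m + 1 + 1), B.K (k + (m + 1) - i) (F i) := by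
        intro k
        have h3 := congrArg (fun y : State V => ((m : ℂ) + 1)⁻¹ • y k) (hode m)
        simp only [BoundedContinuousFunction.coe_smul, BoundedContinuousFunction.coe_add,
          Pi.add_apply, shift_apply, input_apply, inv_smul_smul₀ hm] at h3
        have hρ : (B.ρ : ℂ) ≠ 0 := by exact_mod_cast B.ρ_pos.ne'
        rw [h3, ih1 (k + 1), ih3, hfac, Finset.sum_range_succ _ (m + 1), map_smul]
        have h4 : k + (m + 1) - (m + 1) = k := by omega
        have h5 : (B.ρ : ℂ) * ((B.ρ : ℂ) ^ (k + 1))⁻¹ = ((B.ρ : ℂ) ^ k)⁻¹ := by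
          rw [pow_succ']; field_simp
        have h6 : ∀ i, k + 1 + m - i = k + (m + 1) - i := fun i => by omega
        simp_rw [h6]
        rw [h4, smul_smul (B.ρ : ℂ), h5, ← smul_add, ← smul_add]
        simp only [mul_smul]
        rw [smul_comm ((m : ℂ) + 1)⁻¹]
      have h2 : shiftCoeff φ (m + 1) =
          ((m + 1 : ℕ) : ℂ) • (((m + 1).factorial : ℂ))⁻¹ • F (m + 1) := by
        rw [shiftCoeff, ih3, hfac, mul_smul]
        push_cast
        rw [smul_inv_smul₀ hm]
      exact ⟨h1, h2, hstep _ h1 h2⟩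
  have : φ = fun m => ((m.factorial : ℂ))⁻¹ • F (m + 1) := funext fun m => (key m).2.2
  exact this ▸ hφ

end BorelSystem

end LevelOne

namespace LevelOne

/-! ### The coefficients of a formal solution -/

section Formal

variable {J : ℕ} {n : Fin J → ℕ}

/-- The matrix `L = ⨁ⱼ (λⱼ I + J_{nⱼ})` of the normal form. -/
noncomputable def exponentMatrix (n : Fin J → ℕ) (lam : Fin J → ℂ) : Matrix (Idx n) (Idx n) ℂ :=
  Matrix.blockDiagonal' fun j => lam j • (1 : Matrix (Fin (n j)) (Fin (n j)) ℂ) + jordan (n j)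

theorem normalForm_apply (a lam : Fin J → ℂ) (i k : Idx n) :
    normalForm n a lam i k =
      PowerSeries.C (Matrix.diagonal (fun i : Idx n => a i.1) i k) +
        PowerSeries.X * PowerSeries.C (exponentMatrix n lam i k) := by
  obtain ⟨j, r⟩ := i
  obtain ⟨j', r'⟩ := k
  by_cases hj : j = j'
  · subst hj
    by_cases hr : r = r'
    · subst hr
      simp [normalForm, exponentMatrix, Matrix.blockDiagonal'_apply_eq, mul_add]
      ring
    · simp [normalForm, exponentMatrix, Matrix.blockDiagonal'_apply_eq, hr]
  · rw [normalForm, exponentMatrix, Matrix.blockDiagonal'_apply_ne _ _ _ hj,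
      Matrix.blockDiagonal'_apply_ne _ _ _ hj, Matrix.diagonal_apply_ne _ (by simp [hj])]
    simp

theorem coeff_mul_normalForm (a lam : Fin J → ℂ) (F : Matrix (Idx n) (Idx n) ℂ⟦X⟧) (i k : Idx n)
    (m : ℕ) : PowerSeries.coeff (m + 1) ((F * normalForm n a lam) i k) =
      PowerSeries.coeff (m + 1) (F i k) * a k.1 +
        ∑ l, PowerSeries.coeff m (F i l) * exponentMatrix n lam l k := by
  simp only [Matrix.mul_apply, normalForm_apply, map_sum, mul_add, map_add, Finset.sum_add_distrib]
  congr 1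
  · rw [Finset.sum_eq_single k]
    · simp
    · intro l _ hl
      simp [Matrix.diagonal_apply_ne _ hl]
    · simp
  · refine Finset.sum_congr rfl fun l _ => ?_
    rw [← mul_assoc, PowerSeries.coeff_mul_C, PowerSeries.coeff_succ_mul_X]

theorem coeff_zero_mul_normalForm (a lam : Fin J → ℂ) (F : Matrix (Idx n) (Idx n) ℂ⟦X⟧)
    (i k : Idx n) : PowerSeries.coeff 0 ((F * normalForm n a lam) i k) =
      PowerSeries.coeff 0 (F i k) * a k.1 := by
  simp only [Matrix.mul_apply, normalForm_apply, map_sum, mul_add, map_add, Finset.sum_add_distrib]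
  rw [Finset.sum_eq_single k]
  · simp
  · intro l _ hl
    simp [Matrix.diagonal_apply_ne _ hl]
  · simp

theorem coeff_X_sq_smul_derivative (F : Matrix (Idx n) (Idx n) ℂ⟦X⟧) (i k : Idx n) (m : ℕ) :
    PowerSeries.coeff (m + 1) (((PowerSeries.X : ℂ⟦X⟧) ^ 2 •
      F.map (fun p => PowerSeries.derivative ℂ p)) i k) = m * PowerSeries.coeff m (F i k) := by
  rw [Matrix.smul_apply, Matrix.map_apply, smul_eq_mul, pow_two, mul_assoc,
    PowerSeries.coeff_succ_X_mul]
  cases m with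
  | zero => simp
  | succ m =>
    rw [PowerSeries.coeff_succ_X_mul, PowerSeries.coeff_derivative]
    push_cast
    ring

/-- The equation satisfied by the coefficients of a formal solution. -/
theorem IsFormalSolution.coeff_succ {a lam : Fin J → ℂ} {A F : Matrix (Idx n) (Idx n) ℂ⟦X⟧}
    (hF : IsFormalSolution n a lam A F) (m : ℕ) (i k : Idx n) :
    (m : ℂ) * PowerSeries.coeff m (F i k) =
      ∑ p ∈ Finset.range (m + 2), ∑ l, PowerSeries.coeff (m + 1 - p) (A i l) *
        PowerSeries.coeff p (F l k) -
      (PowerSeries.coeff (m + 1) (F i k) * a k.1 +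
        ∑ l, PowerSeries.coeff m (F i l) * exponentMatrix n lam l k) := by
  have h := congrArg (PowerSeries.coeff (m + 1)) (congrFun (congrFun hF i) k)
  rw [coeff_X_sq_smul_derivative, Matrix.sub_apply, map_sub, coeff_mul_normalForm] at h
  rw [h, Matrix.mul_apply, map_sum, Finset.sum_comm]
  congr 1
  refine Finset.sum_congr rfl fun l _ => ?_
  rw [PowerSeries.coeff_mul, ← Finset.Nat.sum_antidiagonal_swap,
    Finset.Nat.sum_antidiagonal_eq_sum_range_succ_mk]
  rfl

theorem coeff_zero_eq {F : Matrix (Idx n) (Idx n) ℂ⟦X⟧}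
    (hF0 : F.map PowerSeries.constantCoeff = 1) (i k : Idx n) :
    PowerSeries.coeff 0 (F i k) = if i = k then 1 else 0 := by
  have := congrFun (congrFun hF0 i) k
  rw [Matrix.map_apply, Matrix.one_apply] at this
  simpa using this

theorem IsFormalSolution.coeff_zero {a lam : Fin J → ℂ} {A F : Matrix (Idx n) (Idx n) ℂ⟦X⟧}
    (hF : IsFormalSolution n a lam A F) (hF0 : F.map PowerSeries.constantCoeff = 1) (i k : Idx n) :
    PowerSeries.coeff 0 (A i k) = if i = k then a i.1 else 0 := by
  have h := congrArg (PowerSeries.coeff 0) (congrFun (congrFun hF i) k)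
  rw [Matrix.sub_apply, map_sub, coeff_zero_mul_normalForm, coeff_zero_eq hF0, Matrix.mul_apply,
    map_sum] at h
  have h1 : PowerSeries.coeff 0 (((PowerSeries.X : ℂ⟦X⟧) ^ 2 •
      F.map (fun p => PowerSeries.derivative ℂ p)) i k) = 0 := by
    rw [Matrix.smul_apply, smul_eq_mul, PowerSeries.coeff_zero_eq_constantCoeff, map_mul, map_pow,
      PowerSeries.constantCoeff_X]
    simp
  have h2 : ∑ l, PowerSeries.coeff 0 (A i l * F l k) = PowerSeries.coeff 0 (A i k) := by
    have h3 : ∀ l, PowerSeries.coeff 0 (A i l * F l k) =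
        PowerSeries.coeff 0 (A i l) * if l = k then 1 else 0 := fun l => by
      rw [← coeff_zero_eq hF0 l k]
      simp
    simp [h3]
  rw [h1, h2, eq_comm, sub_eq_zero] at h
  rw [h]
  split_ifs with hik
  · rw [hik, one_mul]
  · rw [zero_mul]

/-- The diagonal blocks of the coefficient of `x` in `A`. -/
theorem IsFormalSolution.coeff_one {a lam : Fin J → ℂ} {A F : Matrix (Idx n) (Idx n) ℂ⟦X⟧}
    (hF : IsFormalSolution n a lam A F) (hF0 : F.map PowerSeries.constantCoeff = 1) {i k : Idx n}
    (hik : a i.1 = a k.1) : PowerSeries.coeff 1 (A i k) = exponentMatrix n lam i k := by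
  -- At this order A₁ − L = F₁ D − D F₁, whose (i, k) entry carries the factor a_k − a_i and
  -- vanishes here.
  have h := hF.coeff_succ 0 i k
  simp only [coeff_zero_eq hF0, hF.coeff_zero hF0, Finset.sum_range_succ, Finset.sum_range_zero,
    Nat.cast_zero, zero_mul, zero_add, Nat.sub_zero, Nat.sub_self, mul_ite, ite_mul, mul_one,
    mul_zero, one_mul, Finset.sum_ite_eq, Finset.sum_ite_eq', Finset.mem_univ, if_true,
        ite_self] at h
  rw [hik] at h
  linear_combination -h

theorem sum_blockDiagonal'_mul (M : (j : Fin J) → Matrix (Fin (n j)) (Fin (n j)) ℂ) (j : Fin J)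
    (r : Fin (n j)) (f : Idx n → ℂ) :
    ∑ k, Matrix.blockDiagonal' M ⟨j, r⟩ k * f k = ∑ r', M j r r' * f ⟨j, r'⟩ := by
  rw [Fintype.sum_sigma, Finset.sum_eq_single j]
  · simp only [Matrix.blockDiagonal'_apply_eq]
  · intro j' _ hj'
    refine Finset.sum_eq_zero fun r' _ => ?_
    rw [Matrix.blockDiagonal'_apply_ne _ _ _ (Ne.symm hj'), zero_mul]
  · simp

end Formal

/-! ### The convolution system attached to a level-one linear differential system -/

section Columns

variable {J : ℕ} [NeZero J] {n : Fin J → ℕ}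

/-- Matrices whose columns are indexed by the first block. -/
abbrev Cols {J : ℕ} [NeZero J] (n : Fin J → ℕ) : Type := Idx n → Fin (n 0) → ℂ

/-- Left multiplication by a square matrix. -/
noncomputable def leftMul (A : Matrix (Idx n) (Idx n) ℂ) : Cols n →L[ℂ] Cols n :=
  LinearMap.toContinuousLinearMap
    { toFun := fun X i q => ∑ k, A i k * X k q
      map_add' := fun X Y => by ext i q; simp [mul_add, Finset.sum_add_distrib]
      map_smul' := fun c X => by
        ext i q
        simp only [Pi.smul_apply, smul_eq_mul, RingHom.id_apply, Finset.mul_sum]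
        exact Finset.sum_congr rfl fun k _ => by ring }

@[simp]
theorem leftMul_apply (A : Matrix (Idx n) (Idx n) ℂ) (X : Cols n) (i : Idx n) (q : Fin (n 0)) :
    leftMul A X i q = ∑ k, A i k * X k q := rfl

/-- Right multiplication by the nilpotent Jordan block. -/
noncomputable def rightJordan (n : Fin J → ℕ) : Cols n →L[ℂ] Cols n :=
  LinearMap.toContinuousLinearMap
    { toFun := fun X i q => ∑ p, X i p * jordan (n 0) p q
      map_add' := fun X Y => by ext i q; simp [add_mul, Finset.sum_add_distrib]
      map_smul' := fun c X => by
        ext i q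
        simp only [Pi.smul_apply, smul_eq_mul, RingHom.id_apply, Finset.mul_sum]
        exact Finset.sum_congr rfl fun k _ => by ring }

@[simp]
theorem rightJordan_apply (X : Cols n) (i : Idx n) (q : Fin (n 0)) :
    rightJordan n X i q = ∑ p, X i p * jordan (n 0) p q := rfl

/-- The projection on a block of rows. -/
noncomputable def rowProj (n : Fin J → ℕ) (j : Fin J) : Cols n →L[ℂ] Cols n :=
  LinearMap.toContinuousLinearMap
    { toFun := fun X i q => if i.1 = j then X i q else 0
      map_add' := fun X Y => by ext i q; simp only [Pi.add_apply]; split_ifs <;> simp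
      map_smul' := fun c X => by ext i q; simp }

@[simp]
theorem rowProj_apply (j : Fin J) (X : Cols n) (i : Idx n) (q : Fin (n 0)) :
    rowProj n j X i q = if i.1 = j then X i q else 0 := rfl

/-- An entry of a matrix. -/
noncomputable def entry (i : Idx n) (q : Fin (n 0)) : Cols n →L[ℂ] ℂ :=
  (ContinuousLinearMap.proj q : (Fin (n 0) → ℂ) →L[ℂ] ℂ) ∘L
    (ContinuousLinearMap.proj i : Cols n →L[ℂ] (Fin (n 0) → ℂ))

@[simp]
theorem entry_apply (i : Idx n) (q : Fin (n 0)) (X : Cols n) : entry i q X = X i q := rfl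

theorem norm_leftMul_le (A : Matrix (Idx n) (Idx n) ℂ) : ‖leftMul A‖ ≤ ∑ i, ∑ k, ‖A i k‖ := by
  refine ContinuousLinearMap.opNorm_le_bound _ (by positivity) fun X => ?_
  refine (pi_norm_le_iff_of_nonneg (by positivity)).2 fun i =>
    (pi_norm_le_iff_of_nonneg (by positivity)).2 fun q => ?_
  rw [leftMul_apply]
  calc ‖∑ k, A i k * X k q‖ ≤ ∑ k, ‖A i k‖ * ‖X‖ := by
        refine (norm_sum_le _ _).trans (Finset.sum_le_sum fun k _ => ?_)
        rw [norm_mul]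
        gcongr
        exact (norm_le_pi_norm (X k) q).trans (norm_le_pi_norm X k)
    _ = (∑ k, ‖A i k‖) * ‖X‖ := by rw [Finset.sum_mul]
    _ ≤ (∑ i, ∑ k, ‖A i k‖) * ‖X‖ := by
        refine mul_le_mul_of_nonneg_right ?_ (norm_nonneg _)
        exact Finset.single_le_sum (f := fun i => ∑ k, ‖A i k‖) (fun _ _ => by positivity)
          (Finset.mem_univ i)

/-- The nilpotent part of the exponents: `X ↦ J X - X J₁` on each block of rows. -/
noncomputable def nilpotentPart (n : Fin J → ℕ) : Cols n →L[ℂ] Cols n :=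
  leftMul (Matrix.blockDiagonal' fun j => jordan (n j)) - rightJordan n

theorem nilpotentPart_apply (X : Cols n) (j : Fin J) (r : Fin (n j)) (q : Fin (n 0)) :
    nilpotentPart n X ⟨j, r⟩ q = ∑ r', jordan (n j) r r' * X ⟨j, r'⟩ q -
      ∑ p, X ⟨j, r⟩ p * jordan (n 0) p q := by
  rw [nilpotentPart]
  change leftMul _ X ⟨j, r⟩ q - rightJordan n X ⟨j, r⟩ q = _
  rw [leftMul_apply, sum_blockDiagonal'_mul, rightJordan_apply]

/-- The entry (r, q) of J X − X J₁ only involves the entries (r + 1, q) and (r, q − 1) of X. Each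
step raises r − q by one, and this difference cannot exceed n_j − 1. The degrees `logDegree` come
from the case r = 0. -/
theorem nilpotentPart_pow_apply_eq_zero (X : Cols n) (p : ℕ) (j : Fin J) (r : Fin (n j))
    (q : Fin (n 0)) (h : n j + q ≤ p + r) : (nilpotentPart n ^ p) X ⟨j, r⟩ q = 0 := by
  induction p generalizing r q with
  | zero => have := r.2; omega
  | succ p ih =>
    rw [pow_succ', mul_apply_eq_comp, nilpotentPart_apply]
    rw [Finset.sum_eq_zero fun r' _ => ?_, Finset.sum_eq_zero fun p' _ => ?_, sub_zero]
    · by_cases hp : (p' : ℕ) + 1 = q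
      · rw [ih r p' (by omega), zero_mul]
      · simp [jordan, hp]
    · by_cases hr : (r : ℕ) + 1 = r'
      · rw [ih r' q (by omega), mul_zero]
      · simp [jordan, hr]

/-- A common bound for the orders of nilpotency. -/
def nilpotencyBound (n : Fin J → ℕ) : ℕ := ∑ j, n j + n 0

theorem nilpotentPart_pow_eq_zero : nilpotentPart n ^ nilpotencyBound n = 0 := by
  ext X i q
  refine nilpotentPart_pow_apply_eq_zero X _ i.1 i.2 q ?_
  have h1 : n i.1 ≤ ∑ j, n j := Finset.single_le_sum (fun _ _ => Nat.zero_le _)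
      (Finset.mem_univ i.1)
  have := q.2
  unfold nilpotencyBound
  omega

theorem rowProj_nilpotentPart (j : Fin J) (X : Cols n) :
    rowProj n j (nilpotentPart n X) = nilpotentPart n (rowProj n j X) := by
  ext ⟨i, r⟩ q
  rw [rowProj_apply, nilpotentPart_apply, nilpotentPart_apply]
  simp only [rowProj_apply]
  split_ifs <;> simp

theorem leftMul_rightJordan (A : Matrix (Idx n) (Idx n) ℂ) (X : Cols n) :
    leftMul A (rightJordan n X) = rightJordan n (leftMul A X) := by
  ext i q
  simp only [leftMul_apply, rightJordan_apply, Finset.mul_sum, Finset.sum_mul]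
  rw [Finset.sum_comm]
  simp only [mul_assoc]

theorem rowProj_rightJordan (j : Fin J) (X : Cols n) :
    rowProj n j (rightJordan n X) = rightJordan n (rowProj n j X) := by
  ext i q
  simp only [rowProj_apply, rightJordan_apply]
  split_ifs <;> simp

theorem rightJordan_pow_apply (X : Cols n) (m : ℕ) (i : Idx n) (q : Fin (n 0)) :
    (rightJordan n ^ m) X i q = if h : m ≤ q then X i ⟨q - m, by omega⟩ else 0 := by
  induction m generalizing q with
  | zero => simp
  | succ m ih =>
    rw [pow_succ', mul_apply_eq_comp, rightJordan_apply]
    by_cases hq : 1 ≤ (q : ℕ)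
    · rw [Finset.sum_eq_single ⟨q - 1, by omega⟩]
      · rw [ih]
        have h1 : (q : ℕ) - 1 + 1 = q := by omega
        simp only [jordan, Matrix.of_apply, h1, if_true, mul_one]
        by_cases h2 : m + 1 ≤ q
        · rw [dif_pos h2, dif_pos (by omega)]
          congr 2
          omega
        · rw [dif_neg h2, dif_neg (by omega)]
      · intro p _ hp
        have h1 : ¬ (p : ℕ) + 1 = q := fun h => hp (Fin.ext (by simp; omega))
        simp [jordan, h1]
      · simp
    · rw [dif_neg (by omega)]
      refine Finset.sum_eq_zero fun p _ => ?_
      have h1 : ¬ (p : ℕ) + 1 = q := by omega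
      simp [jordan, h1]

/-- A matrix whose first columns vanish is divisible by a power of the Jordan block. -/
theorem exists_eq_rightJordan_pow {X : Cols n} {q : ℕ}
    (h : ∀ i (p : Fin (n 0)), (p : ℕ) ≤ q → X i p = 0) : ∃ Y, X = (rightJordan n ^ (q + 1)) Y := by
  refine ⟨fun i p => if h : (p : ℕ) + (q + 1) < n 0 then X i ⟨p + (q + 1), h⟩ else 0, ?_⟩
  ext i p
  rw [rightJordan_pow_apply]
  split_ifs with h1 h2
  · exact congrArg (X i) (Fin.ext (Nat.sub_add_cancel h1).symm)
  · exact absurd p.2 (by simp at h2; omega)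
  · exact h i p (by omega)

end Columns

end LevelOne

namespace LevelOne

/-! ### The convolution system of a level-one system and its exponents. -/

section Concrete

variable {J : ℕ} [NeZero J] {n : Fin J → ℕ}

/-- The Taylor coefficients of the kernel of the convolution system attached to
`x² dY/dx = A(x) Y - Y A₀(x)`. -/
noncomputable def kernel (A : Matrix (Idx n) (Idx n) ℂ⟦X⟧) (k : ℕ) : Cols n →L[ℂ] Cols n :=
  leftMul (A.map (PowerSeries.coeff (k + 1))) - if k = 0 then rightJordan n else 0

theorem kernel_zero_apply (A : Matrix (Idx n) (Idx n) ℂ⟦X⟧) (X : Cols n) (i : Idx n)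
    (q : Fin (n 0)) : kernel A 0 X i q =
      ∑ k, PowerSeries.coeff 1 (A i k) * X k q - rightJordan n X i q := by
  rw [kernel, if_pos rfl, sub_apply]
  rfl

theorem IsConvergent.exists_nonneg_le {p : ℂ⟦X⟧} (hp : IsConvergent p) :
    ∃ C ρ : ℝ, 0 ≤ C ∧ 0 ≤ ρ ∧ ∀ m : ℕ, ‖PowerSeries.coeff m p‖ ≤ C * ρ ^ m := by
  obtain ⟨C, ρ, h⟩ := hp
  refine ⟨|C|, |ρ|, abs_nonneg _, abs_nonneg _, fun m => (h m).trans ?_⟩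
  rw [← abs_pow, ← abs_mul]
  exact le_abs_self _

theorem exists_norm_kernel_le {A : Matrix (Idx n) (Idx n) ℂ⟦X⟧}
    (hA : ∀ i k, IsConvergent (A i k)) :
    ∃ C ρ : ℝ, 0 < ρ ∧ ∀ k, ‖kernel A k‖ ≤ C * ρ ^ k := by
  choose C ρ hC hρ h using fun i k => (hA i k).exists_nonneg_le
  -- The sum dominates the geometric rates of all entries, and the summand 1 keeps σ positive. The
  -- index shift in `coeff (k + 1)` costs one factor σ, put in the constant.
  set σ : ℝ := 1 + ∑ i, ∑ k, ρ i k with hσ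
  have hσ1 : 1 ≤ σ := le_add_of_nonneg_right
    (Finset.sum_nonneg fun i _ => Finset.sum_nonneg fun k _ => hρ i k)
  have hρσ : ∀ i k, ρ i k ≤ σ := fun i k => by
    have h1 : ρ i k ≤ ∑ k, ρ i k :=
      Finset.single_le_sum (f := ρ i) (fun k _ => hρ i k) (Finset.mem_univ k)
    have h2 : ∑ k, ρ i k ≤ ∑ i, ∑ k, ρ i k :=
      Finset.single_le_sum (f := fun i => ∑ k, ρ i k)
        (fun i _ => Finset.sum_nonneg fun k _ => hρ i k) (Finset.mem_univ i)
    linarith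
  refine ⟨(∑ i, ∑ k, C i k * σ) + ‖rightJordan n‖, σ, by linarith, fun m => ?_⟩
  have h1 : ‖leftMul (A.map (PowerSeries.coeff (m + 1)))‖ ≤ (∑ i, ∑ k, C i k * σ) * σ ^ m := by
    refine (norm_leftMul_le _).trans ?_
    rw [Finset.sum_mul]
    refine Finset.sum_le_sum fun i _ => ?_
    rw [Finset.sum_mul]
    refine Finset.sum_le_sum fun k _ => (h i k (m + 1)).trans ?_
    rw [mul_assoc, ← pow_succ']
    exact mul_le_mul_of_nonneg_left (pow_le_pow_left₀ (hρ i k) (hρσ i k) _) (hC i k)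
  have h2 : ‖(if m = 0 then rightJordan n else 0 : Cols n →L[ℂ] Cols n)‖ ≤
      ‖rightJordan n‖ * σ ^ m := by
    split_ifs with hm
    · simp [hm]
    · rw [norm_zero]; positivity
  rw [kernel, add_mul]
  exact (norm_sub_le _ _).trans (add_le_add h1 h2)

/-- The convolution system satisfied by the Borel transform of the first columns of a formal
solution. -/
noncomputable def borelSystem (a : Fin J → ℂ) {A : Matrix (Idx n) (Idx n) ℂ⟦X⟧}
    (hA : ∀ i k, IsConvergent (A i k)) : BorelSystem J (Cols n) where
  a := a
  E := rowProj n
  K := kernel A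
  C := (exists_norm_kernel_le hA).choose
  ρ := (exists_norm_kernel_le hA).choose_spec.choose
  E_mul := fun i j => by
    ext X k q
    rw [mul_apply_eq_comp, rowProj_apply, rowProj_apply]
    split_ifs <;> simp_all
  E_sum := by
    ext X k q
    simp [sum_apply, Finset.sum_apply]
  ρ_pos := (exists_norm_kernel_le hA).choose_spec.choose_spec.1
  K_le := (exists_norm_kernel_le hA).choose_spec.choose_spec.2

variable {a lam : Fin J → ℂ} {A F : Matrix (Idx n) (Idx n) ℂ⟦X⟧}

section

variable (hA : ∀ i k, IsConvergent (A i k))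

@[simp] theorem borelSystem_a : (borelSystem a hA).a = a := rfl

@[simp] theorem borelSystem_E : (borelSystem a hA).E = rowProj n := rfl

@[simp] theorem borelSystem_K : (borelSystem a hA).K = kernel A := rfl

theorem borelSystem_proj_apply (ω : ℂ) (X : Cols n) (i : Idx n) (q : Fin (n 0)) :
    (borelSystem a hA).proj ω X i q = if a i.1 = ω then X i q else 0 := by
  rw [BorelSystem.proj_apply, Finset.sum_apply, Finset.sum_apply]
  simp only [borelSystem_E, rowProj_apply, Finset.sum_ite_eq]
  exact if_congr (by rw [Finset.mem_filter, and_iff_right (Finset.mem_univ _)]; rfl) rfl rfl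

theorem borelSystem_diag_apply (X : Cols n) (i : Idx n) (q : Fin (n 0)) :
    (borelSystem a hA).diag X i q = a i.1 * X i q := by
  simp [BorelSystem.diag_apply, Finset.sum_apply]

end

/-- The coefficients of the first columns of a matrix of power series. -/
noncomputable def firstCols (F : Matrix (Idx n) (Idx n) ℂ⟦X⟧) (m : ℕ) : Cols n :=
  fun i q => PowerSeries.coeff m (F i ⟨0, q⟩)

/-- Since a_0 = λ_0 = 0, the normal form acts on the first columns as x J₁ only, whence the
correction of `kernel` at index 0. The top term A₀ F_{m+1} of the product is the one giving D. -/
theorem IsFormalSolution.firstCols_eq (hA : ∀ i k, IsConvergent (A i k))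
    (hF : IsFormalSolution n a lam A F) (hF0 : F.map PowerSeries.constantCoeff = 1)
    (ha : a 0 = 0) (hlam : lam 0 = 0) (m : ℕ) :
    (m : ℂ) • firstCols F m - (borelSystem a hA).diag (firstCols F (m + 1)) =
      ∑ i ∈ Finset.range (m + 1), (borelSystem a hA).K (m - i) (firstCols F i) := by
  ext i q
  have h := hF.coeff_succ m i ⟨0, q⟩
  have h1 : ∑ l, PowerSeries.coeff m (F i l) * exponentMatrix n lam l ⟨0, q⟩ =
      rightJordan n (firstCols F m) i q := by
    rw [Fintype.sum_sigma, Finset.sum_eq_single 0]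
    · simp [exponentMatrix, hlam, firstCols, Matrix.blockDiagonal'_apply_eq]
    · intro j _ hj
      refine Finset.sum_eq_zero fun r _ => ?_
      rw [exponentMatrix, Matrix.blockDiagonal'_apply_ne _ _ _ hj, mul_zero]
    · simp
  have h2 : ∑ l, PowerSeries.coeff (m + 1 - (m + 1)) (A i l) *
      PowerSeries.coeff (m + 1) (F l ⟨0, q⟩) = a i.1 * PowerSeries.coeff (m + 1) (F i ⟨0, q⟩) := by
    simp [hF.coeff_zero hF0]
  have h3 : (∑ p ∈ Finset.range (m + 1), (borelSystem a hA).K (m - p) (firstCols F p)) i q =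
      ∑ p ∈ Finset.range (m + 1), ∑ l, PowerSeries.coeff (m + 1 - p) (A i l) *
        PowerSeries.coeff p (F l ⟨0, q⟩) - rightJordan n (firstCols F m) i q := by
    rw [Finset.sum_apply, Finset.sum_apply]
    simp only [borelSystem_K, kernel, sub_apply, Pi.sub_apply, Finset.sum_sub_distrib]
    congr 1
    · refine Finset.sum_congr rfl fun p hp => ?_
      rw [leftMul_apply, Nat.sub_add_comm (Nat.lt_succ_iff.1 (Finset.mem_range.1 hp))]
      rfl
    · rw [Finset.sum_range_succ, Finset.sum_eq_zero, zero_add, Nat.sub_self, if_pos rfl]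
      intro p hp
      rw [if_neg (by have := Finset.mem_range.1 hp; omega)]
      rfl
  rw [h3, Pi.sub_apply, Pi.sub_apply, borelSystem_diag_apply, Pi.smul_apply, Pi.smul_apply,
    smul_eq_mul]
  rw [Finset.sum_range_succ, h2, h1, ha] at h
  change (m : ℂ) * PowerSeries.coeff m (F i ⟨0, q⟩) -
    a i.1 * PowerSeries.coeff (m + 1) (F i ⟨0, q⟩) = _
  linear_combination h

/-- Although A₁ is not block-diagonal, its blocks between indices with a_i = a_k = ω are those of L,
by `coeff_one`, and the projections keep only these. -/
theorem IsFormalSolution.exponent_apply (hA : ∀ i k, IsConvergent (A i k))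
    (hF : IsFormalSolution n a lam A F) (hF0 : F.map PowerSeries.constantCoeff = 1) (ω : ℂ)
    (X : Cols n) (j : Fin J) (r : Fin (n j)) (q : Fin (n 0)) :
    (borelSystem a hA).exponent ω X ⟨j, r⟩ q =
      if a j = ω then lam j * X ⟨j, r⟩ q + nilpotentPart n X ⟨j, r⟩ q else 0 := by
  rw [BorelSystem.exponent_apply, borelSystem_proj_apply]
  by_cases hj : a j = ω
  · rw [if_pos hj, if_pos hj, borelSystem_K, kernel_zero_apply, nilpotentPart_apply]
    have h1 : ∑ k, PowerSeries.coeff 1 (A ⟨j, r⟩ k) * (borelSystem a hA).proj ω X k q =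
        ∑ k, exponentMatrix n lam ⟨j, r⟩ k * X k q := by
      refine Finset.sum_congr rfl fun k _ => ?_
      rw [borelSystem_proj_apply]
      by_cases hk : a k.1 = ω
      · rw [if_pos hk, hF.coeff_one hF0 (hj.trans hk.symm)]
      · have hjk : j ≠ k.1 := fun h => hk (h ▸ hj)
        obtain ⟨j', r'⟩ := k
        rw [if_neg hk, exponentMatrix, Matrix.blockDiagonal'_apply_ne _ _ _ hjk, mul_zero, zero_mul]
    rw [h1, exponentMatrix, sum_blockDiagonal'_mul, rightJordan_apply]
    simp only [borelSystem_proj_apply, hj, if_true, Matrix.add_apply, Matrix.smul_apply,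
        smul_eq_mul,
      add_mul, Finset.sum_add_distrib, Matrix.one_apply, mul_ite, ite_mul, mul_one, mul_zero,
      zero_mul, Finset.sum_ite_eq, Finset.mem_univ]
    ring
  · rw [if_neg hj, if_neg hj]

theorem IsFormalSolution.exponent_rowProj (hA : ∀ i k, IsConvergent (A i k))
    (hF : IsFormalSolution n a lam A F) (hF0 : F.map PowerSeries.constantCoeff = 1) {ω : ℂ}
    {ℓ : Fin J} (hℓ : a ℓ = ω) (X : Cols n) :
    (borelSystem a hA).exponent ω (rowProj n ℓ X) =
      rowProj n ℓ (lam ℓ • X + nilpotentPart n X) := by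
  ext ⟨j, r⟩ q
  rw [hF.exponent_apply hA hF0, ← rowProj_nilpotentPart, rowProj_apply, rowProj_apply,
    rowProj_apply]
  by_cases hj : j = ℓ
  · subst hj
    simp [hℓ]
  · simp [hj]

/-- An eigenvector with a nonzero entry in a block with a_j = ω restricts there to an eigenvector of
λ_j plus a nilpotent, which forces μ = λ_j. In any other block μ = 0. -/
theorem IsFormalSolution.hasGoodExponents (hA : ∀ i k, IsConvergent (A i k))
    (hF : IsFormalSolution n a lam A F) (hF0 : F.map PowerSeries.constantCoeff = 1)
    (hre : ∀ j, 0 ≤ (lam j).re ∧ (lam j).re < 1) (ω : ℂ) :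
    (borelSystem a hA).HasGoodExponents ω := by
  intro μ v hv hv0
  obtain ⟨⟨j, r⟩, q, h0⟩ : ∃ i q, v i q ≠ 0 := by
    by_contra! h
    exact hv0 (by ext i q; exact h i q)
  by_cases hj : a j = ω
  · have h1 : nilpotentPart n (rowProj n j v) = (μ - lam j) • rowProj n j v := by
      rw [← rowProj_nilpotentPart]
      ext ⟨j', r'⟩ q'
      have h2 := congrFun (congrFun hv ⟨j', r'⟩) q'
      rw [hF.exponent_apply hA hF0, Pi.smul_apply, Pi.smul_apply, smul_eq_mul] at h2
      rw [rowProj_apply, Pi.smul_apply, Pi.smul_apply, rowProj_apply, smul_eq_mul]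
      by_cases hj' : j' = j
      · subst hj'
        rw [if_pos hj] at h2
        rw [if_pos rfl, if_pos rfl]
        linear_combination h2
      · simp [hj']
    have h2 : ∀ p : ℕ, (nilpotentPart n ^ p) (rowProj n j v) = (μ - lam j) ^ p • rowProj n j v := by
      intro p
      induction p with
      | zero => simp
      | succ p ih =>
        rw [pow_succ', mul_apply_eq_comp, ih, map_smul, h1, smul_smul, pow_succ]
    have h3 := h2 (nilpotencyBound n)
    rw [nilpotentPart_pow_eq_zero] at h3
    have h4 := congrFun (congrFun h3 ⟨j, r⟩) q
    rw [Pi.smul_apply, Pi.smul_apply, rowProj_apply, if_pos rfl, smul_eq_mul] at h4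
    have h5 : μ - lam j = 0 := by
      have := mul_eq_zero.1 h4.symm
      exact eq_zero_of_pow_eq_zero (this.resolve_right h0)
    rw [sub_eq_zero.1 h5]
    exact hre j
  · have h2 := congrFun (congrFun hv ⟨j, r⟩) q
    rw [hF.exponent_apply hA hF0, if_neg hj, Pi.smul_apply, Pi.smul_apply, smul_eq_mul] at h2
    have h3 : μ = 0 := (mul_eq_zero.1 h2.symm).resolve_right h0
    simp [h3]

end Concrete

/-! ### Triangularity with respect to the columns -/

section Lift

variable {V : Type*} [NormedAddCommGroup V] [NormedSpace ℂ V]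

/-- The action of an endomorphism on the state space. -/
noncomputable def liftState (T : V →L[ℂ] V) : State V →L[ℂ] State V :=
  T.compLeftContinuousBounded ℕ

@[simp]
theorem liftState_apply (T : V →L[ℂ] V) (y : State V) (k : ℕ) : liftState T y k = T (y k) := rfl

namespace BorelSystem

variable {J : ℕ} {B : BorelSystem J V} {T : V →L[ℂ] V}

theorem liftState_input (hK : ∀ k v, B.K k (T v) = T (B.K k v)) (v : V) :
    liftState T (B.input v) = B.input (T v) := by
  ext k
  simp [hK]

theorem commute_liftState_residue (hK : ∀ k v, B.K k (T v) = T (B.K k v))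
    (hE : ∀ j v, B.E j (T v) = T (B.E j v)) (j : Fin J) :
    Commute (liftState T) (B.residue j) := by
  ext1 y
  rw [mul_apply_eq_comp, mul_apply_eq_comp]
  change liftState T (B.input (B.E j (y 0))) = B.input (B.E j (T (y 0)))
  rw [liftState_input hK, hE]

theorem commute_liftState_shift : Commute (liftState T) B.shift := by
  ext1 y
  rw [mul_apply_eq_comp, mul_apply_eq_comp]
  ext k
  simp

/-- An endomorphism commuting with the kernel and with the projections commutes with the residue and
the regular part, hence with H. It is applied to powers of the right Jordan multiplication. -/
theorem IsGauge.commute_liftState [CompleteSpace V] [FiniteDimensional ℂ V] {ω : ℂ}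
    {H : ℂ → State V →L[ℂ] State V} (hH : B.IsGauge ω H)
    (hK : ∀ k v, B.K k (T v) = T (B.K k v)) (hE : ∀ j v, B.E j (T v) = T (B.E j v)) :
    ∀ᶠ ξ in 𝓝 (0 : ℂ), Commute (liftState T) (H ξ) := by
  refine hH.commute _ ?_ (Eventually.of_forall fun ξ => ?_)
  · rw [residueAt_eq_sum]
    exact Commute.sum_right _ _ _ fun j _ => commute_liftState_residue hK hE j
  · exact commute_liftState_shift.add_right (Commute.sum_right _ _ _ fun j _ =>
      (commute_liftState_residue hK hE j).smul_right _)

end BorelSystem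

end Lift

end LevelOne

namespace LevelOne

/-! ### Logarithmic polynomials -/

section NilExp

variable {V : Type*} [NormedAddCommGroup V] [NormedSpace ℂ V]

/-- The exponential `e^{sN} u` for an endomorphism `N` with `N ^ (P + 1) = 0`. -/
noncomputable def nilExp (N : V →L[ℂ] V) (P : ℕ) (s : ℂ) (u : V) : V :=
  ∑ p ∈ Finset.range (P + 1), s ^ p • ((p.factorial : ℂ)⁻¹ • (N ^ p) u)

variable {N : V →L[ℂ] V} {P : ℕ}

theorem nilExp_zero (u : V) : nilExp N P 0 u = u := by
  rw [nilExp, Finset.sum_eq_single 0]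
  · simp
  · intro p _ hp
    rw [zero_pow hp, zero_smul]
  · simp

theorem map_nilExp_eq_sum (s : ℂ) (u : V) : N (nilExp N P s u) =
    ∑ p ∈ Finset.range (P + 1), s ^ p • ((p.factorial : ℂ)⁻¹ • (N ^ (p + 1)) u) := by
  rw [nilExp, map_sum]
  refine Finset.sum_congr rfl fun p _ => ?_
  rw [map_smul, map_smul, pow_succ', mul_apply_eq_comp]

theorem map_nilExp (s : ℂ) (u : V) : N (nilExp N P s u) = nilExp N P s (N u) := by
  rw [map_nilExp_eq_sum, nilExp]
  refine Finset.sum_congr rfl fun p _ => ?_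
  rw [pow_succ, mul_apply_eq_comp]

theorem nilExp_add (s : ℂ) (u v : V) : nilExp N P s (u + v) = nilExp N P s u + nilExp N P s v := by
  simp [nilExp, Finset.sum_add_distrib]

theorem nilExp_smul (s c : ℂ) (u : V) : nilExp N P s (c • u) = c • nilExp N P s u := by
  rw [nilExp, nilExp, Finset.smul_sum]
  refine Finset.sum_congr rfl fun p _ => ?_
  rw [map_smul, smul_comm c, smul_comm c]

theorem hasDerivAt_sum_pow_smul (v : ℕ → V) (m : ℕ) (s : ℂ) :
    HasDerivAt (fun s : ℂ => ∑ p ∈ Finset.range (m + 1), s ^ p • v p)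
      (∑ p ∈ Finset.range m, s ^ p • (((p : ℂ) + 1) • v (p + 1))) s := by
  have h1 : HasDerivAt (fun s : ℂ => ∑ p ∈ Finset.range (m + 1), s ^ p • v p)
      (∑ p ∈ Finset.range (m + 1), ((p : ℂ) * s ^ (p - 1)) • v p) s :=
    HasDerivAt.fun_sum fun p _ => (hasDerivAt_pow p s).smul_const (v p)
  refine h1.congr_deriv ?_
  rw [Finset.sum_range_succ']
  simp only [Nat.cast_zero, zero_mul, zero_smul, add_zero, Nat.add_sub_cancel]
  refine Finset.sum_congr rfl fun p _ => ?_
  rw [smul_smul]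
  congr 1
  push_cast
  ring

theorem cast_succ_smul_factorial_inv (p : ℕ) (x : V) :
    ((p : ℂ) + 1) • (((p + 1).factorial : ℂ)⁻¹ • x) = (p.factorial : ℂ)⁻¹ • x := by
  rw [smul_smul]
  congr 1
  have h1 : (p.factorial : ℂ) ≠ 0 := Nat.cast_ne_zero.2 p.factorial_ne_zero
  have h2 : (p : ℂ) + 1 ≠ 0 := Nat.cast_add_one_ne_zero p
  rw [Nat.factorial_succ]
  push_cast
  field_simp

theorem hasDerivAt_nilExp (hN : N ^ (P + 1) = 0) (u : V) (s : ℂ) :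
    HasDerivAt (fun s => nilExp N P s u) (N (nilExp N P s u)) s := by
  refine (hasDerivAt_sum_pow_smul (fun p => (p.factorial : ℂ)⁻¹ • (N ^ p) u) P s).congr_deriv ?_
  rw [map_nilExp_eq_sum, Finset.sum_range_succ, hN]
  simp only [cast_succ_smul_factorial_inv, zero_apply, smul_zero, add_zero]

/-- A primitive of `e^{s(μ + N)} u`. -/
theorem exists_log_primitive (hN : N ^ (P + 1) = 0) (μ : ℂ) (u : V) : ∃ v : ℕ → V,
    (∀ s, HasDerivAt (fun s => Complex.exp (μ * s) • ∑ p ∈ Finset.range (P + 2), s ^ p • v p)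
      (Complex.exp (μ * s) • nilExp N P s u) s) ∧
    (∀ s, u + (μ • (Complex.exp (μ * s) • ∑ p ∈ Finset.range (P + 2), s ^ p • v p - v 0) +
      N (Complex.exp (μ * s) • ∑ p ∈ Finset.range (P + 2), s ^ p • v p - v 0)) =
      Complex.exp (μ * s) • nilExp N P s u) ∧
    (μ ≠ 0 → ∀ p, ∃ x, v p = (N ^ p) x) ∧
    (μ = 0 → v 0 = 0 ∧ ∀ p, ∃ x, v (p + 1) = (N ^ p) x) ∧
    ∀ p, P + 2 ≤ p → v p = 0 := by
  have hN' : ∀ p, P + 1 ≤ p → N ^ p = 0 := fun p hp => by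
    rw [← Nat.add_sub_cancel' hp, pow_add, hN, zero_mul]
  by_cases hμ : μ = 0
  -- For μ = 0 integration of a polynomial in s raises its degree by one, with no constant term.
  -- This is the extra unit in `logDegree`.
  · subst hμ
    let v : ℕ → V := fun p => Nat.casesOn p 0 fun p => ((p + 1).factorial : ℂ)⁻¹ • (N ^ p) u
    have hv0 : v 0 = 0 := rfl
    have hv : ∀ p, v (p + 1) = ((p + 1).factorial : ℂ)⁻¹ • (N ^ p) u := fun p => rfl
    refine ⟨v, fun s => ?_, fun s => ?_, fun h => absurd rfl h, fun _ => ⟨rfl, fun p =>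
      ⟨((p + 1).factorial : ℂ)⁻¹ • u, ?_⟩⟩, fun p hp => ?_⟩
    · simp only [zero_mul, Complex.exp_zero, one_smul]
      refine (hasDerivAt_sum_pow_smul v (P + 1) s).congr_deriv ?_
      rw [nilExp]
      refine Finset.sum_congr rfl fun p _ => ?_
      rw [hv, cast_succ_smul_factorial_inv]
    · simp only [zero_mul, Complex.exp_zero, one_smul, zero_smul, zero_add, hv0, sub_zero]
      rw [nilExp, Finset.sum_range_succ', hv0, smul_zero, add_zero, map_sum,
        Finset.sum_range_succ, Finset.sum_range_succ']
      have h1 : N (s ^ (P + 1) • v (P + 1)) = 0 := by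
        rw [hv, map_smul, map_smul, ← mul_apply_eq_comp, ← pow_succ', hN]
        simp
      rw [h1, add_zero, add_comm]
      congr 1
      · refine Finset.sum_congr rfl fun p _ => ?_
        rw [hv, map_smul, map_smul, ← mul_apply_eq_comp, ← pow_succ']
      · simp
    · rw [hv, map_smul]
    · obtain ⟨p, rfl⟩ : ∃ p', p = p' + 1 := ⟨p - 1, by omega⟩
      rw [hv, hN' p (by omega)]
      simp
  -- For μ ≠ 0 the operator μ + N is invertible, and the primitive is e^{s(μ + N)} (μ + N)⁻¹ u, of
  -- unchanged degree in s.
  · have hunit : IsUnit (algebraMap ℂ (V →L[ℂ] V) μ + N) :=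
      IsNilpotent.isUnit_add_left_of_commute ⟨P + 1, hN⟩
        ((isUnit_iff_ne_zero.2 hμ).map (algebraMap ℂ (V →L[ℂ] V)))
        (Algebra.commutes μ N).symm
    obtain ⟨U, hU⟩ := hunit
    let w := (↑U⁻¹ : V →L[ℂ] V) u
    have hw : μ • w + N w = u := by
      have h1 : (↑U * ↑U⁻¹ : V →L[ℂ] V) u = u := by rw [Units.mul_inv]; rfl
      rw [hU, mul_apply_eq_comp, add_apply, Algebra.algebraMap_eq_smul_one, smul_apply] at h1
      exact h1
    let v : ℕ → V := fun p => (p.factorial : ℂ)⁻¹ • (N ^ p) w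
    have hsum : ∀ s, ∑ p ∈ Finset.range (P + 2), s ^ p • v p = nilExp N P s w := fun s => by
      rw [Finset.sum_range_succ, nilExp]
      simp only [v]
      rw [hN]
      simp
    have hv0 : v 0 = w := by simp [v]
    refine ⟨v, fun s => ?_, fun s => ?_, fun _ p => ⟨(p.factorial : ℂ)⁻¹ • w, ?_⟩,
      fun h => absurd h hμ, fun p hp => ?_⟩
    · simp only [hsum]
      have h1 : HasDerivAt (fun s => Complex.exp (μ * s)) (Complex.exp (μ * s) * μ) s :=
        (Complex.hasDerivAt_exp _).comp s ((hasDerivAt_id s).const_mul μ |>.congr_deriv (mul_one μ))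
      refine (h1.smul (hasDerivAt_nilExp hN w s)).congr_deriv ?_
      rw [← hw, nilExp_add, nilExp_smul, map_nilExp, smul_add, smul_smul, add_comm]
    · rw [hsum, hv0, ← hw, nilExp_add, nilExp_smul, ← map_nilExp, map_sub, map_smul, smul_sub,
        smul_add, smul_comm μ]
      abel
    · rw [map_smul]
    · simp only [v]
      rw [hN' p (by omega)]
      simp

end NilExp

section MatPow

attribute [local instance] Matrix.linftyOpNormedRing Matrix.linftyOpNormedAlgebra

theorem hasDerivAt_matPow_apply {m : ℕ} (M : Matrix (Fin m) (Fin m) ℂ) (s : ℂ) (i k : Fin m) :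
    HasDerivAt (fun s => matPow s M i k) ((M * matPow s M) i k) s := by
  have h1 : HasDerivAt (fun s : ℂ => NormedSpace.exp (s • M)) (M * NormedSpace.exp (s • M)) s :=
    hasDerivAt_exp_smul_const' M s
  exact (LinearMap.toContinuousLinearMap
    (Matrix.entryLinearMap ℂ ℂ i k)).hasFDerivAt.comp_hasDerivAt
    s h1

theorem matPow_mul_self {m : ℕ} (M : Matrix (Fin m) (Fin m) ℂ) (s : ℂ) :
    M * matPow s M = matPow s M * M :=
  (((Commute.refl M).smul_right s).exp_right).eq

end MatPow

section Columns

variable {J : ℕ} [NeZero J] {n : Fin J → ℕ}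

theorem nilpotentPart_pow_succ_eq_zero : nilpotentPart n ^ (nilpotencyBound n + 1) = 0 := by
  rw [pow_succ, nilpotentPart_pow_eq_zero, zero_mul]

/-- Both sides solve the constant-coefficient equation G' = J G − G J₁ with value X at s = 0. -/
theorem matPow_mul_mul_matPow (X : Cols n) (s : ℂ) (j : Fin J) (r : Fin (n j)) (q : Fin (n 0)) :
    (matPow s (jordan (n j)) * Matrix.of (fun r q => X ⟨j, r⟩ q) *
      matPow s (-jordan (n 0))) r q = nilExp (nilpotentPart n) (nilpotencyBound n) s X
          ⟨j, r⟩ q := by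
  let G : ℂ → Cols n := fun s i q => (matPow s (jordan (n i.1)) *
    Matrix.of (fun r q => X ⟨i.1, r⟩ q) * matPow s (-jordan (n 0))) i.2 q
  have hG : SolvesOn (fun _ => nilpotentPart n) Set.univ G := by
    intro s _
    refine hasDerivAt_pi.2 fun i => hasDerivAt_pi.2 fun q => ?_
    obtain ⟨j, r⟩ := i
    have h1 : HasDerivAt (fun s => G s ⟨j, r⟩ q)
        ((jordan (n j) * matPow s (jordan (n j)) * Matrix.of (fun r q => X ⟨j, r⟩ q) *
          matPow s (-jordan (n 0)) + matPow s (jordan (n j)) * Matrix.of (fun r q => X ⟨j, r⟩ q) *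
          (-jordan (n 0) * matPow s (-jordan (n 0)))) r q) s := by
      simp only [G]
      rw [Matrix.add_apply, Matrix.mul_apply, Matrix.mul_apply, ← Finset.sum_add_distrib]
      simp only [Matrix.mul_apply (M := _ * _)]
      refine HasDerivAt.fun_sum fun p _ => HasDerivAt.mul ?_ (hasDerivAt_matPow_apply _ s p q)
      simp only [Matrix.mul_apply (M := matPow _ _)]
      exact HasDerivAt.fun_sum fun p' _ => (hasDerivAt_matPow_apply _ s r p').mul_const _
    refine h1.congr_deriv ?_
    rw [matPow_mul_self (-jordan (n 0)), Matrix.mul_neg, Matrix.mul_neg, ← sub_eq_add_neg,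
        Matrix.sub_apply,
      nilpotentPart_apply, Matrix.mul_assoc (jordan (n j)), Matrix.mul_assoc (jordan (n j)),
      Matrix.mul_apply, ← Matrix.mul_assoc, Matrix.mul_apply (N := jordan (n 0))]
  have hE : SolvesOn (fun _ => nilpotentPart n) Set.univ
      fun s => nilExp (nilpotentPart n) (nilpotencyBound n) s X :=
    fun s _ => hasDerivAt_nilExp nilpotentPart_pow_succ_eq_zero X s
  have h := hG.eqOn_of_convex hE convex_univ continuousOn_const (Set.mem_univ 0) (by
    ext i q
    simp [G, nilExp_zero, matPow])
  exact congrFun (congrFun (h (Set.mem_univ s)) ⟨j, r⟩) q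

end Columns

end LevelOne

namespace LevelOne

/-! ### The local expansions of a solution -/

namespace BorelSystem

section LocalReadout

variable {J : ℕ} {V : Type*} [NormedAddCommGroup V] [NormedSpace ℂ V] {B : BorelSystem J V}
  {ω : ℂ} {H : ℂ → State V →L[ℂ] State V} {e : V →L[ℂ] ℂ} {j : Fin J}

theorem apply_E (he : ∀ v, e (B.E j v) = e v) (i : Fin J) (v : V) :
    e (B.E i v) = if i = j then e v else 0 := by
  split_ifs with h
  · rw [h, he]
  · rw [← he, E_comp_E, if_neg (Ne.symm h), map_zero]

theorem apply_readout (he : ∀ v, e (B.E j v) = e v) (ξ : ℂ) (y : State V) :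
    e (B.readout ξ y) = (ξ - B.a j)⁻¹ * e (output y) := by
  rw [readout, sum_apply, map_sum, Finset.sum_eq_single j]
  · rw [smul_apply, map_smul, ContinuousLinearMap.comp_apply, he, smul_eq_mul]
  · intro i _ hi
    rw [smul_apply, map_smul, ContinuousLinearMap.comp_apply, apply_E he, if_neg hi, smul_zero]
  · simp

variable (B ω H e j) in
/-- The coordinate `e` of the solution with initial state `z` of the system reduced to its residue
at `ω`, without its polar part. -/
noncomputable def localReadout (ξ : ℂ) : State V →L[ℂ] ℂ :=
  if B.a j = ω then (e ∘L output) ∘L dslope H 0 ξ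
  else (ω + ξ - B.a j)⁻¹ • ((e ∘L output) ∘L H ξ)

/-- For a_j = ω, dividing H by ξ leaves the difference quotient of H plus ξ⁻¹ times the identity, so
the polar part only sees the output of z. For a_j ≠ ω there is no pole. -/
theorem IsGauge.apply_readout (hH : B.IsGauge ω H) (he : ∀ v, e (B.E j v) = e v) {ξ : ℂ}
    (hξ : ξ ≠ 0) (z : State V) :
    e (B.readout (ω + ξ) (H ξ z)) =
      B.localReadout ω H e j ξ z + if B.a j = ω then ξ⁻¹ * e (output z) else 0 := by
  rw [BorelSystem.apply_readout he, localReadout]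
  split_ifs with hj
  · rw [hj, add_sub_cancel_left, ContinuousLinearMap.comp_apply, dslope_zero_eq hξ, hH.apply_zero,
      smul_apply, sub_apply, map_smul, map_sub, smul_eq_mul]
    simp only [ContinuousLinearMap.comp_apply, one_apply_eq_self]
    ring
  · rw [add_zero]
    rfl

theorem IsGauge.isSummableResurgent_localReadout [CompleteSpace V] (hH : B.IsGauge ω H)
    (hω : ω ∈ Set.range B.a) (e : V →L[ℂ] ℂ) (j : Fin J) (z : State V) :
    IsSummableResurgent ((fun b => b - ω) '' Set.range B.a)
      fun ξ => B.localReadout ω H e j ξ z := by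
  by_cases hj : B.a j = ω
  · have h := hH.isSummableResurgent_dslope hω
      ((e ∘L output) ∘L ContinuousLinearMap.apply ℂ (State V) z)
    simp only [localReadout, if_pos hj]
    exact h
  · have h := hH.isSummableResurgent_inv_mul hω
      ((e ∘L output) ∘L ContinuousLinearMap.apply ℂ (State V) z) hj
    simp only [localReadout, if_neg hj]
    exact h

/-- H and `input` carry the range of T into itself, where the linear form e vanishes. -/
theorem IsGauge.localReadout_input_eq_zero [CompleteSpace V] [FiniteDimensional ℂ V]
    (hH : B.IsGauge ω H) {T : V →L[ℂ] V} (hK : ∀ k v, B.K k (T v) = T (B.K k v))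
    (hE : ∀ j v, B.E j (T v) = T (B.E j v)) (he : ∀ v, e (T v) = 0) (v : V) :
    ∀ᶠ ξ in 𝓝[≠] (0 : ℂ), B.localReadout ω H e j ξ (B.input (T v)) = 0 := by
  filter_upwards [(hH.commute_liftState hK hE).filter_mono nhdsWithin_le_nhds,
    self_mem_nhdsWithin] with ξ h1 h2
  have h3 : e (output (H ξ (B.input (T v)))) = 0 := by
    rw [← liftState_input hK, ← mul_apply_eq_comp, ← h1.eq, mul_apply_eq_comp]
    exact he _
  rw [localReadout]
  split_ifs
  · rw [ContinuousLinearMap.comp_apply, dslope_zero_eq h2, hH.apply_zero, smul_apply, sub_apply,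
      map_smul, map_sub, ContinuousLinearMap.comp_apply, h3, ContinuousLinearMap.comp_apply,
      one_apply_eq_self, output_input, hK, he]
    simp
  · rw [smul_apply, ContinuousLinearMap.comp_apply, ContinuousLinearMap.comp_apply, h3, smul_zero]

end LocalReadout

end BorelSystem

/-! ### Majors -/

theorem isLogGerm_of_analyticOnNhd {φ : ℂ → ℂ} {σ : ℝ} (h : AnalyticOnNhd ℂ φ {s | s.re < σ}) :
    IsLogGerm φ :=
  eventually_logZero_iff.2 ⟨σ, fun s hs => h s hs⟩

theorem IsLogGerm.isMajor {m φ h : ℂ → ℂ} (hφ : IsLogGerm φ) (hh : AnalyticAt ℂ h 0)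
    (hm : ∀ᶠ s in logZero, φ s = m s + h (Complex.exp s)) : IsMajor m φ := by
  refine ⟨?_, hφ, h, hh, hm⟩
  obtain ⟨σ, hσ⟩ := eventually_logZero_iff.1 (hφ.and (hm.and (tendsto_exp_logZero.eventually
    (hh.eventually_analyticAt.filter_mono nhdsWithin_le_nhds))))
  refine eventually_logZero_iff.2 ⟨σ, fun s hs => ?_⟩
  obtain ⟨h1, -, h3⟩ := hσ s hs
  refine (h1.sub (AnalyticAt.fun_comp h3 (by fun_prop))).congr ?_
  filter_upwards [(isOpen_re_lt σ).mem_nhds hs] with t ht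
  rw [Pi.sub_apply, (hσ t ht).2.1]
  simp

/-- Indices with equal λ_ℓ are grouped, and the exponent 0 is treated apart. The condition c (N + 1)
= 0 lets the polar and the regular sums share a range for nonzero exponents. The vanishing of R ℓ 0
when λ_ℓ = 0 matches the absence of p = 0 among the pure logarithms. -/
theorem isSimpleModerate_of_eventually {ι : Type*} {S : Finset ι} {lam : ι → ℂ} {φ h : ℂ → ℂ}
    (hre : ∀ ℓ, 0 ≤ (lam ℓ).re ∧ (lam ℓ).re < 1) (hφ : IsLogGerm φ) (hh : AnalyticAt ℂ h 0)
    {N : ℕ} {μ : ℂ} {c : ℕ → ℂ} {R : ι → ℕ → ℂ → ℂ} (hR : ∀ ℓ p, AnalyticAt ℂ (R ℓ p) 0)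
    (hc : c (N + 1) = 0) (hμ : (∃ ℓ ∈ S, lam ℓ = μ) ∨ ∀ p, c p = 0)
    (hR0 : ∀ ℓ, lam ℓ = 0 → R ℓ 0 = 0)
    (heq : ∀ᶠ s in logZero, φ s = Complex.exp ((μ - 1) * s) *
        ∑ p ∈ Finset.range (N + 1), c p * s ^ p +
      ∑ ℓ ∈ S, Complex.exp (lam ℓ * s) *
        ∑ p ∈ Finset.range (N + 2), R ℓ p (Complex.exp s) * s ^ p + h (Complex.exp s)) :
    IsSimpleModerate (Finset.image lam {ℓ ∈ S | lam ℓ ≠ 0}) φ := by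
  classical
  refine ⟨?_, N, fun p => if μ = 0 then c p else 0, fun p ξ => ∑ ℓ ∈ S with lam ℓ = 0, R ℓ p ξ,
    fun _ => N + 1, fun ν p => if μ = ν then c p else 0,
    fun ν p ξ => ∑ ℓ ∈ S with lam ℓ = ν, R ℓ p ξ,
    fun p => Finset.analyticAt_fun_sum _ fun ℓ _ => hR ℓ p,
    fun ν p => Finset.analyticAt_fun_sum _ fun ℓ _ => hR ℓ p, hφ.isMajor hh ?_⟩
  · intro ν hν
    obtain ⟨ℓ, hℓ, rfl⟩ := Finset.mem_image.1 hν
    exact ⟨(hre ℓ).1, (hre ℓ).2, (Finset.mem_filter.1 hℓ).2⟩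
  filter_upwards [heq] with s hs
  rw [hs]
  congr 1
  set Λ := Finset.image lam {ℓ ∈ S | lam ℓ ≠ 0} with hΛ
  have h1 : Complex.exp ((μ - 1) * s) * ∑ p ∈ Finset.range (N + 1), c p * s ^ p =
      ∑ p ∈ Finset.range (N + 1), (if μ = 0 then c p else 0) * Complex.exp (-s) * s ^ p +
      ∑ ν ∈ Λ, ∑ p ∈ Finset.range (N + 2),
        (if μ = ν then c p else 0) * Complex.exp ((ν - 1) * s) * s ^ p := by
    have h2 : ∀ ν ∈ Λ, ∑ p ∈ Finset.range (N + 2),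
        (if μ = ν then c p else 0) * Complex.exp ((ν - 1) * s) * s ^ p =
        if μ = ν then Complex.exp ((μ - 1) * s) * ∑ p ∈ Finset.range (N + 1), c p * s ^ p
          else 0 := by
      intro ν _
      by_cases hν : μ = ν
      · simp only [if_pos hν]
        rw [Finset.sum_range_succ, hc, zero_mul, zero_mul, add_zero, Finset.mul_sum, hν]
        exact Finset.sum_congr rfl fun p _ => by ring
      · simp [hν]
    rw [Finset.sum_congr rfl h2, Finset.sum_ite_eq]
    by_cases hμ0 : μ = 0
    · have h3 : μ ∉ Λ := by
        rw [hΛ, Finset.mem_image]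
        rintro ⟨ℓ, hℓ, h⟩
        exact (Finset.mem_filter.1 hℓ).2 (h.trans hμ0)
      simp only [if_pos hμ0]
      rw [if_neg h3, add_zero, Finset.mul_sum, hμ0]
      exact Finset.sum_congr rfl fun p _ => by rw [zero_sub, neg_one_mul]; ring
    · simp only [if_neg hμ0, zero_mul, Finset.sum_const_zero, zero_add]
      rcases hμ with ⟨ℓ, hℓ, rfl⟩ | h
      · rw [if_pos (Finset.mem_image_of_mem _ (Finset.mem_filter.2 ⟨hℓ, hμ0⟩))]
      · simp [h]
  have h2 : ∑ ℓ ∈ S with lam ℓ = 0, Complex.exp (lam ℓ * s) *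
      ∑ p ∈ Finset.range (N + 2), R ℓ p (Complex.exp s) * s ^ p =
      ∑ p ∈ Finset.Icc 1 (N + 1), (∑ ℓ ∈ S with lam ℓ = 0, R ℓ p (Complex.exp s)) * s ^ p := by
    simp only [Finset.sum_mul]
    rw [Finset.sum_comm]
    refine Finset.sum_congr rfl fun ℓ hℓ => ?_
    have h3 := (Finset.mem_filter.1 hℓ).2
    rw [h3, zero_mul, Complex.exp_zero, one_mul, Finset.range_eq_Ico,
      Finset.sum_eq_sum_Ico_succ_bot (by omega), hR0 ℓ h3]
    simp only [Pi.zero_apply, zero_mul, zero_add]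
    rfl
  have h3 : ∑ ℓ ∈ S with ¬ lam ℓ = 0, Complex.exp (lam ℓ * s) *
      ∑ p ∈ Finset.range (N + 2), R ℓ p (Complex.exp s) * s ^ p =
      ∑ ν ∈ Λ, ∑ p ∈ Finset.range (N + 2), (∑ ℓ ∈ S with lam ℓ = ν, R ℓ p (Complex.exp s)) *
        Complex.exp (ν * s) * s ^ p := by
    rw [← Finset.sum_fiberwise_of_maps_to (t := Λ) (g := lam)
      fun ℓ hℓ => Finset.mem_image_of_mem lam hℓ]
    refine Finset.sum_congr rfl fun ν hν => ?_
    have hν0 : ν ≠ 0 := by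
      obtain ⟨ℓ, hℓ, rfl⟩ := Finset.mem_image.1 hν
      exact (Finset.mem_filter.1 hℓ).2
    have h4 : {ℓ ∈ {ℓ ∈ S | ¬ lam ℓ = 0} | lam ℓ = ν} = {ℓ ∈ S | lam ℓ = ν} := by
      ext ℓ
      simp only [Finset.mem_filter]
      exact ⟨fun h => ⟨h.1.1, h.2⟩, fun h => ⟨⟨h.1, h.2 ▸ hν0⟩, h.2⟩⟩
    rw [h4]
    simp only [Finset.sum_mul, Finset.mul_sum]
    rw [Finset.sum_comm]
    refine Finset.sum_congr rfl fun p _ => Finset.sum_congr rfl fun ℓ hℓ => ?_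
    rw [(Finset.mem_filter.1 hℓ).2]
    ring
  rw [← Finset.sum_filter_add_sum_filter_not S (fun ℓ => lam ℓ = 0), h1, h2, h3]
  simp only [Finset.sum_add_distrib]
  ring

end LevelOne

namespace LevelOne

/-! ### The logarithmic expansion at ω and the log-degrees of the columns. -/

section Expansion

variable {J : ℕ} [NeZero J] {n : Fin J → ℕ} {a lam : Fin J → ℂ}
  {A F : Matrix (Idx n) (Idx n) ℂ⟦X⟧} {ω : ℂ}

/-- The logarithmic expansion of a solution near `ω`, on the state space. -/
theorem IsFormalSolution.exists_log_state (hn : ∀ j, 0 < n j) (hA : ∀ i k, IsConvergent (A i k))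
    (hF : IsFormalSolution n a lam A F) (hF0 : F.map PowerSeries.constantCoeff = 1)
    {H : ℂ → State (Cols n) →L[ℂ] State (Cols n)} (hH : (borelSystem a hA).IsGauge ω H) {σ : ℝ}
    {y : ℂ → State (Cols n)}
    (hy : SolvesOn (fun s => Complex.exp s • (borelSystem a hA).system (ω + Complex.exp s))
      {s | s.re < σ} y) :
    ∃ (k : Cols n) (v : Fin J → ℕ → Cols n) (z : State (Cols n)) (u : ℂ → State (Cols n)),
      (∀ i q, a i.1 ≠ ω → k i q = 0) ∧
      (∀ ℓ, lam ℓ = 0 → v ℓ 0 = 0) ∧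
      (∀ ℓ p i (q : Fin (n 0)), logDegree (n ℓ) (lam ℓ) q < p → v ℓ p i q = 0) ∧
      (∀ ℓ p, nilpotencyBound n + 2 ≤ p → v ℓ p = 0) ∧
      (∀ s, u s = z + ∑ ℓ with a ℓ = ω, Complex.exp (lam ℓ * s) •
        ∑ p ∈ Finset.range (nilpotencyBound n + 2), s ^ p • (borelSystem a hA).input (v ℓ p)) ∧
      (∀ s i q, a i.1 = ω → BorelSystem.output (u s) i q =
        Complex.exp (lam i.1 * s) * nilExp (nilpotentPart n) (nilpotencyBound n) s k i q) ∧
      ∀ᶠ s in logZero, y s = H (Complex.exp s) (u s) := by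
  set B := borelSystem a hA with hB
  set P := nilpotencyBound n with hP
  obtain ⟨y₀, hy₀⟩ := hH.exists_eq hy
  set k : Cols n := B.proj ω (BorelSystem.output y₀) with hk
  have hkp : B.proj ω k = k := B.proj_proj ω _
  have hksum : ∑ ℓ with a ℓ = ω, rowProj n ℓ k = k := (B.proj_apply ω k).symm.trans hkp
  choose v hv1 hv2 hv3 hv4 hv5 using fun ℓ => exists_log_primitive (P := P)
    (nilpotentPart_pow_succ_eq_zero (n := n)) (lam ℓ) k
  set Φ : Fin J → ℂ → Cols n := fun ℓ s =>
    Complex.exp (lam ℓ * s) • ∑ p ∈ Finset.range (P + 2), s ^ p • v ℓ p with hΦ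
  -- The equation for Ψ decouples into row-blocks, each solved by the primitive of e^{s(λ_ℓ + N)} k
  -- normalized to vanish at s = 0.
  set Ψ : ℂ → Cols n := fun s => ∑ ℓ with a ℓ = ω, rowProj n ℓ (Φ ℓ s - v ℓ 0) with hΨ
  have hΦ0 : ∀ ℓ, Φ ℓ 0 = v ℓ 0 := fun ℓ => by
    simp only [hΦ, mul_zero, Complex.exp_zero, one_smul]
    rw [Finset.sum_eq_single 0]
    · simp
    · intro p _ hp
      rw [zero_pow hp, zero_smul]
    · simp
  have hΨ0 : Ψ 0 = 0 := Finset.sum_eq_zero fun ℓ _ => by rw [hΦ0, sub_self, map_zero]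
  have hexp : ∀ s, k + B.exponent ω (Ψ s) = ∑ ℓ with a ℓ = ω,
      rowProj n ℓ (Complex.exp (lam ℓ * s) • nilExp (nilpotentPart n) P s k) := by
    intro s
    have h1 : k + B.exponent ω (Ψ s) = ∑ ℓ with a ℓ = ω, rowProj n ℓ k +
        ∑ ℓ with a ℓ = ω, B.exponent ω (rowProj n ℓ (Φ ℓ s - v ℓ 0)) := by
      rw [hksum, hΨ, map_sum]
    rw [h1, ← Finset.sum_add_distrib]
    refine Finset.sum_congr rfl fun ℓ hℓ => ?_
    rw [hF.exponent_rowProj hA hF0 (Finset.mem_filter.1 hℓ).2, ← map_add, ← hv2 ℓ s]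
  have hΨd : ∀ s, HasDerivAt Ψ (k + B.exponent ω (Ψ s)) s := by
    intro s
    rw [hexp]
    exact HasDerivAt.fun_sum fun ℓ _ =>
      (rowProj n ℓ).hasFDerivAt.comp_hasDerivAt s ((hv1 ℓ s).sub_const (v ℓ 0))
  have hproj : ∀ s, B.proj ω (Ψ s) = Ψ s := by
    intro s
    rw [hΨ, map_sum]
    refine Finset.sum_congr rfl fun ℓ hℓ => ?_
    exact (B.proj_E ω ℓ _).trans (if_pos (Finset.mem_filter.1 hℓ).2)
  -- The state `z` collects what carries no power of ξ or logarithm: y₀ and the normalization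
  -- constants of the primitives.
  refine ⟨k, fun ℓ p => rowProj n ℓ (v ℓ p),
    y₀ - ∑ ℓ with a ℓ = ω, B.input (rowProj n ℓ (v ℓ 0)), fun s => y₀ + B.input (Ψ s), ?_, ?_, ?_,
    ?_, ?_, ?_, ?_⟩
  · intro i q hi
    rw [hk, hB, borelSystem_proj_apply, if_neg hi]
  · intro ℓ hℓ
    simp only [(hv4 ℓ hℓ).1, map_zero]
  · intro ℓ p ⟨j, r⟩ q hp
    simp only [rowProj_apply]
    split_ifs with hj
    · subst hj
      unfold logDegree at hp
      split_ifs at hp with h0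
      · obtain ⟨p, rfl⟩ : ∃ p', p = p' + 1 := ⟨p - 1, by omega⟩
        obtain ⟨x, hx⟩ := (hv4 j h0).2 p
        rw [hx]
        exact nilpotentPart_pow_apply_eq_zero x p j r q (by omega)
      · obtain ⟨x, hx⟩ := hv3 j h0 p
        rw [hx]
        have := hn j
        exact nilpotentPart_pow_apply_eq_zero x p j r q (by omega)
    · rfl
  · intro ℓ p hp
    simp only [hv5 ℓ p hp, map_zero]
  · intro s
    simp only [hΨ, hΦ, map_sub, map_sum, map_smul, Finset.sum_sub_distrib]
    abel
  · intro s i q hi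
    -- On rows with a_i = ω the output of the state is k + `exponent` Ψ = Ψ', which is why the polar
    -- part has the closed form with a single constant matrix.
    have h1 := congrFun (congrFun (hexp s) i) q
    rw [BorelSystem.exponent_apply, hproj, Pi.add_apply, Pi.add_apply, hk, hB,
      borelSystem_proj_apply, borelSystem_proj_apply, if_pos hi, if_pos hi, Finset.sum_apply,
      Finset.sum_apply, Finset.sum_eq_single i.1] at h1
    · rw [map_add, BorelSystem.output_input, Pi.add_apply, Pi.add_apply]
      rw [rowProj_apply, if_pos rfl, Pi.smul_apply, Pi.smul_apply, smul_eq_mul] at h1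
      exact h1
    · intro ℓ _ hℓ
      rw [rowProj_apply, if_neg (Ne.symm hℓ)]
    · intro h
      exact absurd (Finset.mem_filter.2 ⟨Finset.mem_univ i.1, hi⟩) h
  · filter_upwards [hy₀ Ψ hΨ0 hΨd] with s hs
    rw [hs, hproj]

theorem kernel_rightJordan_pow (A : Matrix (Idx n) (Idx n) ℂ⟦X⟧) (k m : ℕ) (X : Cols n) :
    kernel A k ((rightJordan n ^ m) X) = (rightJordan n ^ m) (kernel A k X) := by
  have h1 : Commute (kernel A k) (rightJordan n) := by
    refine Commute.sub_left ?_ ?_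
    · ext1 X
      exact leftMul_rightJordan _ X
    · split_ifs
      · exact Commute.refl _
      · exact Commute.zero_left _
  exact congrArg (fun T : Cols n →L[ℂ] Cols n => T X) (h1.pow_right m).eq

theorem rowProj_rightJordan_pow (j : Fin J) (m : ℕ) (X : Cols n) :
    rowProj n j ((rightJordan n ^ m) X) = (rightJordan n ^ m) (rowProj n j X) := by
  have h1 : Commute (rowProj n j) (rightJordan n) := by
    ext1 X
    exact rowProj_rightJordan j X
  exact congrArg (fun T : Cols n →L[ℂ] Cols n => T X) (h1.pow_right m).eq

theorem entry_rowProj (i : Idx n) (q : Fin (n 0)) (X : Cols n) :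
    entry i q (rowProj n i.1 X) = entry i q X := by
  simp

/-- The system is triangular with respect to the columns. -/
theorem localReadout_eq_zero (hA : ∀ i k, IsConvergent (A i k))
    {H : ℂ → State (Cols n) →L[ℂ] State (Cols n)} (hH : (borelSystem a hA).IsGauge ω H)
    {X : Cols n} {q : Fin (n 0)} (hX : ∀ i (p : Fin (n 0)), p ≤ q → X i p = 0) (i : Idx n)
    (j : Fin J) :
    ∀ᶠ ξ in 𝓝[≠] (0 : ℂ), (borelSystem a hA).localReadout ω H (entry i q) j ξ
      ((borelSystem a hA).input X) = 0 := by
  -- X is the image of Y under right multiplication by J₁^{q+1}, and every such image has zero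
  -- column q.
  obtain ⟨Y, rfl⟩ := exists_eq_rightJordan_pow (q := q) fun i p hp => hX i p (Fin.le_def.2 hp)
  refine hH.localReadout_input_eq_zero (fun k v => kernel_rightJordan_pow A k _ v)
    (fun j v => rowProj_rightJordan_pow j _ v) (fun v => ?_) Y
  rw [entry_apply, rightJordan_pow_apply, dif_neg (by omega)]

theorem nilExp_apply (s : ℂ) (X : Cols n) (P : ℕ) (i : Idx n) (q : Fin (n 0)) :
    nilExp (nilpotentPart n) P s X i q = ∑ p ∈ Finset.range (P + 1),
      (p.factorial : ℂ)⁻¹ * (nilpotentPart n ^ p) X i q * s ^ p := by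
  rw [nilExp, Finset.sum_apply, Finset.sum_apply]
  refine Finset.sum_congr rfl fun p _ => ?_
  simp only [Pi.smul_apply, smul_eq_mul]
  ring

/-- The expansion at `ω` of a solution, defined on the Riemann surface of the logarithm over a
punctured disc. -/
theorem IsFormalSolution.exists_expansion (hn : ∀ j, 0 < n j) (hA : ∀ i k, IsConvergent (A i k))
    (hF : IsFormalSolution n a lam A F) (hF0 : F.map PowerSeries.constantCoeff = 1)
    (hre : ∀ j, 0 ≤ (lam j).re ∧ (lam j).re < 1) (hω : ω ∈ Set.range a) {σ : ℝ}
    {y : ℂ → State (Cols n)}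
    (hy : SolvesOn (fun s => Complex.exp s • (borelSystem a hA).system (ω + Complex.exp s))
      {s | s.re < σ} y) {φ : Idx n → Fin (n 0) → ℂ → ℂ} (hφ : ∀ i q, IsLogGerm (φ i q))
    (hφy : ∀ i q s, φ i q s = entry i q ((borelSystem a hA).readout (ω + Complex.exp s) (y s))) :
    ∃ (k : (j : Fin J) → Matrix (Fin (n j)) (Fin (n 0)) ℂ)
      (R : Fin J → ℕ → ℂ → Matrix (Idx n) (Fin (n 0)) ℂ),
      (∀ j, a j ≠ ω → k j = 0) ∧
      (∀ ℓ p i q, IsSummableResurgent ((fun b => b - ω) '' Set.range a) (fun ξ => R ℓ p ξ i q)) ∧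
      (∀ j i q, IsMajor
        (fun s =>
          Complex.exp ((lam j - 1) * s) *
            (matPow s (jordan (n j)) * k j * matPow s (-jordan (n 0))) i q +
          ∑ ℓ with a ℓ = ω, Complex.exp (lam ℓ * s) *
            ∑ p ∈ Finset.range (logDegree (n ℓ) (lam ℓ) q + 1),
              R ℓ p (Complex.exp s) ⟨j, i⟩ q * s ^ p)
        (φ ⟨j, i⟩ q)) ∧
      (∀ i q, IsSimpleModerate (Finset.image lam {ℓ | a ℓ = ω ∧ lam ℓ ≠ 0}) (φ i q)) := by
  obtain ⟨H, hH⟩ := (borelSystem a hA).exists_isGauge ω (hF.hasGoodExponents hA hF0 hre ω)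
  obtain ⟨k, v, z, u, hk, hv0, hvq, hvP, hu, hout, hyu⟩ := hF.exists_log_state hn hA hF0 hH hy
  set B := borelSystem a hA with hB
  set P := nilpotencyBound n with hP
  set L : Idx n → Fin (n 0) → ℂ → State (Cols n) →L[ℂ] ℂ := fun i q =>
    B.localReadout ω H (entry i q) i.1 with hL
  have hLres : ∀ i q z, IsSummableResurgent ((fun b => b - ω) '' Set.range a)
      fun ξ => L i q ξ z := fun i q z => hH.isSummableResurgent_localReadout hω (entry i q) i.1 z
  -- Three contributions: the polar part, the logarithmic part with resurgent coefficients, and the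
  -- holomorphic germ coming from `z`, which a major may drop.
  have hmain : ∀ i q, ∀ᶠ s in logZero, φ i q s =
      Complex.exp ((lam i.1 - 1) * s) * nilExp (nilpotentPart n) P s k i q +
      ∑ ℓ with a ℓ = ω, Complex.exp (lam ℓ * s) * ∑ p ∈ Finset.range (P + 2),
        L i q (Complex.exp s) (B.input (v ℓ p)) * s ^ p + L i q (Complex.exp s) z := by
    intro i q
    filter_upwards [hyu] with s hs
    have h1 : (if B.a i.1 = ω then (Complex.exp s)⁻¹ * entry i q (BorelSystem.output (u s)) else 0)
        = Complex.exp ((lam i.1 - 1) * s) * nilExp (nilpotentPart n) P s k i q := by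
      split_ifs with hi
      · rw [entry_apply, hout s i q hi, sub_mul, one_mul, Complex.exp_sub]
        ring
      · have h2 : nilExp (nilpotentPart n) P s k i q = 0 := by
          obtain ⟨j, r⟩ := i
          rw [hP, ← matPow_mul_mul_matPow]
          have h3 : (Matrix.of fun r q => k ⟨j, r⟩ q) = 0 := by
            ext r q
            exact hk ⟨j, r⟩ q hi
          rw [h3]
          simp
        rw [h2, mul_zero]
    rw [hφy, hs, hH.apply_readout (entry_rowProj i q) (Complex.exp_ne_zero s), h1, add_comm,
      add_assoc]
    congr 1
    change L i q (Complex.exp s) (u s) = _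
    rw [hu, map_add, map_sum, add_comm]
    simp only [map_smul, map_sum, smul_eq_mul]
    congr 1
    refine Finset.sum_congr rfl fun ℓ _ => ?_
    congr 1
    exact Finset.sum_congr rfl fun p _ => mul_comm _ _
  refine ⟨fun j => Matrix.of fun r q => k ⟨j, r⟩ q,
    fun ℓ p ξ => Matrix.of fun i q => L i q ξ (B.input (v ℓ p)), ?_, ?_, ?_, ?_⟩
  · intro j hj
    ext r q
    exact hk ⟨j, r⟩ q hj
  · exact fun ℓ p i q => hLres i q _
  · intro j r q
    refine (hφ ⟨j, r⟩ q).isMajor (hLres ⟨j, r⟩ q z).1.1 ?_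
    have h1 : ∀ᶠ ξ in 𝓝[≠] (0 : ℂ), ∀ ℓ, ∀ p ∈ Finset.range (P + 2),
        logDegree (n ℓ) (lam ℓ) q < p → L ⟨j, r⟩ q ξ (B.input (v ℓ p)) = 0 := by
      refine eventually_all.2 fun ℓ => (Finset.eventually_all _).2 fun p _ => ?_
      by_cases hp : logDegree (n ℓ) (lam ℓ) q < p
      -- The log-degree increases with the column, so a vector beyond the bound of column q vanishes
      -- in all earlier columns too, as triangularity requires.
      · have hX : ∀ i (q' : Fin (n 0)), q' ≤ q → v ℓ p i q' = 0 := by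
          intro i q' hq'
          refine hvq ℓ p i q' (lt_of_le_of_lt ?_ hp)
          have : (q' : ℕ) ≤ q := hq'
          unfold logDegree
          split_ifs <;> omega
        filter_upwards [localReadout_eq_zero hA hH hX ⟨j, r⟩ j] with ξ hξ _ using hξ
      · exact Eventually.of_forall fun ξ h => absurd h hp
    filter_upwards [hmain ⟨j, r⟩ q, tendsto_exp_logZero.eventually h1] with s hs h2
    rw [hs, matPow_mul_mul_matPow]
    congr 2
    refine Finset.sum_congr rfl fun ℓ _ => ?_
    congr 1
    simp only [Matrix.of_apply]
    set D := logDegree (n ℓ) (lam ℓ) q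
    -- The two ranges are compared inside a common one: beyond the nilpotency bound the vectors
    -- vanish, beyond the log-degree their readouts do.
    calc _ = ∑ p ∈ Finset.range (max (P + 2) (D + 1)),
          L ⟨j, r⟩ q (Complex.exp s) (B.input (v ℓ p)) * s ^ p := by
          refine Finset.sum_subset (Finset.range_mono (le_max_left _ _)) fun p _ hp => ?_
          rw [hvP ℓ p (not_lt.1 fun h => hp (Finset.mem_range.2 h))]
          simp
      _ = _ := by
          refine (Finset.sum_subset (Finset.range_mono (le_max_right _ _)) fun p _ hp => ?_).symm
          by_cases hpP : p ∈ Finset.range (P + 2)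
          · rw [h2 ℓ p hpP (by rw [Finset.mem_range] at hp; omega), zero_mul]
          · rw [hvP ℓ p (not_lt.1 fun h => hpP (Finset.mem_range.2 h))]
            simp
  · intro i q
    have h1 := isSimpleModerate_of_eventually (S := {ℓ | a ℓ = ω}) (N := P) (μ := lam i.1)
      (c := fun p => (p.factorial : ℂ)⁻¹ * (nilpotentPart n ^ p) k i q)
      (R := fun ℓ p ξ => L i q ξ (B.input (v ℓ p))) hre (hφ i q) (hLres i q z).1.1
      (fun ℓ p => (hLres i q _).1.1) ?_ ?_ ?_ ?_
    · rwa [Finset.filter_filter] at h1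
    · simp only [hP]
      rw [nilpotentPart_pow_succ_eq_zero]
      exact mul_zero _
    · by_cases hi : a i.1 = ω
      · exact Or.inl ⟨i.1, Finset.mem_filter.2 ⟨Finset.mem_univ _, hi⟩, rfl⟩
      · refine Or.inr fun p => ?_
        have h2 : rowProj n i.1 ((nilpotentPart n ^ p) k) = 0 := by
          have h3 : rowProj n i.1 k = 0 := by
            ext i' q'
            rw [rowProj_apply]
            split_ifs with h
            · exact hk i' q' (h ▸ hi)
            · rfl
          have h4 : Commute (rowProj n i.1) (nilpotentPart n) := by
            ext1 X
            exact rowProj_nilpotentPart i.1 X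
          rw [← mul_apply_eq_comp, (h4.pow_right p).eq, mul_apply_eq_comp, h3, map_zero]
        have h3 := congrFun (congrFun h2 i) q
        rw [rowProj_apply, if_pos rfl] at h3
        rw [h3]
        simp
    · intro ℓ hℓ
      funext ξ
      simp [hv0 ℓ hℓ]
    · filter_upwards [hmain i q] with s hs
      rw [hs, nilExp_apply]

end Expansion

end LevelOne

namespace LevelOne

/-! ### Convergence of the Borel transform and its continuation up to ω. -/

section Continuation

variable {J : ℕ} [NeZero J] {n : Fin J → ℕ} {a lam : Fin J → ℂ}
  {A F : Matrix (Idx n) (Idx n) ℂ⟦X⟧} {ω : ℂ}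

theorem IsTame.differentiableOn_exp_smul {E : Type*} [NormedAddCommGroup E] [NormedSpace ℂ E]
    {Ω U : Set ℂ} {f : ℂ → E} (hf : IsTame Ω f) (hΩ : IsClosed Ω)
    (hU : ∀ s ∈ U, ω + Complex.exp s ∉ Ω) :
    DifferentiableOn ℂ (fun s => Complex.exp s • f (ω + Complex.exp s)) U := by
  intro s hs
  have h1 : DifferentiableAt ℂ f (ω + Complex.exp s) :=
    hf.1.differentiableAt (hΩ.isOpen_compl.mem_nhds (hU s hs))
  have h2 : DifferentiableAt ℂ (fun s => ω + Complex.exp s) s := by fun_prop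
  exact (Complex.differentiable_exp.differentiableAt.smul
    (DifferentiableAt.comp s h1 h2)).differentiableWithinAt

theorem isSumOf_of_hasSeries {f : ℂ → ℂ} {p : ℂ⟦X⟧}
    (h : HasSeries f fun m => PowerSeries.coeff m p) : IsSumOf f p := by
  rw [IsSumOf, hasFPowerSeriesAt_iff]
  simpa [HasSeries, FormalMultilinearSeries.coeff_ofScalars] using h

/-- The Borel transform of the first columns of the formal solution converges, and extends to the
Riemann surface of the logarithm over a punctured disc. -/
theorem IsFormalSolution.exists_continuationNear (hA : ∀ i k, IsConvergent (A i k))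
    (hF : IsFormalSolution n a lam A F) (hF0 : F.map PowerSeries.constantCoeff = 1)
    (ha : a 0 = 0) (hlam : lam 0 = 0) (hre : ∀ j, 0 ≤ (lam j).re ∧ (lam j).re < 1) {r : ℝ}
    (hr : ∀ b ∈ Set.range a, dist b ω < r → b = ω) {z : ℂ} (hz : dist z ω < r)
    (γ : Path (0 : ℂ) z) (hγ : Avoids (Set.range a) γ) {s₁ : ℂ} (hs₁ : ω + Complex.exp s₁ = z) :
    ∃ (y : ℂ → State (Cols n)) (φ : Idx n → Fin (n 0) → ℂ → ℂ),
      SolvesOn (fun s => Complex.exp s • (borelSystem a hA).system (ω + Complex.exp s))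
        {s | s.re < Real.log r} y ∧
      (∀ i q s, φ i q s = entry i q ((borelSystem a hA).readout (ω + Complex.exp s) (y s))) ∧
      ∀ i q, IsContinuationNear (borel (F i ⟨0, q⟩)) γ ω r s₁ (φ i q) := by
  set B := borelSystem a hA with hB
  have hgood := hF.hasGoodExponents hA hF0 hre 0
  obtain ⟨H, hH⟩ := B.exists_isGauge 0 hgood
  obtain ⟨hv, hser⟩ := BorelSystem.hasSeries_regularSolution hH hgood
    (hF.firstCols_eq hA hF0 ha hlam)
  have hΩ : IsClosed (Set.range a) := (Set.finite_range a).isClosed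
  have hr0 : 0 < r := dist_nonneg.trans_lt hz
  have hread : ∀ i q, IsTame (Set.range a) fun ξ => entry i q ∘L B.readout ξ := fun i q =>
    B.isTame_readout.clm_comp (ContinuousLinearMap.compL ℂ (State (Cols n)) (Cols n) ℂ (entry i q))
  -- All entries are continued at once from a single solution y₁, so that one state describes them
  -- all near z.
  obtain ⟨y₁, hy₁, hcont⟩ := exists_continuation_of_solution hΩ ⟨0, ha⟩ B.isTame_system
    (BorelSystem.hasDerivAt_regularState hH hv) γ hγ (Idx n × Fin (n 0))
    (fun x ξ => entry x.1 x.2 (B.regularSolution H (firstCols F 0) ξ))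
    (fun x ξ => entry x.1 x.2 ∘L B.readout ξ) (fun _ _ => 0)
    (fun x => ((entry x.1 x.2).analyticAt _).comp (BorelSystem.analyticAt_regularSolution hH _))
    (fun x => hread x.1 x.2) (fun _ => isTame_const 0) (fun x => by
      filter_upwards [self_mem_nhdsWithin] with ξ hξ
      rw [BorelSystem.regularSolution_eq hH hv hξ]
      simp)
  -- In the coordinate s the punctured disc becomes a half-plane, which is convex and free of
  -- singularities, so the solution extends to all of it.
  have hmem : ∀ s : ℂ, s.re < Real.log r → ω + Complex.exp s ∉ Set.range a := by
    intro s hs hmem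
    have h1 := hr _ hmem (by
      rw [dist_eq_norm, add_sub_cancel_left, Complex.norm_exp]
      exact (Real.lt_log_iff_exp_lt hr0).1 hs)
    exact Complex.exp_ne_zero s (add_eq_left.1 h1)
  have hs₁r : s₁.re < Real.log r := by
    rw [Real.lt_log_iff_exp_lt hr0, ← Complex.norm_exp]
    rwa [← hs₁, dist_eq_norm, add_sub_cancel_left] at hz
  have hdiff : DifferentiableOn ℂ (fun s => Complex.exp s • B.system (ω + Complex.exp s))
      {s | s.re < Real.log r} :=
    B.isTame_system.differentiableOn_exp_smul hΩ hmem
  obtain ⟨y, hy, hys₁⟩ := exists_solvesOn (convex_re_lt (Real.log r)) (isOpen_re_lt _) hdiff hs₁r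
    (y₁ z)
  have hopen := (isOpen_re_lt (Real.log r)).mem_nhds hs₁r
  have hyy : y =ᶠ[𝓝 s₁] fun s => y₁ (ω + Complex.exp s) := by
    refine (hy.solvesAt (isOpen_re_lt _) hs₁r).eventuallyEq
      (SolvesAt.comp_exp (by rw [hs₁]; exact hy₁)) ?_ (by rw [hys₁, hs₁])
    filter_upwards [hopen] with s hs
    exact (hdiff.differentiableAt ((isOpen_re_lt _).mem_nhds hs)).continuousAt
  refine ⟨y, fun i q s => entry i q (B.readout (ω + Complex.exp s) (y s)), hy, fun _ _ _ => rfl,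
    fun i q => ?_⟩
  obtain ⟨g, hg, hg0, hg1⟩ := hcont (i, q)
  refine ⟨g, ?_, hg, fun s hs => ?_, ?_⟩
  · rw [hg0]
    refine isSumOf_of_hasSeries ?_
    convert hser.clm (entry i q) using 2 with m
    simp only [borel, PowerSeries.coeff_mk, map_smul, entry_apply, smul_eq_mul, firstCols]
    ring
  · have h1 : AnalyticAt ℂ (fun ξ => entry i q ∘L B.readout ξ) (ω + Complex.exp s) :=
      (hread i q).1.analyticAt (hΩ.isOpen_compl.mem_nhds (hmem s hs))
    have h2 : AnalyticAt ℂ (fun s => entry i q ∘L B.readout (ω + Complex.exp s)) s :=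
      AnalyticAt.fun_comp (f := fun s => ω + Complex.exp s) h1 (by fun_prop)
    have h3 := analyticAt_clm_apply h2 (hy.analyticOnNhd (isOpen_re_lt _) s hs)
    exact h3
  · have hc : Tendsto (fun s => ω + Complex.exp s) (𝓝 s₁) (𝓝 z) := by
      rw [← hs₁]
      exact (by fun_prop : Continuous fun s => ω + Complex.exp s).tendsto s₁
    filter_upwards [hyy, hc.eventually hg1] with s h1 h2
    rw [h1, h2]
    simp

end Continuation

end LevelOne

/-! ### The main theorem. -/

theorem mainTheorem3 {J : ℕ} [NeZero J] (n : Fin J → ℕ) (hn : ∀ j, 0 < n j)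
    (a lam : Fin J → ℂ)
    (ha : a 0 = 0) (hlam : lam 0 = 0)
    (hre : ∀ j, 0 ≤ (lam j).re ∧ (lam j).re < 1)
    (A F : Matrix (LevelOne.Idx n) (LevelOne.Idx n) ℂ⟦X⟧)
    (hA : ∀ i k, LevelOne.IsConvergent (A i k))
    (hF0 : F.map PowerSeries.constantCoeff = 1)
    (hF : LevelOne.IsFormalSolution n a lam A F)
    (ω : ℂ) (hω : ω ∈ Set.range a)
    (r : ℝ) (hr : ∀ b ∈ Set.range a, dist b ω < r → b = ω)
    (z : ℂ) (hz : dist z ω < r)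
    (γ : Path (0 : ℂ) z) (hγ : LevelOne.Avoids (Set.range a) γ)
    (s₁ : ℂ) (hs₁ : ω + Complex.exp s₁ = z) :
    ∃ (φ : LevelOne.Idx n → Fin (n 0) → ℂ → ℂ)
      (k : (j : Fin J) → Matrix (Fin (n j)) (Fin (n 0)) ℂ)
      (R : Fin J → ℕ → ℂ → Matrix (LevelOne.Idx n) (Fin (n 0)) ℂ),
      (∀ i q, LevelOne.IsContinuationNear (LevelOne.borel (F i ⟨0, q⟩)) γ ω r s₁ (φ i q)) ∧
      (∀ j, a j ≠ ω → k j = 0) ∧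
      (∀ ℓ p i q, LevelOne.IsSummableResurgent ((fun b => b - ω) '' Set.range a)
        (fun ξ => R ℓ p ξ i q)) ∧
      (∀ j i q, LevelOne.IsMajor
        (fun s =>
          Complex.exp ((lam j - 1) * s) *
            (LevelOne.matPow s (LevelOne.jordan (n j)) * k j *
              LevelOne.matPow s (-LevelOne.jordan (n 0))) i q +
          ∑ ℓ with a ℓ = ω, Complex.exp (lam ℓ * s) *
            ∑ p ∈ Finset.range (LevelOne.logDegree (n ℓ) (lam ℓ) q + 1),
              R ℓ p (Complex.exp s) ⟨j, i⟩ q * s ^ p)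
        (φ ⟨j, i⟩ q)) ∧
      (∀ i q, LevelOne.IsSimpleModerate
        (Finset.image lam {ℓ | a ℓ = ω ∧ lam ℓ ≠ 0}) (φ i q)) := by
  obtain ⟨y, φ, hy, hφy, hφ⟩ :=
    hF.exists_continuationNear hA hF0 ha hlam hre hr hz γ hγ hs₁
  obtain ⟨k, R, hk, hR, hmajor, hmod⟩ := hF.exists_expansion hn hA hF0 hre hω hy
    (fun i q => LevelOne.isLogGerm_of_analyticOnNhd (hφ i q).choose_spec.2.2.1) hφy
  exact ⟨φ, k, R, hφ, hk, hR, hmajor, hmod⟩
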